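/- Let $s\ge 1$ be an integer and $r=s(s+1)$. All sites carry quantum spins of length $s$, and all Hamiltonians are Heisenberg Hamiltonians $\sum J_{ij}\,\mathbf s_i\cdot\mathbf s_j$. *Model.* The modified Shastry–Sutherland lattice is obtained from the Shastry–Sutherland square lattice by completing every diagonal, by means of one additional site, to a triangle with uniform coupling $J_1=1$ (type I: diagonals of positive slope, type II: negative slope). Each triangle has four neighbouring triangles of the other type. Two neighbouring triangles are connected by three bonds of strength $J_2=J$, which join one diagonal end of one triangle, a corner of the square containing the other triangle's diagonal, to all three sites of the other triangle. $H(J)$ denotes the Hamiltonian of the finite lattice with $L_1\times L_2$ unit cells ($L_1,L_2\ge1$, one triangle of each type per cell) and periodic boundary conditions (if bonds coincide for very small $L_i$, their strengths add up), and $H_6(J)$ that of two neighbouring triangles. Let $\varphi$ be the singlet (total spin $0$) of one triangle, unique up to scalars, and $\Phi$ the product of the singlets of all triangles. The gap of a Hamiltonian is the difference between its next-lowest and its lowest eigenvalue; $\Delta E(J)$ denotes the gap of $H(J)$. The TSPGS-region of a lattice is the set of all $J\in\mathbb R$ for which $\Phi$ is a ground state of $H(J)$. *Claim.* $\varphi$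 is the unique ground state of a single triangle. For $J\in\mathbb R$ let $f(J)$ be the lowest real root $x$ of $$-(x-4)(x-2)(x-1)-(x-1)(2x-5)J+(1-3r-x+rx)J^2+rJ^3=0 .$$ 1. Whenever $f(J)>0$, the product of the two trimer singlets is the unique ground state of $H_6(J)$, and $f(J)$ is the gap of $H_6(J)$. 2. For every lattice size and every $J\in\mathbb R$, $\Delta E(J)\ge f(4J)$. 3. There are numbers $J_L^{(1)}<0<J_L^{(2)}$, depending only on $s$, such that $f(4J)>0$ if and only if $J_L^{(1)}<J<J_L^{(2)}$. For every lattice size, $\Phi$ is the unique ground state of $H(J)$ for all these $J$, and the TSPGS-region is an interval $[J^{c1},J^{c2}]$ with $$J^{c1}<J_L^{(1)}<0<J_L^{(2)}<J^{c2}.$$ 4. For $s=1$, $J_L^{(1)}=\frac{3-\sqrt{73}}{16}$ and $J_L^{(2)}=\frac14$; hence $J^{c1}<\frac{3-\sqrt{73}}{16}<\frac14<J^{c2}$. -/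

import Mathlib

open scoped Matrix

noncomputable section

namespace ShastrySutherland

/-! Spin-`s` systems with integer `s`. The local space is `ℂ ^ (2 s + 1)` with the standard basis
`k = 0, …, 2 s` of magnetic quantum numbers `m = k - s`; a system with the finite set of sites `ι`
lives on the tensor product of the local spaces, written as functions of configurations
`σ : ι → Fin (2 s + 1)`. -/

/-- The raising operator `S⁺ |m⟩ = √(s (s + 1) - m (m + 1)) |m + 1⟩`. -/
def spinPlus (s : ℕ) : Matrix (Fin (2 * s + 1)) (Fin (2 * s + 1)) ℂ :=
  Matrix.of fun i j =>
    if (i : ℕ) = (j : ℕ) + 1 then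
      ((Real.sqrt ((s : ℝ) * (s + 1) - ((j : ℝ) - s) * ((j : ℝ) - s + 1)) : ℝ) : ℂ)
    else 0

/-- The three components `(Sˣ, Sʸ, Sᶻ)` of the spin operator of a single spin `s`. -/
def spinVec (s : ℕ) : Fin 3 → Matrix (Fin (2 * s + 1)) (Fin (2 * s + 1)) ℂ :=
  ![(1 / 2 : ℂ) • (spinPlus s + (spinPlus s)ᴴ),
    (1 / (2 * Complex.I) : ℂ) • (spinPlus s - (spinPlus s)ᴴ),
    Matrix.diagonal fun k => ((k : ℕ) : ℂ) - (s : ℂ)]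

/-- Operators on the state space of the spins located at the sites `ι`. -/
abbrev Operator (s : ℕ) (ι : Type) : Type :=
  Matrix (ι → Fin (2 * s + 1)) (ι → Fin (2 * s + 1)) ℂ

/-- State vectors of the spins located at the sites `ι`. -/
abbrev StateVec (s : ℕ) (ι : Type) : Type := (ι → Fin (2 * s + 1)) → ℂ

section Systems

variable {s : ℕ} {ι : Type} [Fintype ι] [DecidableEq ι]

/-- The one-site operator `M` acting at site `i`, tensored with the identity elsewhere. -/
def siteOp (i : ι) (M : Matrix (Fin (2 * s + 1)) (Fin (2 * s + 1)) ℂ) : Operator s ι :=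
  Matrix.of fun σ τ => if ∀ j, j ≠ i → σ j = τ j then M (σ i) (τ i) else 0

variable (s) in
/-- The Heisenberg bond `𝐬ᵢ ⬝ 𝐬ⱼ`. -/
def bond (i j : ι) : Operator s ι :=
  ∑ a : Fin 3, siteOp i (spinVec s a) * siteOp j (spinVec s a)

variable (s ι) in
/-- The component `a` of the total spin. -/
def totalSpin (a : Fin 3) : Operator s ι := ∑ i : ι, siteOp i (spinVec s a)

end Systems

section Spectrum

variable {n : Type} [Fintype n]

/-- The set of (real) energy eigenvalues. -/
def energies (A : Matrix n n ℂ) : Set ℝ :=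
  {E | ∃ ψ : n → ℂ, ψ ≠ 0 ∧ A *ᵥ ψ = (E : ℂ) • ψ}

/-- `ψ` is a ground state: a nonzero eigenvector to the lowest energy. -/
def IsGroundState (A : Matrix n n ℂ) (ψ : n → ℂ) : Prop :=
  ψ ≠ 0 ∧ ∃ E : ℝ, IsLeast (energies A) E ∧ A *ᵥ ψ = (E : ℂ) • ψ

/-- `ψ` is a ground state and, up to scalars, the only one. -/
def IsUniqueGroundState (A : Matrix n n ℂ) (ψ : n → ℂ) : Prop :=
  IsGroundState A ψ ∧ ∀ χ : n → ℂ, IsGroundState A χ → ∃ c : ℂ, χ = c • ψ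

/-- `δ` is the difference between the next-lowest energy and the lowest energy. -/
def IsGap (A : Matrix n n ℂ) (δ : ℝ) : Prop :=
  ∃ E₀ E₁ : ℝ, IsLeast (energies A) E₀ ∧ IsLeast {E | E ∈ energies A ∧ E₀ < E} E₁ ∧ δ = E₁ - E₀

end Spectrum

/-! A single triangle with unit coupling, its singlet, and systems of triangles indexed by `T`,
whose sites are the pairs `(t, c)` of a triangle `t : T` and a corner `c : Fin 3`. -/

/-- The Hamiltonian of a single uniform triangle with coupling constant `1`. -/
def trimerHamiltonian (s : ℕ) : Operator s (Fin 3) := bond s 0 1 + bond s 0 2 + bond s 1 2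

/-- `φ` is a (nonzero) state of total spin zero of three spins. -/
def IsTrimerSinglet (s : ℕ) (φ : StateVec s (Fin 3)) : Prop :=
  φ ≠ 0 ∧ ∀ a : Fin 3, totalSpin s (Fin 3) a *ᵥ φ = 0

section Triangles

variable {s : ℕ} {T : Type} [Fintype T] [DecidableEq T]

/-- The product of copies of the trimer state `φ`, one for each triangle. -/
def productState (φ : StateVec s (Fin 3)) : StateVec s (T × Fin 3) :=
  fun σ => ∏ t : T, φ fun c => σ (t, c)

variable (s) in
/-- The three bonds inside the triangle `t`. -/
def triangle (t : T) : Operator s (T × Fin 3) :=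
  bond s (t, 0) (t, 1) + bond s (t, 0) (t, 2) + bond s (t, 1) (t, 2)

variable (s) in
/-- The three bonds that connect the corner `c` of the triangle `t` to all corners of `t'`. -/
def threeBonds (t : T) (c : Fin 3) (t' : T) : Operator s (T × Fin 3) :=
  ∑ d : Fin 3, bond s (t, c) (t', d)

end Triangles

/-- The Hamiltonian `H₆` of two neighbouring triangles, with `J₁ = 1` and `J₂ = J`. -/
def H6 (s : ℕ) (J : ℝ) : Operator s (Fin 2 × Fin 3) :=
  triangle s 0 + triangle s 1 + (J : ℂ) • threeBonds s 1 0 0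

/-- The triangles of the modified Shastry-Sutherland lattice with `L₁ × L₂` unit cells and periodic
boundary conditions: `(0, k)` is the triangle of type I and `(1, k)` the one of type II in the
cell `k`. In the square lattice with integer coordinates, modulo `(2 L₁, 0)` and `(0, 2 L₂)`,

* the corners 0, 1 of `(0, k)` are the sites `2 k + (0, 0)`, `2 k + (1, 1)` (positive slope);
* the corners 0, 1 of `(1, k)` are the sites `2 k + (1, 2)`, `2 k + (2, 1)` (negative slope).

Corner 2 is the additional site that completes the diagonal to a triangle. -/
abbrev Triangle (L₁ L₂ : ℕ) : Type := Fin 2 × (ZMod L₁ × ZMod L₂)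

/-- The Hamiltonian of the modified Shastry-Sutherland lattice with `J₁ = 1` and `J₂ = J`. A square
with a diagonal has two more corners; these are ends of diagonals of the other type, and each of
them is connected by bonds of strength `J` to all three sites of the triangle in the square.
(For side lengths so small that some of these bonds coincide, their strengths add up.) -/
def latticeHamiltonian (s L₁ L₂ : ℕ) [NeZero L₁] [NeZero L₂] (J : ℝ) :
    Operator s (Triangle L₁ L₂ × Fin 3) :=
  (∑ t : Triangle L₁ L₂, triangle s t) +
    (J : ℂ) • ∑ k : ZMod L₁ × ZMod L₂,
      (threeBonds s ((1, k) : Triangle L₁ L₂) 0 (0, k + (0, 1)) +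
        threeBonds s ((1, k) : Triangle L₁ L₂) 1 (0, k + (1, 0)) +
        threeBonds s ((0, k) : Triangle L₁ L₂) 1 (1, k) +
        threeBonds s ((0, k) : Triangle L₁ L₂) 0 (1, k - (1, 1)))

/-- The set of couplings `J` for which the trimer-singlet product state is a ground state. -/
def tspgsRegion (s L₁ L₂ : ℕ) [NeZero L₁] [NeZero L₂] : Set ℝ :=
  {J | ∃ φ : StateVec s (Fin 3), IsTrimerSinglet s φ ∧
    IsGroundState (latticeHamiltonian s L₁ L₂ J) (productState φ)}

/-- The cubic polynomial in `x` that determines the gap of `H₆`, for `r = s (s + 1)`. -/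
def gapCubic (r J x : ℝ) : ℝ :=
  -((x - 4) * (x - 2) * (x - 1)) - (x - 1) * (2 * x - 5) * J
    + (1 - 3 * r - x + r * x) * J ^ 2 + r * J ^ 3

end ShastrySutherland

end

open scoped InnerProductSpace

namespace ShastrySutherland

/-! ### Symmetric operators on invariant subspaces -/

section Spectral

variable {V : Type*} [NormedAddCommGroup V] [InnerProductSpace ℂ V]

/-! Up to a constant, the energy of a triangle is half its squared total spin, and the three bonds
between a corner and a neighbouring triangle form the scalar product of the corner spin with the
total spin of that neighbour. The latter annihilates singlets, so `Φ` is an eigenvector for every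
`J`. Each triangle takes part in four connections. Hence `4 H(J)` is, up to a constant, the sum over
all connections of the pair energies `S²/2 + A²/2 + 4J x·S`, where `A` is the triangle with the
corner spin `x` and `S` is the other one (`IsNetwork.sum_pairEnergy`). A state orthogonal to `Φ`
excites at least four connections on average (`IsNetwork.four_mul_le_sum`), so a gap bound for one
pair at `4J` is a gap bound for the lattice at `J`.

In a pair, `S² = j(j+1)` is conserved. For `j = 0` the coupling vanishes. For `j = 1` and `T = x·S`,
a singlet `w` of `A` generates the invariant space of `w, Tw, T²w`, on which the energy has the
given cubic as characteristic polynomial (`IsPair.energy_levels`, `IsPair.root_or_orthogonal`). All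
other states must lie above the lowest root `f`. This uses that the energy is affine in `J`: write
`J = u z` with `0 ≤ u ≤ 1` and `z` an endpoint, a coupling at which the lowest root is `0`. At `z`
these states have nonnegative energy, by the extreme values of `x·S` and, in the delicate case `j =
2`, by a resolvent estimate (`resolvent_moment_bound`). Interpolation with `J = 0` leaves at least
`2(1 - u)`, and the cubic is nonpositive at that point, so `f ≤ 2(1 - u)` (`gapCubic_nonpos_of_mul`,
`IsPair.le_re_inner_energy`).

For the strict inequalities, consider a lattice state of lowest energy at `4J = z`. It has zero
energy in every pair, so all triangles have spin at most one. Where a triangle has spin one, each of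
its two connecting corners would force the remaining two spins into a singlet, which is impossible
for both at once (`IsEndpoint.sub_apply_casimirA`, `IsPair.eq_zero_of_corners`). So `Φ` is still the
only ground state, and since the coupling annihilates it, it survives a small further change of `J`
(`exists_pos_perturbation`). The region is a compact interval because it is cut out by conditions
affine in `J`, and polarized states bound it on both sides. -/

theorem re_inner_eq_sum_of_eigenbasis {X : Module.End ℂ V} {W : Submodule ℂ V} {n : ℕ}
    (b : OrthonormalBasis (Fin n) ℂ W) {e : Fin n → ℝ}
    (he : ∀ i, X (b i) = (e i : ℂ) • (b i : V)) {ψ : V} (hψ : ψ ∈ W) :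
    (⟪ψ, X ψ⟫_ℂ).re = ∑ i, e i * ‖⟪(b i : V), ψ⟫_ℂ‖ ^ 2 ∧
      ‖ψ‖ ^ 2 = ∑ i, ‖⟪(b i : V), ψ⟫_ℂ‖ ^ 2 := by
  constructor
  · have h1 : ⟪ψ, X ψ⟫_ℂ = ∑ i, (e i : ℂ) * (‖⟪(b i : V), ψ⟫_ℂ‖ ^ 2 : ℝ) := by
      have hs : ψ = ∑ i, ⟪(b i : V), ψ⟫_ℂ • (b i : V) := by
        have := congrArg Subtype.val (b.sum_repr' ⟨ψ, hψ⟩)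
        simpa using this.symm
      have h2 : ⟪ψ, X ψ⟫_ℂ = ⟪ψ, X (∑ i, ⟪(b i : V), ψ⟫_ℂ • (b i : V))⟫_ℂ := by rw [← hs]
      rw [h2, map_sum, inner_sum]
      refine Finset.sum_congr rfl fun i _ => ?_
      rw [map_smul, he, smul_smul, inner_smul_right, ← inner_conj_symm ψ (b i : V)]
      have := Complex.mul_conj' (⟪(b i : V), ψ⟫_ℂ)
      push_cast
      linear_combination (e i : ℂ) * this
    rw [h1, Complex.re_sum]
    refine Finset.sum_congr rfl fun i _ => ?_
    rw [← Complex.ofReal_mul, Complex.ofReal_re]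
  · have := b.sum_sq_norm_inner_right ⟨ψ, hψ⟩
    simpa using this.symm

variable [FiniteDimensional ℂ V]

/-- A symmetric operator has an orthonormal eigenbasis of each invariant subspace. -/
theorem exists_eigenbasis {X : Module.End ℂ V} (hX : X.IsSymmetric) (W : Submodule ℂ V)
    (hW : ∀ v ∈ W, X v ∈ W) :
    ∃ (n : ℕ) (b : OrthonormalBasis (Fin n) ℂ W) (e : Fin n → ℝ),
      ∀ i, X (b i) = (e i : ℂ) • (b i : V) := by
  have h := hX.restrict_invariant hW
  refine ⟨_, h.eigenvectorBasis rfl, h.eigenvalues rfl, fun i => ?_⟩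
  have := congrArg (Subtype.val) (h.apply_eigenvectorBasis rfl i)
  exact this

theorem le_re_inner_of_eigen {X : Module.End ℂ V} (hX : X.IsSymmetric) (W : Submodule ℂ V)
    (hW : ∀ v ∈ W, X v ∈ W) {m : ℝ}
    (h : ∀ (μ : ℝ) (ψ : V), ψ ∈ W → ψ ≠ 0 → X ψ = (μ : ℂ) • ψ → m ≤ μ) {ψ : V} (hψ : ψ ∈ W) :
    m * ‖ψ‖ ^ 2 ≤ (⟪ψ, X ψ⟫_ℂ).re := by
  obtain ⟨n, b, e, he⟩ := exists_eigenbasis hX W hW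
  obtain ⟨h1, h3⟩ := re_inner_eq_sum_of_eigenbasis b he hψ
  rw [h1, h3, Finset.mul_sum]
  refine Finset.sum_le_sum fun i _ => mul_le_mul_of_nonneg_right ?_ (by positivity)
  exact h (e i) (b i) (b i).2 (by simpa using b.orthonormal.ne_zero i) (he i)

theorem re_inner_pos_of_eigen {X : Module.End ℂ V} (hX : X.IsSymmetric) (W : Submodule ℂ V)
    (hW : ∀ v ∈ W, X v ∈ W)
    (h : ∀ (μ : ℝ) (ψ : V), ψ ∈ W → ψ ≠ 0 → X ψ = (μ : ℂ) • ψ → 0 < μ) {ψ : V} (hψ : ψ ∈ W)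
    (h0 : ψ ≠ 0) : 0 < (⟪ψ, X ψ⟫_ℂ).re := by
  obtain ⟨n, b, e, he⟩ := exists_eigenbasis hX W hW
  obtain ⟨h1, h3⟩ := re_inner_eq_sum_of_eigenbasis b he hψ
  have he0 : ∀ i, 0 < e i := fun i =>
    h (e i) (b i) (b i).2 (by simpa using b.orthonormal.ne_zero i) (he i)
  rw [h1]
  have hpos : 0 < ‖ψ‖ ^ 2 := by positivity
  rw [h3] at hpos
  obtain ⟨i, -, hi⟩ := Finset.exists_lt_of_sum_lt (f := fun _ => (0 : ℝ)) (by simpa using hpos)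
  exact Finset.sum_pos' (fun j _ => mul_nonneg (he0 j).le (by positivity))
    ⟨i, Finset.mem_univ i, mul_pos (he0 i) hi⟩

/-- In an eigenbasis the expectation value is a sum of nonnegative terms, so only components with
eigenvalue zero can be present. -/
theorem apply_eq_zero_of_re_inner_eq_zero {X : Module.End ℂ V} (hX : X.IsSymmetric)
    (hpos : ∀ v, 0 ≤ (⟪v, X v⟫_ℂ).re) {ψ : V} (h : (⟪ψ, X ψ⟫_ℂ).re = 0) : X ψ = 0 := by
  obtain ⟨n, b, e, he⟩ := exists_eigenbasis hX ⊤ (fun _ _ => Submodule.mem_top)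
  obtain ⟨h1, -⟩ := re_inner_eq_sum_of_eigenbasis b he (Submodule.mem_top (x := ψ))
  have he0 : ∀ i, 0 ≤ e i := fun i => by
    have := hpos (b i)
    rw [he, inner_smul_right, inner_self_eq_norm_sq_to_K, Complex.re_ofReal_mul] at this
    have hb : ‖(b i : V)‖ = 1 := b.orthonormal.1 i
    simpa [hb] using this
  rw [h1, Finset.sum_eq_zero_iff_of_nonneg (fun i _ => mul_nonneg (he0 i) (by positivity))] at h
  have hs : ψ = ∑ i, ⟪(b i : V), ψ⟫_ℂ • (b i : V) := by
    have := congrArg Subtype.val (b.sum_repr' ⟨ψ, Submodule.mem_top⟩)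
    simpa using this.symm
  rw [hs, map_sum]
  refine Finset.sum_eq_zero fun i _ => ?_
  rw [map_smul, he, smul_smul]
  rcases mul_eq_zero.1 (h i (Finset.mem_univ i)) with h0 | h0
  · simp [h0]
  · have : ⟪(b i : V), ψ⟫_ℂ = 0 := by simpa using h0
    simp [this]

/-- The eigenvectors of `X` in `W` span `W`. With `Y` a polynomial in `X`, this turns knowledge of
the eigenvalues into an operator identity on `W`. -/
theorem apply_eq_zero_of_eigen {X : Module.End ℂ V} (hX : X.IsSymmetric) (W : Submodule ℂ V)
    (hW : ∀ v ∈ W, X v ∈ W) (Y : Module.End ℂ V)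
    (h : ∀ (μ : ℝ) (ψ : V), ψ ∈ W → ψ ≠ 0 → X ψ = (μ : ℂ) • ψ → Y ψ = 0) {ψ : V} (hψ : ψ ∈ W) :
    Y ψ = 0 := by
  obtain ⟨n, b, e, he⟩ := exists_eigenbasis hX W hW
  have hs : ψ = ∑ i, ⟪(b i : V), ψ⟫_ℂ • (b i : V) := by
    have := congrArg Subtype.val (b.sum_repr' ⟨ψ, hψ⟩)
    simpa using this.symm
  rw [hs, map_sum]
  refine Finset.sum_eq_zero fun i _ => ?_
  rw [map_smul, h (e i) (b i) (b i).2 (by simpa using b.orthonormal.ne_zero i) (he i), smul_zero]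

theorem exists_eigenvector {X : Module.End ℂ V} (hX : X.IsSymmetric) (W : Submodule ℂ V)
    (hW : ∀ v ∈ W, X v ∈ W) {ψ : V} (hψ : ψ ∈ W) (h0 : ψ ≠ 0) :
    ∃ (μ : ℝ) (χ : V), χ ∈ W ∧ χ ≠ 0 ∧ X χ = (μ : ℂ) • χ := by
  by_contra! hcon
  exact h0 (apply_eq_zero_of_eigen hX W hW 1
    (fun μ χ h1 h2 h3 => absurd h3 (hcon μ χ h1 h2)) hψ)

/-- The form of `X` is bounded below if its eigenvalues on joint eigenvectors with `Y` are. -/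
theorem le_re_inner_of_joint_eigen {X Y : Module.End ℂ V} (hX : X.IsSymmetric)
    (hY : Y.IsSymmetric) (hXY : Commute X Y) (W : Submodule ℂ V)
    (hWX : ∀ v ∈ W, X v ∈ W) (hWY : ∀ v ∈ W, Y v ∈ W) {m : ℝ}
    (h : ∀ (μ ν : ℝ) (ψ : V), ψ ∈ W → ψ ≠ 0 → X ψ = (μ : ℂ) • ψ → Y ψ = (ν : ℂ) • ψ → m ≤ μ)
    {ψ : V} (hψ : ψ ∈ W) : m * ‖ψ‖ ^ 2 ≤ (⟪ψ, X ψ⟫_ℂ).re := by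
  refine le_re_inner_of_eigen hX W hWX (fun μ χ hχ h0 hμ => ?_) hψ
  obtain ⟨ν, ξ, hξ, hξ0, hν⟩ := exists_eigenvector hY (W ⊓ X.eigenspace (μ : ℂ)) (fun v hv => by
    have h2 := Module.End.mem_eigenspace_iff.1 hv.2
    refine Submodule.mem_inf.2 ⟨hWY v hv.1, Module.End.mem_eigenspace_iff.2 ?_⟩
    have := LinearMap.congr_fun hXY.eq v
    simp only [Module.End.mul_apply] at this
    rw [this, h2, map_smul]) (ψ := χ) ⟨hχ, Module.End.mem_eigenspace_iff.2 hμ⟩ h0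
  exact h μ ν ξ hξ.1 hξ0 (Module.End.mem_eigenspace_iff.1 hξ.2) hν

end Spectral

/-! ### Angular momentum operators -/

section Spin

variable {V : Type*} [NormedAddCommGroup V] [InnerProductSpace ℂ V]

/-- The square `X₀² + X₁² + X₂²` of a vector operator. -/
def casimir (X : Fin 3 → Module.End ℂ V) : Module.End ℂ V := X 0 * X 0 + X 1 * X 1 + X 2 * X 2

/-- The scalar product of two vector operators. -/
def scalarProd (X Y : Fin 3 → Module.End ℂ V) : Module.End ℂ V :=
  X 0 * Y 0 + X 1 * Y 1 + X 2 * Y 2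

/-- `X₀, X₁, X₂` are angular momentum operators with integer magnetic quantum numbers. -/
structure IsSpin (X : Fin 3 → Module.End ℂ V) : Prop where
  symm : ∀ a, (X a).IsSymmetric
  comm01 : X 0 * X 1 - X 1 * X 0 = Complex.I • X 2
  comm12 : X 1 * X 2 - X 2 * X 1 = Complex.I • X 0
  comm20 : X 2 * X 0 - X 0 * X 2 = Complex.I • X 1
  integral : ∀ (μ : ℝ) (v : V), v ≠ 0 → X 2 v = (μ : ℂ) • v → ∃ m : ℤ, μ = m

theorem isSymmetric_mul_of_commute {A B : Module.End ℂ V} (hA : A.IsSymmetric)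
    (hB : B.IsSymmetric) (h : Commute A B) : (A * B).IsSymmetric := by
  intro x y
  have := LinearMap.congr_fun h.eq y
  simp only [Module.End.mul_apply] at this ⊢
  rw [hA, hB, this]

theorem IsSpin.casimir_symm {X : Fin 3 → Module.End ℂ V} (hX : IsSpin X) :
    (casimir X).IsSymmetric :=
  ((isSymmetric_mul_of_commute (hX.symm 0) (hX.symm 0) (Commute.refl _)).add
    (isSymmetric_mul_of_commute (hX.symm 1) (hX.symm 1) (Commute.refl _))).add
    (isSymmetric_mul_of_commute (hX.symm 2) (hX.symm 2) (Commute.refl _))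

theorem IsSpin.commute_casimir {X : Fin 3 → Module.End ℂ V} (hX : IsSpin X) (a : Fin 3) :
    Commute (casimir X) (X a) := by
  have h01 := hX.comm01
  have h12 := hX.comm12
  have h20 := hX.comm20
  have e1 : X 0 * X 1 = X 1 * X 0 + Complex.I • X 2 := by rw [← h01]; abel
  have e2 : X 1 * X 2 = X 2 * X 1 + Complex.I • X 0 := by rw [← h12]; abel
  have e3 : X 0 * X 2 = X 2 * X 0 - Complex.I • X 1 := by rw [← h20]; abel
  have r1 : ∀ Z, X 0 * (X 1 * Z) = X 1 * (X 0 * Z) + Complex.I • (X 2 * Z) := fun Z => by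
    rw [← mul_assoc, e1, add_mul, mul_assoc, smul_mul_assoc]
  have r2 : ∀ Z, X 1 * (X 2 * Z) = X 2 * (X 1 * Z) + Complex.I • (X 0 * Z) := fun Z => by
    rw [← mul_assoc, e2, add_mul, mul_assoc, smul_mul_assoc]
  have r3 : ∀ Z, X 0 * (X 2 * Z) = X 2 * (X 0 * Z) - Complex.I • (X 1 * Z) := fun Z => by
    rw [← mul_assoc, e3, sub_mul, mul_assoc, smul_mul_assoc]
  show casimir X * X a = X a * casimir X
  unfold casimir
  fin_cases a <;>
  simp [add_mul, mul_add, mul_sub, mul_assoc, e1, e2, e3, r1, r2, r3] <;> module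

/-- The expectation value of the square is the sum of the `‖X a v‖ ^ 2`, so it vanishes only if
every term does. -/
theorem casimir_apply_eq_zero_iff {X : Fin 3 → Module.End ℂ V} (hX : ∀ a, (X a).IsSymmetric)
    {v : V} : casimir X v = 0 ↔ ∀ a, X a v = 0 := by
  constructor
  · intro h
    have h1 : ∀ a, ⟪v, X a (X a v)⟫_ℂ = ((‖X a v‖ ^ 2 : ℝ) : ℂ) := fun a => by
      rw [← hX a, inner_self_eq_norm_sq_to_K]; push_cast; rfl
    have h2 : ⟪v, casimir X v⟫_ℂ = 0 := by rw [h, inner_zero_right]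
    simp only [casimir, LinearMap.add_apply, Module.End.mul_apply, inner_add_right, h1] at h2
    norm_cast at h2
    have : ∀ a, ‖X a v‖ ^ 2 = 0 := by
      intro a
      have p0 := sq_nonneg ‖X 0 v‖
      have p1 := sq_nonneg ‖X 1 v‖
      have p2 := sq_nonneg ‖X 2 v‖
      fin_cases a <;> simp only [Fin.zero_eta, Fin.mk_one, Fin.reduceFinMk] <;> linarith
    intro a
    simpa using this a
  · intro h
    simp [casimir, h]

theorem re_inner_casimir {X : Fin 3 → Module.End ℂ V} (hX : ∀ a, (X a).IsSymmetric) (v : V) :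
    (⟪v, casimir X v⟫_ℂ).re = ∑ a, ‖X a v‖ ^ 2 := by
  have h1 : ∀ a, ⟪v, X a (X a v)⟫_ℂ = ((‖X a v‖ ^ 2 : ℝ) : ℂ) := fun a => by
    rw [← hX a, inner_self_eq_norm_sq_to_K]; push_cast; rfl
  simp only [casimir, LinearMap.add_apply, Module.End.mul_apply, inner_add_right, h1,
    Fin.sum_univ_three]
  norm_cast

/-- With the ladder operators `X₊, X₋`, the square is `X₋ X₊ + X₂ (X₂ + 1)`, and the first term
drops out on a highest-weight vector. -/
theorem IsSpin.casimir_of_raising_eq_zero {X : Fin 3 → Module.End ℂ V} (hX : IsSpin X) {m : ℝ}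
    {u : V} (hm : X 2 u = (m : ℂ) • u) (htop : X 0 u + Complex.I • X 1 u = 0) :
    casimir X u = ((m * (m + 1) : ℝ) : ℂ) • u := by
  have h0 : X 0 u = -(Complex.I • X 1 u) := eq_neg_of_add_eq_zero_left htop
  have h1 := LinearMap.congr_fun hX.comm01 u
  have h3 := congrArg (X 0) htop
  simp only [LinearMap.sub_apply, Module.End.mul_apply, LinearMap.smul_apply, map_add, map_smul,
    hm, map_zero] at h1 h3
  have h4 := congrArg (X 1) htop
  simp only [map_add, map_smul, map_zero] at h4
  simp only [casimir, LinearMap.add_apply, Module.End.mul_apply, hm, map_smul]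
  have hI := Complex.I_mul_I
  linear_combination (norm := module) h3 - Complex.I • h4 - Complex.I • h1 + (hI) • (X 1 (X 1 u))
    - hI • ((m : ℂ) • u)

/-- The square of an integer angular momentum has the eigenvalues `n (n + 1)`. -/
theorem IsSpin.casimir_eigenvalue [FiniteDimensional ℂ V] {X : Fin 3 → Module.End ℂ V}
    (hX : IsSpin X) {σ : ℝ} {v : V}
    (hv : v ≠ 0) (h : casimir X v = (σ : ℂ) • v) : ∃ n : ℕ, σ = n * (n + 1) := by
  set U := (casimir X).eigenspace (σ : ℂ) with hU
  have hUX : ∀ a, ∀ u ∈ U, X a u ∈ U := fun a u hu => by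
    have h2 := Module.End.mem_eigenspace_iff.1 hu
    rw [hU, Module.End.mem_eigenspace_iff]
    have := LinearMap.congr_fun (hX.commute_casimir a).eq u
    simp only [Module.End.mul_apply] at this
    rw [this, h2, map_smul]
  obtain ⟨μ₀, u₀, hu₀, hu₀0, hμ₀⟩ := exists_eigenvector (hX.symm 2) U (hUX 2)
    (Module.End.mem_eigenspace_iff.2 h) hv
  obtain ⟨m, u, hu, hu0, hm, htop⟩ : ∃ (m : ℤ) (u : V), u ∈ U ∧ u ≠ 0 ∧
      X 2 u = ((m : ℝ) : ℂ) • u ∧ X 0 u + Complex.I • X 1 u = 0 := by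
    -- If raising never gave zero on eigenvectors of `X 2` in `U`, repeating it would give the
    -- infinitely many eigenvalues `μ₀ + k`.
    by_contra! hcon
    have step : ∀ k : ℕ, ∃ u ∈ U, u ≠ 0 ∧ X 2 u = ((μ₀ + k : ℝ) : ℂ) • u := by
      intro k
      induction k with
      | zero => exact ⟨u₀, hu₀, hu₀0, by simpa using hμ₀⟩
      | succ k ih =>
        obtain ⟨u, hu, hu0, hk⟩ := ih
        obtain ⟨m, hm⟩ := hX.integral _ u hu0 hk
        refine ⟨X 0 u + Complex.I • X 1 u, U.add_mem (hUX 0 u hu) (U.smul_mem _ (hUX 1 u hu)),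
          hcon m u hu hu0 (by rw [← hm]; exact hk), ?_⟩
        have h1 := LinearMap.congr_fun hX.comm12 u
        have h2 := LinearMap.congr_fun hX.comm20 u
        simp only [LinearMap.sub_apply, Module.End.mul_apply, LinearMap.smul_apply, hk,
          map_smul] at h1 h2
        rw [map_add, map_smul]
        push_cast at h1 h2 ⊢
        linear_combination (norm := module) h2 - Complex.I • h1 - Complex.I_mul_I • X 0 u
    have hinj : Function.Injective fun k : ℕ => ((μ₀ + k : ℝ) : ℂ) := fun a b hab => by
      have : (μ₀ + a : ℝ) = μ₀ + b := Complex.ofReal_injective hab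
      exact_mod_cast add_left_cancel this
    refine Set.infinite_range_of_injective hinj ((X 2).finite_hasEigenvalue.subset ?_)
    rintro _ ⟨k, rfl⟩
    obtain ⟨u, -, hu0, hk⟩ := step k
    exact Module.End.hasEigenvalue_of_hasEigenvector ⟨Module.End.mem_eigenspace_iff.2 hk, hu0⟩
  have key := hX.casimir_of_raising_eq_zero hm htop
  have hmm : (σ : ℂ) = ((m * (m + 1) : ℝ) : ℂ) := by
    have := Module.End.mem_eigenspace_iff.1 hu
    rw [key] at this
    exact (smul_left_injective ℂ hu0 this).symm
  have hmm' : σ = m * (m + 1) := Complex.ofReal_injective hmm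
  -- Since `m (m + 1)` is unchanged under `m ↦ -m - 1`, negative highest weights need not be
  -- excluded.
  rcases le_or_gt 0 m with h0 | h0
  · refine ⟨m.toNat, ?_⟩
    have : ((m.toNat : ℤ) : ℝ) = m := by rw [Int.toNat_of_nonneg h0]
    rw [hmm', ← this]; norm_cast
  · refine ⟨(-m - 1).toNat, ?_⟩
    have : (((-m - 1).toNat : ℤ) : ℝ) = -m - 1 := by
      rw [Int.toNat_of_nonneg (by omega)]; push_cast; ring
    rw [hmm']
    have h2 : (((-m - 1).toNat : ℕ) : ℝ) = -m - 1 := by rw [← this]; norm_cast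
    rw [h2]; ring

end Spin


/-! ### Two coupled angular momenta -/

section Coupling

variable {V : Type*} [NormedAddCommGroup V] [InnerProductSpace ℂ V]

theorem commute_casimir_of_commute {X : Fin 3 → Module.End ℂ V} {Y : Module.End ℂ V}
    (h : ∀ a, Commute (X a) Y) : Commute (casimir X) Y :=
  (((h 0).mul_left (h 0)).add_left ((h 1).mul_left (h 1))).add_left ((h 2).mul_left (h 2))

theorem commute_scalarProd_of_commute {X Y : Fin 3 → Module.End ℂ V} {Z : Module.End ℂ V}
    (h : ∀ a, Commute (X a) Z) (h' : ∀ a, Commute (Y a) Z) : Commute (scalarProd X Y) Z :=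
  (((h 0).mul_left (h' 0)).add_left ((h 1).mul_left (h' 1))).add_left ((h 2).mul_left (h' 2))

theorem apply_mem_eigenspace {A B : Module.End ℂ V} (h : Commute A B) {c : ℂ} {v : V}
    (hv : v ∈ A.eigenspace c) : B v ∈ A.eigenspace c := by
  have h2 := Module.End.mem_eigenspace_iff.1 hv
  rw [Module.End.mem_eigenspace_iff]
  have := LinearMap.congr_fun h.eq v
  simp only [Module.End.mul_apply] at this
  rw [this, h2, map_smul]

theorem scalarProd_symm {X Y : Fin 3 → Module.End ℂ V} (hX : ∀ a, (X a).IsSymmetric)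
    (hY : ∀ a, (Y a).IsSymmetric) (h : ∀ a b, Commute (X a) (Y b)) :
    (scalarProd X Y).IsSymmetric :=
  ((isSymmetric_mul_of_commute (hX 0) (hY 0) (h 0 0)).add
    (isSymmetric_mul_of_commute (hX 1) (hY 1) (h 1 1))).add
    (isSymmetric_mul_of_commute (hX 2) (hY 2) (h 2 2))

theorem IsSpin.add [FiniteDimensional ℂ V] {X Y : Fin 3 → Module.End ℂ V} (hX : IsSpin X)
    (hY : IsSpin Y) (h : ∀ a b, Commute (X a) (Y b)) : IsSpin (X + Y) := by
  have hc : ∀ a b, X a * Y b = Y b * X a := fun a b => (h a b).eq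
  refine ⟨fun a => (hX.symm a).add (hY.symm a), ?_, ?_, ?_, ?_⟩
  · have h1 := hX.comm01
    have h2 := hY.comm01
    simp only [Pi.add_apply, mul_add, add_mul, smul_add, ← h1, ← h2, hc]
    abel
  · have h1 := hX.comm12
    have h2 := hY.comm12
    simp only [Pi.add_apply, mul_add, add_mul, smul_add, ← h1, ← h2, hc]
    abel
  · have h1 := hX.comm20
    have h2 := hY.comm20
    simp only [Pi.add_apply, mul_add, add_mul, smul_add, ← h1, ← h2, hc]
    abel
  · intro μ v hv hμ
    -- The operator `X 2` preserves the eigenspace of the sum, so there is a common eigenvector, on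
    -- which `μ` splits into two integers.
    obtain ⟨ν, u, hu, hu0, hν⟩ := exists_eigenvector (hX.symm 2) ((X 2 + Y 2).eigenspace (μ : ℂ))
      (fun w hw => apply_mem_eigenspace ((Commute.refl _).add_left (h 2 2).symm) hw)
      (Module.End.mem_eigenspace_iff.2 hμ) hv
    have hu' := Module.End.mem_eigenspace_iff.1 hu
    obtain ⟨m, hm⟩ := hX.integral ν u hu0 hν
    obtain ⟨m', hm'⟩ := hY.integral (μ - ν) u hu0 (by
      rw [LinearMap.add_apply, hν] at hu'
      rw [← sub_eq_of_eq_add' hu'.symm]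
      push_cast
      module)
    exact ⟨m + m', by push_cast; rw [← hm, ← hm']; ring⟩

theorem casimir_add {X Y : Fin 3 → Module.End ℂ V} (h : ∀ a b, Commute (X a) (Y b)) :
    casimir (X + Y) = casimir X + casimir Y + (2 : ℂ) • scalarProd X Y := by
  have hc : ∀ a b, Y a * X b = X b * Y a := fun a b => (h b a).eq.symm
  simp only [casimir, scalarProd, Pi.add_apply, mul_add, add_mul, hc]
  module

/-- The Cauchy-Schwarz inequality for the scalar product of vector operators. -/
theorem sq_re_inner_scalarProd_le {X Y : Fin 3 → Module.End ℂ V} (hX : ∀ a, (X a).IsSymmetric)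
    (hY : ∀ a, (Y a).IsSymmetric) (v : V) :
    (⟪v, scalarProd X Y v⟫_ℂ).re ^ 2 ≤ (⟪v, casimir X v⟫_ℂ).re * (⟪v, casimir Y v⟫_ℂ).re := by
  rw [re_inner_casimir hX, re_inner_casimir hY]
  have h1 : (⟪v, scalarProd X Y v⟫_ℂ).re = ∑ a, (⟪X a v, Y a v⟫_ℂ).re := by
    simp only [scalarProd, LinearMap.add_apply, Module.End.mul_apply, inner_add_right,
      Complex.add_re, Fin.sum_univ_three, hX _ v]
  have h2 : |(⟪v, scalarProd X Y v⟫_ℂ).re| ≤ ∑ a, ‖X a v‖ * ‖Y a v‖ := by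
    rw [h1]
    refine (Finset.abs_sum_le_sum_abs _ _).trans (Finset.sum_le_sum fun a _ => ?_)
    exact (Complex.abs_re_le_norm _).trans (norm_inner_le_norm _ _)
  calc _ = |(⟪v, scalarProd X Y v⟫_ℂ).re| ^ 2 := (sq_abs _).symm
    _ ≤ (∑ a, ‖X a v‖ * ‖Y a v‖) ^ 2 := by gcongr
    _ ≤ _ := Finset.sum_mul_sq_le_sq_mul_sq _ _ _

/-- Integrality sharpens Cauchy-Schwarz to the triangle rule: if `k ≥ s + j + 1`, then `τ ≥ (s +
1)(j + 1)`, which is too large, and the other two violations make `-τ` too large in the same way. -/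
theorem triangle_inequality_of_coupling {s j k : ℕ} {τ : ℝ}
    (hk : 2 * τ = k * (k + 1) - s * (s + 1) - j * (j + 1))
    (hτ : τ ^ 2 ≤ (s * (s + 1)) * (j * (j + 1))) : k ≤ s + j ∧ s ≤ k + j ∧ j ≤ k + s := by
  have hs0 : (0 : ℝ) ≤ s := s.cast_nonneg
  have hj0 : (0 : ℝ) ≤ j := j.cast_nonneg
  have hk0 : (0 : ℝ) ≤ k := k.cast_nonneg
  refine ⟨?_, ?_, ?_⟩
  · by_contra! h
    have h1 : (s : ℝ) + j + 1 ≤ k := by exact_mod_cast h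
    have h2 : ((s : ℝ) + 1) * (j + 1) ≤ τ := by nlinarith
    have h3 : (((s : ℝ) + 1) * (j + 1)) ^ 2 ≤ τ ^ 2 := by gcongr
    nlinarith [mul_nonneg hs0 hj0, mul_nonneg (mul_nonneg hs0 hj0) hs0,
      mul_nonneg (mul_nonneg hs0 hj0) hj0]
  · by_contra! h
    have h1 : (k : ℝ) + j + 1 ≤ s := by exact_mod_cast h
    have h2 : (s : ℝ) * (j + 1) ≤ -τ := by nlinarith
    have h3 : ((s : ℝ) * (j + 1)) ^ 2 ≤ (-τ) ^ 2 := by gcongr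
    have h4 : 0 < (s : ℝ) * (j + 1) * (s - j) := by
      have : (0 : ℝ) < s := by linarith
      have : (0 : ℝ) < s - j := by linarith
      positivity
    nlinarith
  · by_contra! h
    have h1 : (k : ℝ) + s + 1 ≤ j := by exact_mod_cast h
    have h2 : (j : ℝ) * (s + 1) ≤ -τ := by nlinarith
    have h3 : ((j : ℝ) * (s + 1)) ^ 2 ≤ (-τ) ^ 2 := by gcongr
    have h4 : 0 < (j : ℝ) * (s + 1) * (j - s) := by
      have : (0 : ℝ) < j := by linarith
      have : (0 : ℝ) < j - s := by linarith
      positivity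
    nlinarith

/-- The eigenvalues of the scalar product of two angular momenta of lengths `s` and `j`. -/
theorem exists_coupling_of_eigen [FiniteDimensional ℂ V] {X Y : Fin 3 → Module.End ℂ V}
    (hX : IsSpin X) (hY : IsSpin Y) (h : ∀ a b, Commute (X a) (Y b)) {s j : ℕ} {v : V}
    (hv : v ≠ 0)
    (hXv : casimir X v = ((s * (s + 1) : ℝ) : ℂ) • v)
    (hYv : casimir Y v = ((j * (j + 1) : ℝ) : ℂ) • v) {τ : ℝ}
    (hτ : scalarProd X Y v = (τ : ℂ) • v) :
    ∃ k : ℕ, 2 * τ = k * (k + 1) - s * (s + 1) - j * (j + 1) ∧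
      k ≤ s + j ∧ s ≤ k + j ∧ j ≤ k + s := by
  obtain ⟨k, hk⟩ := (hX.add hY h).casimir_eigenvalue (σ := s * (s + 1) + j * (j + 1) + 2 * τ) hv
    (by
      rw [casimir_add h]
      simp only [LinearMap.add_apply, LinearMap.smul_apply, hXv, hYv, hτ]
      push_cast
      module)
  have hk' : 2 * τ = k * (k + 1) - s * (s + 1) - j * (j + 1) := by linarith
  refine ⟨k, hk', triangle_inequality_of_coupling hk' ?_⟩
  have h1 := sq_re_inner_scalarProd_le hX.symm hY.symm v
  have hn : 0 < ‖v‖ ^ 2 := by positivity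
  have hre : ∀ c : ℝ, (⟪v, (c : ℂ) • v⟫_ℂ).re = c * ‖v‖ ^ 2 := fun c => by
    rw [inner_smul_right, inner_self_eq_norm_sq_to_K, Complex.re_ofReal_mul]
    norm_cast
  rw [hXv, hYv, hτ, hre, hre, hre] at h1
  have h2 : 0 < (‖v‖ ^ 2) ^ 2 := by positivity
  refine le_of_mul_le_mul_right ?_ h2
  linarith

end Coupling

/-! ### A triangle coupled through one corner to the total spin of another triangle -/

section Pair

variable {V : Type*} [NormedAddCommGroup V] [InnerProductSpace ℂ V]

/-- Angular momentum operators `A` (total spin of a triangle), `x` (one of the three spins of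
length `s` of this triangle) and `S` (total spin of another triangle). -/
structure IsPair (s : ℕ) (A x S : Fin 3 → Module.End ℂ V) : Prop where
  spinA : IsSpin A
  spinx : IsSpin x
  spinS : IsSpin S
  length : casimir x = ((s * (s + 1) : ℝ) : ℂ) • 1
  commxS : ∀ a b, Commute (x a) (S b)
  commAS : ∀ a b, Commute (A a) (S b)
  commL : ∀ a b, Commute (A a - x a) (x b)

/-- The energy of a pair of triangles, relative to that of the product of the two singlets. -/
noncomputable def pairEnergy (A x S : Fin 3 → Module.End ℂ V) (J : ℝ) : Module.End ℂ V :=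
  (1 / 2 : ℂ) • casimir S + (1 / 2 : ℂ) • casimir A + (J : ℂ) • scalarProd x S

variable {s : ℕ} {A x S : Fin 3 → Module.End ℂ V}

theorem re_inner_smul_self (c : ℝ) (v : V) : (⟪v, (c : ℂ) • v⟫_ℂ).re = c * ‖v‖ ^ 2 := by
  rw [inner_smul_right, inner_self_eq_norm_sq_to_K, Complex.re_ofReal_mul]
  norm_cast

theorem isSymmetric_ofReal_smul {X : Module.End ℂ V} (hX : X.IsSymmetric) (c : ℝ) :
    ((c : ℂ) • X).IsSymmetric := fun v w => by
  simp only [LinearMap.smul_apply, inner_smul_left, inner_smul_right, hX v w, Complex.conj_ofReal]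

theorem IsPair.symm_scalarProd (h : IsPair s A x S) : (scalarProd x S).IsSymmetric :=
  scalarProd_symm h.spinx.symm h.spinS.symm h.commxS

theorem IsPair.commute_casimirS_scalarProd (h : IsPair s A x S) :
    Commute (casimir S) (scalarProd x S) :=
  (commute_scalarProd_of_commute
    (fun a => (commute_casimir_of_commute fun b => (h.commxS a b).symm).symm)
    (fun a => (h.spinS.commute_casimir a).symm)).symm

theorem IsPair.commute_casimirS_A (h : IsPair s A x S) (a : Fin 3) :
    Commute (casimir S) (A a) :=
  commute_casimir_of_commute fun b => (h.commAS a b).symm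

theorem IsPair.commute_casimirS_casimirA (h : IsPair s A x S) :
    Commute (casimir S) (casimir A) :=
  (commute_casimir_of_commute fun a => (h.commute_casimirS_A a).symm).symm

theorem IsPair.symm_energy (h : IsPair s A x S) (J : ℝ) : (pairEnergy A x S J).IsSymmetric := by
  have e : (1 / 2 : ℂ) = ((1 / 2 : ℝ) : ℂ) := by push_cast; rfl
  unfold pairEnergy
  rw [e]
  exact ((isSymmetric_ofReal_smul h.spinS.casimir_symm _).add
    (isSymmetric_ofReal_smul h.spinA.casimir_symm _)).add
    (isSymmetric_ofReal_smul h.symm_scalarProd _)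

theorem IsPair.commute_casimirS_energy (h : IsPair s A x S) (J : ℝ) :
    Commute (casimir S) (pairEnergy A x S J) :=
  (((Commute.refl _).smul_right _).add_right (h.commute_casimirS_casimirA.smul_right _)).add_right
    (h.commute_casimirS_scalarProd.smul_right _)

theorem re_inner_pairEnergy (A x S : Fin 3 → Module.End ℂ V) (J : ℝ) (v : V) :
    (⟪v, pairEnergy A x S J v⟫_ℂ).re = (⟪v, casimir S v⟫_ℂ).re / 2 + (⟪v, casimir A v⟫_ℂ).re / 2
      + J * (⟪v, scalarProd x S v⟫_ℂ).re := by
  have e : (1 / 2 : ℂ) = ((1 / 2 : ℝ) : ℂ) := by push_cast; rfl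
  simp only [pairEnergy, LinearMap.add_apply, LinearMap.smul_apply, inner_add_right,
    inner_smul_right, Complex.add_re, e, Complex.re_ofReal_mul]
  ring

/-- The bounds for the scalar product of spins of lengths `s` and `j`, applied to `J x ⬝ S`. -/
theorem IsPair.le_re_inner_scalarProd [FiniteDimensional ℂ V] (h : IsPair s A x S) {j : ℕ}
    {J b : ℝ}
    (hb : ∀ k : ℕ, k ≤ s + j → s ≤ k + j → j ≤ k + s →
      b ≤ J * ((k * (k + 1) - s * (s + 1) - j * (j + 1)) / 2))
    {v : V} (hv : casimir S v = ((j * (j + 1) : ℝ) : ℂ) • v) :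
    b * ‖v‖ ^ 2 ≤ J * (⟪v, scalarProd x S v⟫_ℂ).re := by
  have h1 := le_re_inner_of_joint_eigen (isSymmetric_ofReal_smul h.symm_scalarProd J)
    h.symm_scalarProd ((Commute.refl _).smul_left _)
    ((casimir S).eigenspace ((j * (j + 1) : ℝ) : ℂ))
    (fun w hw => Submodule.smul_mem _ _ (apply_mem_eigenspace h.commute_casimirS_scalarProd hw))
    (fun w hw => apply_mem_eigenspace h.commute_casimirS_scalarProd hw) (m := b)
    (fun μ ν ψ hψ h0 hμ hν => by
      obtain ⟨k, hk, k1, k2, k3⟩ := exists_coupling_of_eigen h.spinx h.spinS h.commxS (s := s) h0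
        (by rw [h.length]; rfl) (Module.End.mem_eigenspace_iff.1 hψ) hν
      have e : μ = J * ν := by
        rw [LinearMap.smul_apply, hν, smul_smul] at hμ
        have := smul_left_injective ℂ h0 hμ
        exact_mod_cast this.symm
      have e2 : ν = (k * (k + 1) - s * (s + 1) - j * (j + 1)) / 2 := by linarith
      rw [e, e2]
      exact hb k k1 k2 k3)
    (Module.End.mem_eigenspace_iff.2 hv)
  rwa [LinearMap.smul_apply, inner_smul_right, Complex.re_ofReal_mul] at h1

/-- The scalar product with a spin of length one satisfies a cubic equation. -/
theorem IsPair.scalarProd_cubic [FiniteDimensional ℂ V] (h : IsPair s A x S) {v : V}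
    (hv : casimir S v = (2 : ℂ) • v) :
    scalarProd x S (scalarProd x S (scalarProd x S v)) =
      -(2 : ℂ) • scalarProd x S (scalarProd x S v)
        + ((s * (s + 1) - 1 : ℝ) : ℂ) • scalarProd x S v + ((s * (s + 1) : ℝ) : ℂ) • v := by
  have e : ((((1 : ℕ) : ℝ) * (((1 : ℕ) : ℝ) + 1) : ℝ) : ℂ) = 2 := by norm_num
  have h1 := apply_eq_zero_of_eigen h.symm_scalarProd
    ((casimir S).eigenspace (2 : ℂ))
    (fun w hw => apply_mem_eigenspace h.commute_casimirS_scalarProd hw)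
    (scalarProd x S * scalarProd x S * scalarProd x S + (2 : ℂ) • (scalarProd x S * scalarProd x S)
      - ((s * (s + 1) - 1 : ℝ) : ℂ) • scalarProd x S - ((s * (s + 1) : ℝ) : ℂ) • 1)
    (fun μ ψ hψ h0 hμ => by
      obtain ⟨k, hk, k1, k2, k3⟩ := exists_coupling_of_eigen h.spinx h.spinS h.commxS (s := s)
        (j := 1) h0 (by rw [h.length]; rfl)
        (by rw [e]; exact Module.End.mem_eigenspace_iff.1 hψ) hμ
      have hpoly : μ ^ 3 + 2 * μ ^ 2 - (s * (s + 1) - 1) * μ - s * (s + 1) = 0 := by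
        -- The three couplings of `s` with spin one give the eigenvalues `s`, `-1`, `-(s + 1)`, the
        -- roots of `(μ - s)(μ + 1)(μ + s + 1)`.
        have hk' : k = s + 1 ∨ k = s ∨ s = k + 1 := by omega
        rcases hk' with rfl | rfl | rfl
        · have : μ = s := by push_cast at hk; linarith
          rw [this]; ring
        · have : μ = -1 := by push_cast at hk; linarith
          rw [this]; ring
        · have : μ = -(k + 2) := by push_cast at hk; linarith
          rw [this]; push_cast; ring
      simp only [LinearMap.add_apply, LinearMap.sub_apply, LinearMap.smul_apply,
        Module.End.mul_apply, Module.End.one_apply, hμ, map_smul, smul_smul, ← add_smul,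
        ← sub_smul]
      have : ((μ ^ 3 + 2 * μ ^ 2 - (s * (s + 1) - 1) * μ - s * (s + 1) : ℝ) : ℂ) • ψ = 0 := by
        rw [hpoly]; simp
      rw [← this]
      congr 1
      push_cast
      ring)
    (Module.End.mem_eigenspace_iff.2 hv)
  simp only [LinearMap.add_apply, LinearMap.sub_apply, LinearMap.smul_apply,
    Module.End.mul_apply, Module.End.one_apply] at h1
  linear_combination (norm := module) h1

end Pair


/-! ### Action of the coupling on singlets of the first triangle -/

section Levels

variable {V : Type*} [NormedAddCommGroup V] [InnerProductSpace ℂ V]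
  {s : ℕ} {A x S : Fin 3 → Module.End ℂ V}

theorem IsSpin.comm10 {X : Fin 3 → Module.End ℂ V} (hX : IsSpin X) :
    X 1 * X 0 = X 0 * X 1 - Complex.I • X 2 := by rw [← hX.comm01]; abel

theorem IsSpin.comm21 {X : Fin 3 → Module.End ℂ V} (hX : IsSpin X) :
    X 2 * X 1 = X 1 * X 2 - Complex.I • X 0 := by rw [← hX.comm12]; abel

theorem IsSpin.comm20' {X : Fin 3 → Module.End ℂ V} (hX : IsSpin X) :
    X 2 * X 0 = X 0 * X 2 + Complex.I • X 1 := by rw [← hX.comm20]; abel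

/-- The vector operator `i (S × x)`. -/
noncomputable def crossOp (x S : Fin 3 → Module.End ℂ V) : Fin 3 → Module.End ℂ V :=
  ![Complex.I • (x 2 * S 1 - x 1 * S 2), Complex.I • (x 0 * S 2 - x 2 * S 0),
    Complex.I • (x 1 * S 0 - x 0 * S 1)]

/-- The difference `A - x` is the spin of the two other sites and commutes with `x`, so `A` rotates
`x` exactly as `x` rotates itself. -/
theorem IsPair.comm_A_x (h : IsPair s A x S) (a b : Fin 3) :
    A a * x b = x b * A a + (x a * x b - x b * x a) := by
  have := (h.commL a b).eq
  rw [sub_mul, mul_sub, sub_eq_iff_eq_add] at this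
  rw [this]
  abel

theorem IsPair.A_mul_scalarProd (h : IsPair s A x S) (a : Fin 3) :
    A a * scalarProd x S = scalarProd x S * A a + crossOp x S a := by
  have e0 := h.spinx.comm10
  have e1 := h.spinx.comm21
  have e2 := h.spinx.comm20'
  have hc : ∀ a b, S b * A a = A a * S b := fun a b => (h.commAS a b).eq.symm
  fin_cases a <;>
  simp only [scalarProd, crossOp, mul_add, add_mul, ← mul_assoc, h.comm_A_x, Fin.zero_eta,
    Fin.mk_one, Fin.reduceFinMk, Matrix.cons_val, e0, e1, e2] <;>
  simp only [mul_assoc, hc, sub_mul, smul_mul_assoc, add_mul] <;> module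

/-- In terms of commutators this reads `∑ [A a, [A a, T]] = 2 T` for `T = x·S`: under `A`, the
operator `T` is a combination of components of a vector operator, and `2 = 1 (1 + 1)`. -/
theorem IsPair.A_mul_crossOp (h : IsPair s A x S) :
    A 0 * crossOp x S 0 + A 1 * crossOp x S 1 + A 2 * crossOp x S 2 =
      crossOp x S 0 * A 0 + crossOp x S 1 * A 1 + crossOp x S 2 * A 2
        + (2 : ℂ) • scalarProd x S := by
  have e0 := h.spinx.comm10
  have e1 := h.spinx.comm21
  have e2 := h.spinx.comm20'
  have hc : ∀ a b, S b * A a = A a * S b := fun a b => (h.commAS a b).eq.symm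
  simp only [scalarProd, crossOp, add_mul, mul_sub, sub_mul, ← mul_assoc, h.comm_A_x,
    Matrix.cons_val, Matrix.cons_val_zero, Matrix.cons_val_one, e0, e1, e2, mul_smul_comm,
    smul_mul_assoc]
  simp only [mul_assoc, hc, smul_sub, smul_smul, Complex.I_mul_I, smul_add]
  module

/-- Lagrange's identity for the square of a cross product; the linear term in `x·S` is the
correction from the noncommuting components. -/
theorem IsPair.casimir_crossOp (h : IsPair s A x S) :
    casimir (crossOp x S) =
      scalarProd x S * scalarProd x S + scalarProd x S - casimir x * casimir S := by
  have e0 := h.spinx.comm10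
  have e1 := h.spinx.comm21
  have e2 := h.spinx.comm20'
  have f0 := h.spinS.comm10
  have f1 := h.spinS.comm21
  have f2 := h.spinS.comm20'
  have e0' : ∀ Z, x 1 * (x 0 * Z) = x 0 * (x 1 * Z) - Complex.I • (x 2 * Z) := fun Z => by
    rw [← mul_assoc, e0, sub_mul, mul_assoc, smul_mul_assoc]
  have e1' : ∀ Z, x 2 * (x 1 * Z) = x 1 * (x 2 * Z) - Complex.I • (x 0 * Z) := fun Z => by
    rw [← mul_assoc, e1, sub_mul, mul_assoc, smul_mul_assoc]
  have e2' : ∀ Z, x 2 * (x 0 * Z) = x 0 * (x 2 * Z) + Complex.I • (x 1 * Z) := fun Z => by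
    rw [← mul_assoc, e2, add_mul, mul_assoc, smul_mul_assoc]
  have hc : ∀ a b, S b * x a = x a * S b := fun a b => (h.commxS a b).eq.symm
  have hc' : ∀ a b Z, S b * (x a * Z) = x a * (S b * Z) := fun a b Z => by
    rw [← mul_assoc, hc, mul_assoc]
  simp only [casimir, scalarProd, crossOp, Matrix.cons_val, Matrix.cons_val_zero,
    Matrix.cons_val_one, mul_add, add_mul, mul_sub, sub_mul, mul_assoc, hc', f0,
    f1, f2, e0', e1', e2', mul_smul_comm, smul_mul_assoc, smul_sub, smul_add, smul_smul,
    Complex.I_mul_I]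
  module

variable {σ : ℂ} {w : V}

theorem IsPair.A_scalarProd_apply (h : IsPair s A x S) (hw : ∀ a, A a w = 0) (a : Fin 3) :
    A a (scalarProd x S w) = crossOp x S a w := by
  have := LinearMap.congr_fun (h.A_mul_scalarProd a) w
  simpa [hw] using this

theorem IsPair.casimirA_scalarProd (h : IsPair s A x S) (hw : ∀ a, A a w = 0) :
    casimir A (scalarProd x S w) = (2 : ℂ) • scalarProd x S w := by
  have h1 := LinearMap.congr_fun h.A_mul_crossOp w
  simp only [LinearMap.add_apply, Module.End.mul_apply, hw, map_zero, zero_add,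
    LinearMap.smul_apply] at h1
  simp only [casimir, LinearMap.add_apply, Module.End.mul_apply, h.A_scalarProd_apply hw, h1]

/-- Two applications of a vector operator to a singlet produce spins up to two of the first
triangle. The `6` is the spin-two eigenvalue, and the other terms correct for the parts of spin one
and zero. -/
theorem IsPair.casimirA_scalarProd_scalarProd (h : IsPair s A x S) (hw : ∀ a, A a w = 0)
    (hσ : casimir S w = σ • w) :
    casimir A (scalarProd x S (scalarProd x S w)) =
      (6 : ℂ) • scalarProd x S (scalarProd x S w) + (2 : ℂ) • scalarProd x S w
        - (2 * ((s * (s + 1) : ℝ) : ℂ) * σ) • w := by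
  have h1 := LinearMap.congr_fun h.A_mul_crossOp w
  have h2 := LinearMap.congr_fun h.A_mul_crossOp (scalarProd x S w)
  have h3 := LinearMap.congr_fun h.casimir_crossOp w
  have h4 : ∀ a v, A a (scalarProd x S v) = scalarProd x S (A a v) + crossOp x S a v :=
    fun a v => LinearMap.congr_fun (h.A_mul_scalarProd a) v
  rw [h.length] at h3
  simp only [casimir, LinearMap.add_apply, LinearMap.sub_apply, Module.End.mul_apply, hw, map_zero,
    zero_add, LinearMap.smul_apply, Module.End.one_apply, h.A_scalarProd_apply hw] at h1 h2 h3 hσ ⊢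
  simp only [h4, map_add, hw, map_zero, zero_add]
  have h5 := congrArg (scalarProd x S) h1
  simp only [map_add, map_smul] at h5
  rw [hσ, smul_smul] at h3
  linear_combination (norm := module) h2 + (2 : ℂ) • h3 + h5

/-- One application of `x·S` turns a singlet of the first triangle into a state of spin one there,
which is orthogonal to singlets. -/
theorem IsPair.inner_scalarProd_singlet (h : IsPair s A x S) (hw : ∀ a, A a w = 0) :
    ⟪w, scalarProd x S w⟫_ℂ = 0 := by
  have h1 := congrArg (fun v => ⟪w, v⟫_ℂ) (h.casimirA_scalarProd hw)
  simp only [← h.spinA.casimir_symm w, inner_smul_right,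
    (casimir_apply_eq_zero_iff h.spinA.symm).2 hw, inner_zero_left] at h1
  simpa using h1.symm

/-- Since `A² w = 0`, pairing `casimirA_scalarProd_scalarProd` with `w` leaves `0 = 6 ⟪w, T² w⟫ - 2
s (s + 1) σ ⟪w, w⟫`, where `T = x·S`. -/
theorem IsPair.inner_scalarProd_sq_singlet (h : IsPair s A x S) (hw : ∀ a, A a w = 0)
    (hσ : casimir S w = σ • w) :
    ⟪w, scalarProd x S (scalarProd x S w)⟫_ℂ =
      ((s * (s + 1) : ℝ) : ℂ) * σ / 3 * ⟪w, w⟫_ℂ := by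
  have h1 := congrArg (fun v => ⟪w, v⟫_ℂ) (h.casimirA_scalarProd_scalarProd hw hσ)
  simp only [← h.spinA.casimir_symm w, inner_smul_right, inner_sub_right, inner_add_right,
    (casimir_apply_eq_zero_iff h.spinA.symm).2 hw, inner_zero_left,
    h.inner_scalarProd_singlet hw] at h1
  linear_combination -h1 / 6

end Levels


/-! ### The cubic polynomial -/

section Cubic

theorem continuous_gapCubic (r J : ℝ) : Continuous (gapCubic r J) := by
  unfold gapCubic; fun_prop

/-- The leading coefficient in `x` is `-1`, and `K` is at least `1` and at least the sum of the
absolute values of the other coefficients, so the cubic term dominates at `-K`. -/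
theorem exists_gapCubic_nonneg (r J x : ℝ) : ∃ y ≤ x, 0 ≤ gapCubic r J y := by
  set K := 7 + 2 * |J| + |14 - 7 * J + (1 - r) * J ^ 2| + |gapCubic r J 0| + |x| with hK
  have h1 := abs_nonneg J
  have h2 := abs_nonneg (14 - 7 * J + (1 - r) * J ^ 2)
  have h3 := abs_nonneg (gapCubic r J 0)
  have h4 := abs_nonneg x
  refine ⟨-K, by have := neg_abs_le x; linarith, ?_⟩
  have e : gapCubic r J (-K) = K ^ 3 + (7 - 2 * J) * K ^ 2 + (14 - 7 * J + (1 - r) * J ^ 2) * K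
      + gapCubic r J 0 := by unfold gapCubic; ring
  rw [e]
  have h5 := neg_abs_le (14 - 7 * J + (1 - r) * J ^ 2)
  have h6 := neg_abs_le (gapCubic r J 0)
  have h7 := le_abs_self J
  have hK1 : 1 ≤ K := by linarith
  have hd : 0 ≤ K - 2 * |J| - |14 - 7 * J + (1 - r) * J ^ 2| - |gapCubic r J 0| := by linarith
  have k1 : (14 - 7 * J + (1 - r) * J ^ 2) * K ≥ -|14 - 7 * J + (1 - r) * J ^ 2| * K ^ 2 := by
    have : K ≤ K ^ 2 := by nlinarith
    nlinarith [mul_le_mul_of_nonneg_left this h2, mul_le_mul_of_nonneg_right h5 (by linarith : 0 ≤ K)]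
  have k2 : gapCubic r J 0 ≥ -|gapCubic r J 0| * K ^ 2 := by
    have : 1 ≤ K ^ 2 := by nlinarith
    nlinarith [mul_le_mul_of_nonneg_left this h3]
  have k3 : -(2 * J) * K ^ 2 ≥ -(2 * |J|) * K ^ 2 := by nlinarith [sq_nonneg K]
  nlinarith [mul_nonneg hd (sq_nonneg K), sq_nonneg K]

theorem exists_root_gapCubic_le {r J x : ℝ} (h : gapCubic r J x ≤ 0) :
    ∃ y ≤ x, gapCubic r J y = 0 := by
  obtain ⟨z, hz, hz0⟩ := exists_gapCubic_nonneg r J x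
  obtain ⟨y, hy, hy0⟩ := intermediate_value_Icc' hz (continuous_gapCubic r J).continuousOn ⟨h, hz0⟩
  exact ⟨y, hy.2, hy0⟩

theorem gapCubic_finite_roots (r J : ℝ) : {x : ℝ | gapCubic r J x = 0}.Finite := by
  open Polynomial in
  set q : Polynomial ℝ := -((X - C 4) * (X - C 2) * (X - C 1)) - (X - C 1) * (C 2 * X - C 5) * C J
    + (C (1 - 3 * r) - X + C r * X) * C (J ^ 2) + C (r * J ^ 3) with hq
  have hev : ∀ x, q.eval x = gapCubic r J x := fun x => by
    simp [hq, gapCubic]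
  have hq0 : q ≠ 0 := by
    intro h0
    have hall : ∀ x, gapCubic r J x = 0 := fun x => by rw [← hev, h0]; simp
    -- The third difference of these four values is `-6`, so they cannot all vanish.
    have h1 := hall 0
    have h2 := hall 1
    have h3 := hall (-1)
    have h4 := hall 2
    unfold gapCubic at h1 h2 h3 h4
    linarith
  refine (q.roots.toFinset.finite_toSet).subset fun x hx => ?_
  simp only [Finset.mem_coe, Multiset.mem_toFinset, Polynomial.mem_roots hq0, Polynomial.IsRoot.def,
    hev]
  exact hx

theorem exists_isLeast_root (r J : ℝ) : ∃ x, IsLeast {x : ℝ | gapCubic r J x = 0} x := by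
  have hne : {x : ℝ | gapCubic r J x = 0}.Nonempty := by
    have : ∃ x, gapCubic r J x ≤ 0 := by
      by_contra! hcon
      have hall : ∀ K : ℝ, 0 < gapCubic r J K := hcon
      set K := 14 + 4 * |J| + |14 - 7 * J + (1 - r) * J ^ 2| + |gapCubic r J 0| with hK
      have h1 := abs_nonneg J
      have h2 := abs_nonneg (14 - 7 * J + (1 - r) * J ^ 2)
      have h3 := abs_nonneg (gapCubic r J 0)
      have e : gapCubic r J K = -K ^ 3 + (7 - 2 * J) * K ^ 2
          - (14 - 7 * J + (1 - r) * J ^ 2) * K + gapCubic r J 0 := by unfold gapCubic; ring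
      have h5 := neg_abs_le (14 - 7 * J + (1 - r) * J ^ 2)
      have h6 := le_abs_self (gapCubic r J 0)
      have h7 := neg_abs_le J
      have hK1 : 1 ≤ K := by linarith
      have hd : 0 ≤ K - 7 - 2 * |J| - |14 - 7 * J + (1 - r) * J ^ 2| - |gapCubic r J 0| := by
        linarith
      have hK2 : K ≤ K ^ 2 := by nlinarith
      have k1 : (14 - 7 * J + (1 - r) * J ^ 2) * K ≥ -|14 - 7 * J + (1 - r) * J ^ 2| * K ^ 2 := by
        nlinarith [mul_le_mul_of_nonneg_left hK2 h2,
          mul_le_mul_of_nonneg_right h5 (by linarith : 0 ≤ K)]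
      have k2 : gapCubic r J 0 ≤ |gapCubic r J 0| * K ^ 2 := by
        have : 1 ≤ K ^ 2 := by nlinarith
        nlinarith [mul_le_mul_of_nonneg_left this h3]
      have k3 : -(2 * J) * K ^ 2 ≤ (2 * |J|) * K ^ 2 := by nlinarith [sq_nonneg K]
      have := hall K
      nlinarith [mul_nonneg hd (sq_nonneg K), sq_nonneg K]
    obtain ⟨x, hx⟩ := this
    obtain ⟨y, -, hy⟩ := exists_root_gapCubic_le hx
    exact ⟨y, hy⟩
  obtain ⟨x, hx, hmin⟩ := (gapCubic_finite_roots r J).exists_minimal hne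
  exact ⟨x, hx, fun y hy => by
    rcases le_total x y with h | h
    · exact h
    · exact hmin hy h⟩

/-- The values of the cubic at `0` on the ray through a zero `z`. -/
theorem gapCubic_zero_mul {r z : ℝ} (hz : gapCubic r z 0 = 0) (u : ℝ) :
    gapCubic r (u * z) 0 =
      (1 - u) * (8 + u * (z ^ 2 * ((3 * r - 1) - r * z * (1 + u)))) := by
  unfold gapCubic at hz ⊢
  linear_combination u * hz

theorem gapCubic_zero_mul_pos {r z u : ℝ} (hr : 2 ≤ r) (hz : gapCubic r z 0 = 0) (hz1 : z ≤ 1)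
    (hu : 0 ≤ u) (hu1 : u < 1) : 0 < gapCubic r (u * z) 0 := by
  rw [gapCubic_zero_mul hz]
  have h1 : 0 ≤ (3 * r - 1) - r * z * (1 + u) := by
    have : z * (1 + u) ≤ 2 := by nlinarith
    nlinarith
  have : 0 < 1 - u := by linarith
  positivity

/-- As a polynomial in `-x` the cubic has nonnegative coefficients besides the constant term. For
the linear one, the assumption on the constant term bounds `r J² (3 - J)`, which eliminates `r`. A
positive value at `0` thus excludes roots `x ≤ 0`. -/
theorem gapCubic_zero_add_le {r J x : ℝ} (hJ : J ≤ 1) (h0 : 0 ≤ gapCubic r J 0)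
    (hx : x ≤ 0) : gapCubic r J 0 + (-x) ^ 3 ≤ gapCubic r J x := by
  have e : gapCubic r J x = (-x) ^ 3 + (7 - 2 * J) * x ^ 2
      + (14 - 7 * J - (r - 1) * J ^ 2) * (-x) + gapCubic r J 0 := by unfold gapCubic; ring
  have h1 : 0 < 14 - 7 * J - (r - 1) * J ^ 2 := by
    have h2 : (r - 1) * J ^ 2 * (3 - J) ≤ 8 - 5 * J - 2 * J ^ 2 + J ^ 3 := by
      unfold gapCubic at h0; nlinarith
    have h3 : 8 - 5 * J - 2 * J ^ 2 + J ^ 3 < (14 - 7 * J) * (3 - J) := by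
      nlinarith [mul_nonneg (sub_nonneg.2 hJ) (sq_nonneg (J - 4)), sq_nonneg (J - 4)]
    have h4 : 0 < 3 - J := by linarith
    have h5 : 0 < (14 - 7 * J - (r - 1) * J ^ 2) * (3 - J) := by nlinarith
    exact pos_of_mul_pos_left h5 h4.le
  rw [e]
  have h3 : 0 ≤ (7 - 2 * J) * x ^ 2 := mul_nonneg (by linarith) (sq_nonneg x)
  have h4 : 0 ≤ (14 - 7 * J - (r - 1) * J ^ 2) * (-x) := mul_nonneg h1.le (neg_nonneg.2 hx)
  linarith

theorem exists_gapCubic_nonpos_of_neg {r z J : ℝ} (hr : 2 ≤ r) (hz : gapCubic r z 0 = 0)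
    (hz0 : z < 0) (hJ : J ≤ z) : gapCubic r J 0 ≤ 0 := by
  obtain ⟨u, rfl⟩ : ∃ u, J = u * z := ⟨J / z, by field_simp [hz0.ne]⟩
  have hu : 1 ≤ u := by nlinarith
  rw [gapCubic_zero_mul hz]
  have h1 : 0 ≤ (3 * r - 1) - r * z * (1 + u) := by nlinarith [mul_pos (by linarith : 0 < r) (by linarith : 0 < 1 + u)]
  have h2 : 0 ≤ u * (z ^ 2 * ((3 * r - 1) - r * z * (1 + u))) := by positivity
  nlinarith

/-- The test point `x = 0` does not serve for large `J`, where the constant term becomes positive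
again; hence the separate range beyond `13 / 5`. -/
theorem exists_gapCubic_nonpos_of_pos {r z J : ℝ} (hr : 2 ≤ r) (hz : gapCubic r z 0 = 0)
    (hz0 : 0 < z) (hJ : z ≤ J) : ∃ x ≤ 0, gapCubic r J x ≤ 0 := by
  rcases le_total J 1 with h1 | h1
  · refine ⟨0, le_rfl, ?_⟩
    obtain ⟨u, rfl⟩ : ∃ u, J = u * z := ⟨J / z, by field_simp⟩
    have hu : 1 ≤ u := by nlinarith
    rw [gapCubic_zero_mul hz]
    have h1 : 0 ≤ (3 * r - 1) - r * z * (1 + u) := by nlinarith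
    have h2 : 0 ≤ u * (z ^ 2 * ((3 * r - 1) - r * z * (1 + u))) := by positivity
    nlinarith
  · rcases le_total J (13 / 5) with h2 | h2
    · refine ⟨0, le_rfl, ?_⟩
      -- For `J < 3` the value at `0` decreases in `r`, and at `r = 2` it equals `-(J - 1)(8 + 3J -
      -- 2J²)`.
      unfold gapCubic
      have h3 : 0 ≤ (r - 2) * (J ^ 2 * (3 - J)) :=
        mul_nonneg (by linarith) (mul_nonneg (sq_nonneg J) (by linarith))
      have h4 : 0 ≤ (J - 1) * (8 + 3 * J - 2 * J ^ 2) :=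
        mul_nonneg (by linarith) (by nlinarith)
      nlinarith
    -- At `x = -J` the terms of third order in `J` cancel, leaving `8 + 9J + (1 - 3r) J²`.
    · refine ⟨-J, by linarith, ?_⟩
      unfold gapCubic
      nlinarith [mul_nonneg (by linarith : 0 ≤ r - 2) (sq_nonneg J)]

theorem exists_neg_zero {r : ℝ} (hr : 2 ≤ r) : ∃ z < 0, gapCubic r z 0 = 0 := by
  have hc : Continuous fun J => gapCubic r J 0 := by unfold gapCubic; fun_prop
  have h1 : gapCubic r (-2) 0 ≤ 0 := by unfold gapCubic; nlinarith
  have h2 : 0 ≤ gapCubic r 0 0 := by unfold gapCubic; norm_num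
  obtain ⟨z, hz, hz0⟩ := intermediate_value_Icc (by norm_num : (-2 : ℝ) ≤ 0) hc.continuousOn
    ⟨h1, h2⟩
  refine ⟨z, lt_of_le_of_ne hz.2 ?_, hz0⟩
  rintro rfl
  unfold gapCubic at hz0
  norm_num at hz0

theorem exists_pos_zero {r : ℝ} (hr : 2 ≤ r) : ∃ z, 0 < z ∧ z ≤ 1 ∧ gapCubic r z 0 = 0 := by
  have hc : Continuous fun J => gapCubic r J 0 := by unfold gapCubic; fun_prop
  -- The value is `4 - 2r`, which is zero for `r = 2`; this is why the case `s = 1` has the endpoint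
  -- exactly `1`.
  have h1 : gapCubic r 1 0 ≤ 0 := by unfold gapCubic; nlinarith
  have h2 : 0 ≤ gapCubic r 0 0 := by unfold gapCubic; norm_num
  obtain ⟨z, hz, hz0⟩ := intermediate_value_Icc' (by norm_num : (0 : ℝ) ≤ 1) hc.continuousOn
    ⟨h1, h2⟩
  refine ⟨z, lt_of_le_of_ne hz.1 ?_, hz.2, hz0⟩
  rintro rfl
  unfold gapCubic at hz0
  norm_num at hz0

/-- The point `2 (1 - u)` is what interpolation between `J = 0` and the endpoint guarantees for the
energies not governed by the cubic; the lowest root lies below it. -/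
theorem gapCubic_nonpos_of_mul {r z u : ℝ} (hr : 2 ≤ r) (hz : gapCubic r z 0 = 0) (hz1 : z ≤ 1)
    (hu : 0 ≤ u) (hu1 : u ≤ 1) : gapCubic r (u * z) (2 * (1 - u)) ≤ 0 := by
  have e : gapCubic r (u * z) (2 * (1 - u)) =
      -(u * (1 - u) * (4 - (1 + 3 * u) * z + (1 + r) * u * z ^ 2)) := by
    unfold gapCubic at hz ⊢
    linear_combination u ^ 3 * hz
  rw [e, neg_nonpos]
  have h1 : (1 + 3 * u) * z ≤ 4 := by nlinarith
  have h2 : 0 ≤ (1 + r) * u * z ^ 2 := by positivity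
  exact mul_nonneg (mul_nonneg hu (by linarith)) (by linarith)

theorem gapCubic_zero_antitone {r a b : ℝ} (hr : 2 ≤ r) (ha : 0 ≤ a) (hab : a ≤ b) (hb : b ≤ 1) :
    gapCubic r b 0 ≤ gapCubic r a 0 := by
  have e : gapCubic r b 0 - gapCubic r a 0 =
      (b - a) * (-5 + (a + b) - r * (3 * (a + b) - (b ^ 2 + a * b + a ^ 2))) := by
    unfold gapCubic; ring
  have h1 : 0 ≤ 3 * (a + b) - (b ^ 2 + a * b + a ^ 2) := by nlinarith
  have h2 : 0 ≤ r * (3 * (a + b) - (b ^ 2 + a * b + a ^ 2)) := mul_nonneg (by linarith) h1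
  nlinarith

/-- With `t = -z s`, these are the inputs of `IsPair.re_inner_energy_two_pos`; the second one is
four times `38 t + 2 s (s + 1) z² < 75`. -/
theorem neg_zero_bounds {s : ℕ} (hs : 1 ≤ s) {z : ℝ} (hz : gapCubic (s * (s + 1)) z 0 = 0)
    (hz0 : z < 0) :
    -z * s < 2 ∧ 152 * (-z * s) + 8 * (s * (s + 1)) * z ^ 2 < 300 := by
  have hs' : (1 : ℝ) ≤ s := by exact_mod_cast hs
  obtain ⟨x, rfl⟩ : ∃ x, z = -x := ⟨-z, by ring⟩
  have hx : 0 < x := by linarith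
  -- The equation for `z` reads `8 + 5x + x² = ((xs)² + xs·x)(3 + x)`, and from `xs = 1.66` on the
  -- right side is too large. The value is small enough for the sharper bound, since `152 · 1.66 +
  -- 16 · 1.66² < 300`.
  have h1 : x * s < 1.66 := by
    by_contra! hcon
    unfold gapCubic at hz
    have h2 : 8 + 5 * x + x ^ 2 - ((x * s) ^ 2 + x * s * x) * (3 + x) = 0 := by
      linear_combination hz
    have h3 : (1.66 ^ 2 + 1.66 * x) * (3 + x) ≤ ((x * s) ^ 2 + x * s * x) * (3 + x) := by
      gcongr
    nlinarith
  rw [neg_neg]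
  refine ⟨by linarith, ?_⟩
  have h2 : x ≤ x * s := by nlinarith
  have h3 : (x * s) ^ 2 ≤ 1.66 ^ 2 := by gcongr
  have h4 : x * s * x ≤ (x * s) ^ 2 := by nlinarith
  nlinarith

/-- Here `t = z (s + 1)`. For `s = 1` the borderline `t = 2` is attained, so this case is kept apart
throughout. -/
theorem pos_zero_bounds {s : ℕ} (hs : 1 ≤ s) {z : ℝ} (hz : gapCubic (s * (s + 1)) z 0 = 0)
    (hz0 : 0 < z) (hz1 : z ≤ 1) :
    (s = 1 ∧ z = 1) ∨ (z * (s + 1) < 2 ∧ 152 * (z * (s + 1)) + 8 * (s * (s + 1)) * z ^ 2 < 300) := by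
  rcases hs.eq_or_lt with rfl | hs2
  · left
    refine ⟨rfl, ?_⟩
    unfold gapCubic at hz
    have h1 : (z - 1) * (2 * z ^ 2 - 3 * z - 8) = 0 := by push_cast at hz; linear_combination hz
    rcases mul_eq_zero.1 h1 with h | h
    · linarith
    · nlinarith
  right
  rcases (show 2 ≤ s from hs2).eq_or_lt with rfl | hs3
  -- The value at `0` decreases in the coupling on `[0, 1]`, so a trial coupling at which it is
  -- already negative bounds `z` from above; the same device with `1.8 / (s + 1)` serves for `s ≥
  -- 3`.
  · have h1 : z < 0.615 := by
      by_contra! hcon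
      have := gapCubic_zero_antitone (r := ((2 : ℕ) : ℝ) * ((2 : ℕ) + 1)) (by norm_num)
        (by norm_num : (0 : ℝ) ≤ 0.615) hcon hz1
      rw [hz] at this
      unfold gapCubic at this
      norm_num at this
    push_cast
    constructor <;> nlinarith
  · have hs' : (3 : ℝ) ≤ s := by exact_mod_cast hs3
    have hpos : (0 : ℝ) < s + 1 := by linarith
    have h1 : z * (s + 1) < 1.8 := by
      by_contra! hcon
      set p : ℝ := 1.8 / (s + 1) with hp
      have hps : p * (s + 1) = 1.8 := by rw [hp]; field_simp
      have hp0 : 0 ≤ p := by positivity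
      have hpz : p ≤ z := by rw [hp, div_le_iff₀ hpos]; exact hcon
      have hp4 : p ≤ 0.45 := by nlinarith
      have := gapCubic_zero_antitone (r := (s : ℝ) * (s + 1)) (by nlinarith) hp0 hpz hz1
      rw [hz] at this
      have e : gapCubic ((s : ℝ) * (s + 1)) p 0 =
          8 - 5 * p + p ^ 2 - ((p * (s + 1)) ^ 2 - (p * (s + 1)) * p) * (3 - p) := by
        unfold gapCubic; ring
      rw [e, hps] at this
      nlinarith
    refine ⟨by linarith, ?_⟩
    have h2 : (z * (s + 1)) ^ 2 ≤ 1.8 ^ 2 := by gcongr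
    have h3 : 0 ≤ z ^ 2 * (s + 1) := by positivity
    nlinarith

theorem gapCubic_zero_one_roots {z : ℝ} (hz : gapCubic (((1 : ℕ) : ℝ) * ((1 : ℕ) + 1)) z 0 = 0) :
    (z < 0 → z / 4 = (3 - √73) / 16) ∧ (0 < z → z ≤ 1 → z / 4 = 1 / 4) := by
  have h1 : (z - 1) * (2 * z ^ 2 - 3 * z - 8) = 0 := by
    unfold gapCubic at hz
    push_cast at hz; linear_combination hz
  have hsq : √73 ^ 2 = 73 := Real.sq_sqrt (by norm_num)
  have hpos : 0 < √73 := by positivity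
  have h2 : (z - 1) * ((4 * z - 3 + √73) * (4 * z - 3 - √73)) = 0 := by
    linear_combination 8 * h1 - (z - 1) * hsq
  have h8 : 8 < √73 := by
    apply Real.lt_sqrt_of_sq_lt; norm_num
  rcases mul_eq_zero.1 h2 with h | h
  · exact ⟨fun h0 => by linarith, fun _ _ => by linarith⟩
  rcases mul_eq_zero.1 h with h | h
  · exact ⟨fun _ => by linarith, fun h0 _ => by linarith⟩
  · exact ⟨fun h0 => by linarith, fun _ h0 => by linarith⟩

end Cubic


/-! ### Kernels of squared spins and orthogonal projections -/

section Kernel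

variable {V : Type*} [NormedAddCommGroup V] [InnerProductSpace ℂ V]

/-- A symmetric operator maps the orthogonal complement of an invariant subspace to itself. -/
theorem apply_mem_orthogonal {X : Module.End ℂ V} (hX : X.IsSymmetric) {W : Submodule ℂ V}
    (hW : ∀ v ∈ W, X v ∈ W) {v : V} (hv : v ∈ Wᗮ) : X v ∈ Wᗮ := by
  rw [Submodule.mem_orthogonal] at hv ⊢
  intro u hu
  rw [← hX]
  exact hv _ (hW u hu)

variable [FiniteDimensional ℂ V]

theorem starProjection_apply_comm {X : Module.End ℂ V} (hX : X.IsSymmetric) {W : Submodule ℂ V}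
    (hW : ∀ v ∈ W, X v ∈ W) (v : V) : W.starProjection (X v) = X (W.starProjection v) := by
  refine (Submodule.eq_starProjection_of_mem_of_inner_eq_zero
    (hW _ (Submodule.starProjection_apply_mem W v)) fun w hw => ?_)
  rw [← map_sub, hX]
  exact (Submodule.mem_orthogonal' W _).1 (Submodule.sub_starProjection_mem_orthogonal v) _
    (hW w hw)

variable {X : Fin 3 → Module.End ℂ V}

/-- Beyond `0`, the smallest value of `n (n + 1)` is `2`. -/
theorem IsSpin.two_le_re_inner_casimir (hX : IsSpin X) {v : V}
    (hv : v ∈ (LinearMap.ker (casimir X))ᗮ) : 2 * ‖v‖ ^ 2 ≤ (⟪v, casimir X v⟫_ℂ).re := by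
  refine le_re_inner_of_eigen hX.casimir_symm _
    (fun u hu => apply_mem_orthogonal hX.casimir_symm (fun w hw => ?_) hu)
    (fun μ ψ hψ h0 hμ => ?_) hv
  · rw [LinearMap.mem_ker] at hw ⊢
    rw [hw, map_zero]
  · obtain ⟨n, hn⟩ := hX.casimir_eigenvalue h0 hμ
    rcases n with - | n
    · exfalso
      have hk : ψ ∈ LinearMap.ker (casimir X) := by
        rw [LinearMap.mem_ker, hμ, hn]; simp
      exact h0 (inner_self_eq_zero.1 ((Submodule.mem_orthogonal _ _).1 hψ ψ hk))
    · rw [hn]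
      push_cast
      nlinarith [(n.cast_nonneg : (0 : ℝ) ≤ n)]

theorem re_inner_sub_starProjection (W : Submodule ℂ V) (v : V) :
    ‖v‖ ^ 2 = ‖W.starProjection v‖ ^ 2 + ‖v - W.starProjection v‖ ^ 2 := by
  have h : ⟪W.starProjection v, v - W.starProjection v⟫_ℂ = 0 :=
    (Submodule.mem_orthogonal W _).1 (Submodule.sub_starProjection_mem_orthogonal v) _
      (Submodule.starProjection_apply_mem W v)
  have := norm_add_sq_eq_norm_sq_add_norm_sq_of_inner_eq_zero _ _ h
  rw [add_sub_cancel] at this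
  nlinarith

theorem IsSpin.two_mul_le_re_inner_casimir (hX : IsSpin X) (v : V) :
    2 * (‖v‖ ^ 2 - ‖(LinearMap.ker (casimir X)).starProjection v‖ ^ 2) ≤
      (⟪v, casimir X v⟫_ℂ).re := by
  set W := LinearMap.ker (casimir X) with hW
  have h1 := hX.two_le_re_inner_casimir (Submodule.sub_starProjection_mem_orthogonal (K := W) v)
  have h2 : casimir X (W.starProjection v) = 0 := Submodule.starProjection_apply_mem W v
  have h3 : ⟪v - W.starProjection v, casimir X (v - W.starProjection v)⟫_ℂ =
      ⟪v, casimir X v⟫_ℂ := by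
    rw [← hX.casimir_symm, map_sub, h2, sub_zero, hX.casimir_symm, map_sub, h2, sub_zero]
  rw [h3] at h1
  have := re_inner_sub_starProjection W v
  linarith

theorem re_inner_starProjection (W : Submodule ℂ V) (v : V) :
    ⟪v, W.starProjection v⟫_ℂ = ((‖W.starProjection v‖ ^ 2 : ℝ) : ℂ) := by
  have h : ⟪v - W.starProjection v, W.starProjection v⟫_ℂ = 0 :=
    (Submodule.mem_orthogonal' W _).1 (Submodule.sub_starProjection_mem_orthogonal v) _
      (Submodule.starProjection_apply_mem W v)
  rw [inner_sub_left, sub_eq_zero] at h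
  rw [h, inner_self_eq_norm_sq_to_K]
  push_cast
  rfl

theorem starProjection_symm (W : Submodule ℂ V) :
    ((W.starProjection : V →L[ℂ] V) : Module.End ℂ V).IsSymmetric := fun u v =>
  Submodule.inner_starProjection_left_eq_right W u v

end Kernel

/-! ### A moment bound for a resolvent -/

section Resolvent

variable {V : Type*} [NormedAddCommGroup V] [InnerProductSpace ℂ V]

/-- An upper bound for `⟪w, (c - N)⁻¹ w⟫`, where `w = (c - N) ψ`, in terms of the second moment
of `N` in the state `w` and an upper bound `2 t` of `N`. -/
theorem resolvent_moment_bound {N : Module.End ℂ V} (hN : N.IsSymmetric) {c t G : ℝ} {ψ w : V}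
    (hct : 2 * t ≤ c) (hw : w = (c : ℂ) • ψ - N ψ) (hwψ : ⟪w, ψ⟫_ℂ = ((‖w‖ ^ 2 : ℝ) : ℂ))
    (h1 : ⟪w, N w⟫_ℂ = 0) (h2 : ⟪w, N (N w)⟫_ℂ = ((G * ‖w‖ ^ 2 : ℝ) : ℂ))
    (hη : (⟪ψ + N ψ, N (ψ + N ψ)⟫_ℂ).re ≤ 2 * t * ‖ψ + N ψ‖ ^ 2) :
    ((c - 2 * t) * (c ^ 2 + c - 1) - 1 - G) * ‖w‖ ^ 2 ≤ 0 := by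
  set η := ψ + N ψ with hηdef
  set D := (c - 2 * t) * (c + 1) ^ 2 with hD
  set q₀ := c ^ 2 - 2 * t * c + 2 * c - 4 * t + 1 with hq₀
  set q₁ := c - 2 * t + 2 with hq₁
  -- Operator form of `(n² + q₁ n + q₀)(c - n) = D + (2t - n)(n + 1)²`. The quadratic polynomial
  -- divided by `D` bounds `1 / (c - n)` from above for `n ≤ 2t < c`, touching it at `n = -1` and
  -- meeting it at `n = 2t`.
  have key : (q₀ : ℂ) • w + (q₁ : ℂ) • N w + N (N w) =
      (D : ℂ) • ψ + (((2 * t : ℝ) : ℂ) • (η + N η) - N (η + N η)) := by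
    simp only [hw, hηdef, map_sub, map_add, map_smul, hD, hq₀, hq₁]
    push_cast
    module
  have h3 := congrArg (fun v => (⟪w, v⟫_ℂ).re) key
  have hww : ⟪w, w⟫_ℂ = ((‖w‖ ^ 2 : ℝ) : ℂ) := by
    rw [inner_self_eq_norm_sq_to_K]; push_cast; rfl
  -- The remainder is nonnegative: one factor `1 + N` is moved to `w`, and `(1 + N) w = (c - N) η =
  -- (2t - N) η + (c - 2t) η`.
  have h4 : (⟪w, ((2 * t : ℝ) : ℂ) • (η + N η) - N (η + N η)⟫_ℂ).re =
      ‖((2 * t : ℝ) : ℂ) • η - N η‖ ^ 2 + (c - 2 * t) * (2 * t * ‖η‖ ^ 2 - (⟪η, N η⟫_ℂ).re) := by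
    have e1 : ⟪w, ((2 * t : ℝ) : ℂ) • (η + N η) - N (η + N η)⟫_ℂ =
        ⟪w + N w, ((2 * t : ℝ) : ℂ) • η - N η⟫_ℂ := by
      simp only [smul_add, map_add, inner_sub_right, inner_add_right, inner_smul_right,
        inner_add_left, hN w]
      ring
    have e2 : w + N w = (((2 * t : ℝ) : ℂ) • η - N η) + ((c - 2 * t : ℝ) : ℂ) • η := by
      simp only [hw, hηdef, map_sub, map_add, map_smul]
      push_cast
      module
    rw [e1, e2, inner_add_left, inner_smul_left, Complex.conj_ofReal, Complex.add_re,
      Complex.re_ofReal_mul, inner_sub_right η, inner_smul_right, Complex.sub_re,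
      Complex.re_ofReal_mul, ← inner_self_eq_norm_sq (𝕜 := ℂ) η,
      ← inner_self_eq_norm_sq (𝕜 := ℂ) (((2 * t : ℝ) : ℂ) • η - N η)]
    rfl
  simp only [inner_add_right, inner_smul_right, Complex.add_re, Complex.re_ofReal_mul, h1, h2, hww,
    hwψ, h4, Complex.ofReal_re, mul_zero, add_zero] at h3
  have h5 : 0 ≤ ‖((2 * t : ℝ) : ℂ) • η - N η‖ ^ 2 := by positivity
  have h6 : 0 ≤ (c - 2 * t) * (2 * t * ‖η‖ ^ 2 - (⟪η, N η⟫_ℂ).re) :=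
    mul_nonneg (by linarith) (by linarith)
  have e : (c - 2 * t) * (c ^ 2 + c - 1) - 1 - G = D - q₀ - G := by rw [hD, hq₀]; ring
  rw [e]
  linarith

end Resolvent

/-! ### Positivity of the pair energy at the boundary of the stability interval -/

/-- `z` is a coupling at which the lowest root of the cubic vanishes; `t` measures the lowest
value of `z x ⬝ S`. -/
structure IsEndpoint (s : ℕ) (z t : ℝ) : Prop where
  root : gapCubic (s * (s + 1)) z 0 = 0
  le_one : z ≤ 1
  sign : (0 < z ∧ t = z * (s + 1)) ∨ (z < 0 ∧ t = -z * s)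
  bound : (s = 1 ∧ z = 1) ∨ (t < 2 ∧ 152 * t + 8 * (s * (s + 1)) * z ^ 2 < 300)

section Endpoint

variable {V : Type*} [NormedAddCommGroup V] [InnerProductSpace ℂ V] [FiniteDimensional ℂ V]
  {s : ℕ} {A x S : Fin 3 → Module.End ℂ V} {z t : ℝ}

theorem IsEndpoint.le_two (hz : IsEndpoint s z t) : t ≤ 2 := by
  rcases hz.bound with ⟨rfl, rfl⟩ | h
  · rcases hz.sign with h | h
    · rw [h.2]; norm_num
    · linarith
  · exact h.1.le

/-- For spins `s` and `j` the scalar product lies between `-(s + 1) j` and `s j`; the sign of `z`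
decides which end matters. -/
theorem IsEndpoint.le_re_inner (hz : IsEndpoint s z t) (h : IsPair s A x S) (j : ℕ) {v : V}
    (hv : casimir S v = ((j * (j + 1) : ℝ) : ℂ) • v) :
    -(t * j) * ‖v‖ ^ 2 ≤ z * (⟪v, scalarProd x S v⟫_ℂ).re := by
  refine h.le_re_inner_scalarProd (fun k k1 k2 k3 => ?_) hv
  have hs0 : (0 : ℝ) ≤ s := s.cast_nonneg
  have hj0 : (0 : ℝ) ≤ j := j.cast_nonneg
  have hk0 : (0 : ℝ) ≤ k := k.cast_nonneg
  have k1' : (k : ℝ) ≤ s + j := by exact_mod_cast k1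
  have k2' : (s : ℝ) ≤ k + j := by exact_mod_cast k2
  have k3' : (j : ℝ) ≤ k + s := by exact_mod_cast k3
  rcases hz.sign with ⟨h0, rfl⟩ | ⟨h0, rfl⟩
  · have : -((s + 1) * j : ℝ) ≤ (k * (k + 1) - s * (s + 1) - j * (j + 1)) / 2 := by
      rcases le_total (s : ℝ) j with hsj | hsj <;> nlinarith
    nlinarith [mul_le_mul_of_nonneg_left this h0.le]
  · have : (k * (k + 1) - s * (s + 1) - j * (j + 1)) / 2 ≤ (s * j : ℝ) := by nlinarith
    nlinarith [mul_le_mul_of_nonneg_left this (neg_nonneg.2 h0.le)]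

/-- Since `A² ≥ 2 (1 - P)`, with `P` the projection on the singlets of the first triangle, it
suffices that `4 - N - P` is positive for `N = -z x·S`. An eigenvalue `μ ≤ 0` gives `P χ = (c - N)
χ` with `c = 4 - μ`. In the state `P χ`, the first moment of `N` vanishes and the second is known,
so the resolvent bound forces `P χ = 0`; then `N` would have the eigenvalue `c > 2t`. -/
theorem IsPair.re_inner_energy_two_pos (h : IsPair s A x S) (ht : t < 2)
    (hb : 152 * t + 8 * (s * (s + 1)) * z ^ 2 < 300)
    (hT : ∀ v, casimir S v = (6 : ℂ) • v →
      -(t * 2) * ‖v‖ ^ 2 ≤ z * (⟪v, scalarProd x S v⟫_ℂ).re) {ψ : V}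
    (hψ : casimir S ψ = (6 : ℂ) • ψ) (h0 : ψ ≠ 0) : 0 < (⟪ψ, pairEnergy A x S z ψ⟫_ℂ).re := by
  set K := LinearMap.ker (casimir A) with hK
  set W := (casimir S).eigenspace (6 : ℂ) with hW
  set P : Module.End ℂ V := ((K.starProjection : V →L[ℂ] V) : Module.End ℂ V) with hP
  set N : Module.End ℂ V := ((-z : ℝ) : ℂ) • scalarProd x S with hN
  have hNs : N.IsSymmetric := isSymmetric_ofReal_smul h.symm_scalarProd _
  have hNv : ∀ v, N v = ((-z : ℝ) : ℂ) • scalarProd x S v := fun v => rfl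
  have hSK : ∀ v ∈ K, casimir S v ∈ K := fun v hv => by
    have := LinearMap.congr_fun h.commute_casimirS_casimirA.eq v
    simp only [Module.End.mul_apply] at this
    rw [hK, LinearMap.mem_ker] at hv ⊢
    rw [← this, hv, map_zero]
  have hPS : ∀ v, P (casimir S v) = casimir S (P v) := fun v =>
    starProjection_apply_comm h.spinS.casimir_symm hSK v
  have hWN : ∀ v ∈ W, N v ∈ W := fun v hv =>
    W.smul_mem _ (apply_mem_eigenspace h.commute_casimirS_scalarProd hv)
  have hWP : ∀ v ∈ W, P v ∈ W := fun v hv => by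
    rw [hW, Module.End.mem_eigenspace_iff] at hv ⊢
    rw [← hPS, hv, map_smul]
  have hNle : ∀ v ∈ W, (⟪v, N v⟫_ℂ).re ≤ 2 * t * ‖v‖ ^ 2 := fun v hv => by
    have := hT v (Module.End.mem_eigenspace_iff.1 hv)
    rw [hNv, inner_smul_right, Complex.re_ofReal_mul]
    linarith
  have hB := re_inner_pos_of_eigen (X := ((4 : ℝ) : ℂ) • (1 : Module.End ℂ V) - N - P)
    (((isSymmetric_ofReal_smul (fun _ _ => rfl) 4).sub hNs).sub (starProjection_symm K)) W
    (fun v hv => W.sub_mem (W.sub_mem (W.smul_mem _ hv) (hWN v hv)) (hWP v hv))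
    (fun μ χ hχ hχ0 hμ => by
      by_contra! hneg
      simp only [LinearMap.sub_apply, LinearMap.smul_apply, Module.End.one_apply] at hμ
      have hw : P χ = ((4 - μ : ℝ) : ℂ) • χ - N χ := by
        push_cast at hμ ⊢
        linear_combination (norm := module) -hμ
      have hwA : ∀ a, A a (P χ) = 0 := (casimir_apply_eq_zero_iff h.spinA.symm).1
        (Submodule.starProjection_apply_mem K χ)
      have hwS : casimir S (P χ) = (6 : ℂ) • P χ := Module.End.mem_eigenspace_iff.1 (hWP χ hχ)
      have hχP : ⟪P χ, χ⟫_ℂ = ((‖P χ‖ ^ 2 : ℝ) : ℂ) := by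
        have h1 : ⟪P χ, χ⟫_ℂ = ⟪χ, P χ⟫_ℂ := starProjection_symm K χ χ
        rw [h1]
        exact re_inner_starProjection K χ
      have hmom := resolvent_moment_bound hNs (c := 4 - μ) (t := t)
        (G := 2 * (s * (s + 1)) * z ^ 2) (by linarith) hw hχP
        (by rw [hNv, inner_smul_right, h.inner_scalarProd_singlet hwA, mul_zero])
        (by
          rw [hNv, hNv, map_smul, smul_smul, inner_smul_right,
            h.inner_scalarProd_sq_singlet hwA hwS, inner_self_eq_norm_sq_to_K]
          push_cast
          simp only [Complex.coe_algebraMap]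
          ring)
        (hNle _ (W.add_mem hχ (hWN χ hχ)))
      -- For `c = 4 - μ ≥ 4` one has `c² + c - 1 ≥ 19`, and `19 (4 - 2t) - 1 > 2 s (s + 1) z²` is
      -- the hypothesis `hb` divided by four.
      have hpos : 0 < (4 - μ - 2 * t) * ((4 - μ) ^ 2 + (4 - μ) - 1) - 1
          - 2 * (s * (s + 1)) * z ^ 2 := by
        have h1 : 19 ≤ (4 - μ) ^ 2 + (4 - μ) - 1 := by nlinarith
        have h2 : 0 < 4 - μ - 2 * t := by linarith
        nlinarith
      have hPχ : P χ = 0 := by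
        have : ‖P χ‖ ^ 2 ≤ 0 := by
          by_contra! hc
          nlinarith [mul_pos hpos hc]
        have : ‖P χ‖ = 0 := by nlinarith [norm_nonneg (P χ)]
        exact norm_eq_zero.1 this
      rw [hPχ] at hw
      have h3 := hNle χ hχ
      rw [← sub_eq_zero.1 hw.symm, re_inner_smul_self] at h3
      have h4 : 0 < ‖χ‖ ^ 2 := by positivity
      nlinarith)
    (Module.End.mem_eigenspace_iff.2 hψ) h0
  have h1 : (⟪ψ, (((4 : ℝ) : ℂ) • (1 : Module.End ℂ V) - N - P) ψ⟫_ℂ).re =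
      4 * ‖ψ‖ ^ 2 + z * (⟪ψ, scalarProd x S ψ⟫_ℂ).re - ‖K.starProjection ψ‖ ^ 2 := by
    have e : ⟪ψ, P ψ⟫_ℂ = ((‖K.starProjection ψ‖ ^ 2 : ℝ) : ℂ) := re_inner_starProjection K ψ
    simp only [LinearMap.sub_apply, LinearMap.smul_apply, Module.End.one_apply, inner_sub_right,
      Complex.sub_re, re_inner_smul_self, hNv, e, Complex.ofReal_re]
    rw [inner_smul_right, Complex.re_ofReal_mul]
    ring
  rw [h1] at hB
  have h2 := h.spinA.two_mul_le_re_inner_casimir ψ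
  have h3 : (⟪ψ, casimir S ψ⟫_ℂ).re = 6 * ‖ψ‖ ^ 2 := by
    rw [hψ]; exact_mod_cast re_inner_smul_self 6 ψ
  rw [re_inner_pairEnergy, h3]
  linarith

/-- If the second triangle has total spin at least two, the energy at an endpoint is positive. -/
theorem IsEndpoint.re_inner_energy_pos (hz : IsEndpoint s z t) (h : IsPair s A x S) {j : ℕ}
    (hj : 2 ≤ j) {ψ : V} (hψ : casimir S ψ = ((j * (j + 1) : ℝ) : ℂ) • ψ) (h0 : ψ ≠ 0) :
    0 < (⟪ψ, pairEnergy A x S z ψ⟫_ℂ).re := by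
  have hn : 0 < ‖ψ‖ ^ 2 := by positivity
  have hS : (⟪ψ, casimir S ψ⟫_ℂ).re = j * (j + 1) * ‖ψ‖ ^ 2 := by
    rw [hψ, re_inner_smul_self]
  have hA : 0 ≤ (⟪ψ, casimir A ψ⟫_ℂ).re := by
    rw [re_inner_casimir h.spinA.symm]; positivity
  have hj' : (2 : ℝ) ≤ j := by exact_mod_cast hj
  rcases hz.bound with ⟨rfl, rfl⟩ | ⟨ht, hb⟩
  · have h1 := h.le_re_inner_scalarProd (J := 1) (b := -(j + 1)) (fun k k1 k2 k3 => by
      have k3' : (j : ℝ) ≤ k + 1 := by exact_mod_cast k3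
      push_cast
      nlinarith [(k.cast_nonneg : (0 : ℝ) ≤ k)]) hψ
    rw [re_inner_pairEnergy, hS]
    -- The bound `x·S ≥ -(j + 1)` leaves `(j + 1)(j - 2) / 2`, which is zero for `j = 2`. Strictness
    -- comes from `A² > 0`, or else from the vanishing of the coupling in singlets of `A`.
    rcases hA.eq_or_lt with hA0 | hA0
    · have hA0' : ∀ a, A a ψ = 0 := by
        rw [re_inner_casimir h.spinA.symm] at hA0
        intro a
        have := (Finset.sum_eq_zero_iff_of_nonneg (fun a _ => sq_nonneg ‖A a ψ‖)).1 hA0.symm a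
          (Finset.mem_univ a)
        simpa using this
      rw [h.inner_scalarProd_singlet hA0', ← hA0]
      simp only [Complex.zero_re, mul_zero, add_zero, zero_div]
      positivity
    · nlinarith [mul_nonneg (mul_nonneg (by linarith : (0 : ℝ) ≤ j + 1)
        (by linarith : (0 : ℝ) ≤ j - 2)) hn.le]
  · rcases hj.eq_or_lt with rfl | hj3
    · have e : ∀ v : V, (((((2 : ℕ) : ℝ) * (((2 : ℕ) : ℝ) + 1) : ℝ)) : ℂ) • v = (6 : ℂ) • v :=
        fun v => by norm_num
      refine h.re_inner_energy_two_pos ht hb (fun v hv => ?_) (by rw [hψ, e]) h0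
      exact_mod_cast hz.le_re_inner h 2 (by rw [hv, e])
    · have h1 := hz.le_re_inner h j hψ
      rw [re_inner_pairEnergy, hS]
      have hj3' : (3 : ℝ) ≤ j := by exact_mod_cast hj3
      have : 0 < (j * ((j + 1) / 2 - t) : ℝ) := by
        have : 0 < ((j + 1) / 2 - t : ℝ) := by linarith
        positivity
      nlinarith [mul_pos this hn]

theorem IsEndpoint.le_re_inner_energy_one (hz : IsEndpoint s z t) (h : IsPair s A x S) {ψ : V}
    (hψ : casimir S ψ = (2 : ℂ) • ψ) (hA : ψ ∈ (LinearMap.ker (casimir A))ᗮ) :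
    (2 - t) * ‖ψ‖ ^ 2 ≤ (⟪ψ, pairEnergy A x S z ψ⟫_ℂ).re := by
  have h1 := hz.le_re_inner h 1 (v := ψ) (by rw [hψ]; norm_num)
  have h2 := h.spinA.two_le_re_inner_casimir hA
  have h3 : (⟪ψ, casimir S ψ⟫_ℂ).re = 2 * ‖ψ‖ ^ 2 := by
    rw [hψ]; exact_mod_cast re_inner_smul_self 2 ψ
  rw [re_inner_pairEnergy, h3]
  push_cast at h1
  linarith

end Endpoint


/-! ### The gap of a pair of triangles -/

section PairGap

variable {V : Type*} [NormedAddCommGroup V] [InnerProductSpace ℂ V]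
  {s : ℕ} {A x S : Fin 3 → Module.End ℂ V} {z t : ℝ}

/-- The energy is affine in the coupling, which reduces all couplings between `0` and `z` to these
two. -/
theorem pairEnergy_mul (A x S : Fin 3 → Module.End ℂ V) (u z : ℝ) (v : V) :
    (⟪v, pairEnergy A x S (u * z) v⟫_ℂ).re =
      (1 - u) * ((⟪v, casimir S v⟫_ℂ).re / 2 + (⟪v, casimir A v⟫_ℂ).re / 2)
        + u * (⟪v, pairEnergy A x S z v⟫_ℂ).re := by
  rw [re_inner_pairEnergy, re_inner_pairEnergy]
  ring

theorem pairEnergy_apply (A x S : Fin 3 → Module.End ℂ V) (J : ℝ) (v : V) :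
    pairEnergy A x S J v = (1 / 2 : ℂ) • casimir S v + (1 / 2 : ℂ) • casimir A v
      + (J : ℂ) • scalarProd x S v := rfl

theorem scalarProd_apply_eq_zero {v : V} (hv : ∀ a, S a v = 0) : scalarProd x S v = 0 := by
  simp [scalarProd, hv]

theorem IsPair.energy_singlets (h : IsPair s A x S) {J : ℝ} {v : V}
    (hv : v ∈ LinearMap.ker (casimir S) ⊓ LinearMap.ker (casimir A)) :
    pairEnergy A x S J v = 0 := by
  have h1 : casimir S v = 0 := hv.1
  have h2 : casimir A v = 0 := hv.2
  rw [pairEnergy_apply, h1, h2,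
    scalarProd_apply_eq_zero ((casimir_apply_eq_zero_iff h.spinS.symm).1 h1)]
  simp

/-- The action of the pair energy on `w, T w, T² w`, where the second triangle has spin one and
`w` is a singlet of the first triangle. -/
theorem IsPair.energy_levels [FiniteDimensional ℂ V] (h : IsPair s A x S) (J : ℝ) {w : V}
    (hA : ∀ a, A a w = 0) (hS : casimir S w = (2 : ℂ) • w) :
    pairEnergy A x S J w = w + (J : ℂ) • scalarProd x S w ∧
    pairEnergy A x S J (scalarProd x S w) =
      (2 : ℂ) • scalarProd x S w + (J : ℂ) • scalarProd x S (scalarProd x S w) ∧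
    pairEnergy A x S J (scalarProd x S (scalarProd x S w)) =
      ((s * (s + 1) * (J - 2) : ℝ) : ℂ) • w + ((1 + J * (s * (s + 1) - 1) : ℝ) : ℂ) • scalarProd x S w
        + ((4 - 2 * J : ℝ) : ℂ) • scalarProd x S (scalarProd x S w) := by
  have hST : ∀ v, casimir S v = (2 : ℂ) • v →
      casimir S (scalarProd x S v) = (2 : ℂ) • scalarProd x S v := fun v hv =>
    Module.End.mem_eigenspace_iff.1
      (apply_mem_eigenspace h.commute_casimirS_scalarProd (Module.End.mem_eigenspace_iff.2 hv))
  refine ⟨?_, ?_, ?_⟩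
  · rw [pairEnergy_apply, hS, (casimir_apply_eq_zero_iff h.spinA.symm).2 hA]
    module
  · rw [pairEnergy_apply, hST _ hS, h.casimirA_scalarProd hA]
    module
  · rw [pairEnergy_apply, hST _ (hST _ hS), h.casimirA_scalarProd_scalarProd hA hS,
      h.scalarProd_cubic hS]
    push_cast
    module

/-- If `x + S` annihilates a state, then so does every `A - x` of the same length as its
restriction to the state. -/
theorem IsPair.sub_apply_eq_zero (h : IsPair s A x S) {ψ : V} (hxS : ∀ a, x a ψ = -S a ψ)
    (hc : casimir A ψ = casimir x ψ) : ∀ a, (A a - x a) ψ = 0 := by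
  set L : Fin 3 → Module.End ℂ V := fun a => A a - x a with hL
  have hLs : ∀ a, (L a).IsSymmetric := fun a => (h.spinA.symm a).sub (h.spinx.symm a)
  have hLx : ∀ a b, Commute (x a) (L b) := fun a b => (h.commL b a).symm
  have hLS : ∀ a b, Commute (L a) (S b) := fun a b => (h.commAS a b).sub_left (h.commxS a b)
  have hA : A = x + L := by ext a; simp [hL]
  have hdec := LinearMap.congr_fun (casimir_add (X := x) (Y := L) hLx) ψ
  rw [← hA] at hdec
  simp only [LinearMap.add_apply, LinearMap.smul_apply, hc] at hdec
  -- The spins `x` and `S` form a singlet, in which the vector operator `x` has no expectation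
  -- value, even next to the commuting `L`. Replacing `x` by `-S` one factor at a time makes both
  -- orders of `x a, x b` agree.
  have hkey : ∀ a b c, (x a * x b - x b * x a = Complex.I • x c) → ∀ d,
      ⟪ψ, x c (L d ψ)⟫_ℂ = 0 := by
    intro a b c hcomm d
    have h1 := LinearMap.congr_fun hcomm (L d ψ)
    simp only [LinearMap.sub_apply, Module.End.mul_apply, LinearMap.smul_apply] at h1
    have h2 : x a (L d ψ) = -S a (L d ψ) := by
      have e1 := LinearMap.congr_fun (hLx a d).eq ψ
      have e2 := LinearMap.congr_fun (hLS d a).eq ψ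
      simp only [Module.End.mul_apply] at e1 e2
      rw [e1, hxS, map_neg, e2]
    have h3 := congrArg (fun v => ⟪ψ, v⟫_ℂ) h1
    have e3 := LinearMap.congr_fun (h.commxS b a).eq (L d ψ)
    simp only [Module.End.mul_apply] at e3
    simp only [inner_sub_right, inner_smul_right, h2, map_neg, inner_neg_right, e3,
      ← h.spinx.symm a ψ, hxS, inner_neg_left, h.spinS.symm a ψ] at h3
    have : Complex.I * ⟪ψ, x c (L d ψ)⟫_ℂ = 0 := by rw [← h3]; ring
    exact (mul_eq_zero.1 this).resolve_left Complex.I_ne_zero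
  have h0 : ⟪ψ, scalarProd x L ψ⟫_ℂ = 0 := by
    simp only [scalarProd, LinearMap.add_apply, Module.End.mul_apply, inner_add_right,
      hkey 1 2 0 h.spinx.comm12, hkey 2 0 1 h.spinx.comm20, hkey 0 1 2 h.spinx.comm01, add_zero]
  -- Equality of `A²` and `x²` on `ψ` leaves `L² = -2 x·L` there, whose expectation value is zero.
  have h4 : casimir L ψ = -((2 : ℂ) • scalarProd x L ψ) := by
    linear_combination (norm := module) -hdec
  have h5 : (⟪ψ, casimir L ψ⟫_ℂ).re = 0 := by
    rw [h4, inner_neg_right, inner_smul_right, h0]; simp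
  rw [re_inner_casimir hLs] at h5
  intro a
  have := (Finset.sum_eq_zero_iff_of_nonneg (fun a _ => sq_nonneg ‖L a ψ‖)).1 h5 a
    (Finset.mem_univ a)
  exact norm_eq_zero.1 (pow_eq_zero_iff two_ne_zero |>.1 this)

variable [FiniteDimensional ℂ V]

theorem IsPair.singlet_component (h : IsPair s A x S) {σ : ℂ} {ψ : V}
    (hψ : casimir S ψ = σ • ψ) :
    (∀ a, A a ((LinearMap.ker (casimir A)).starProjection ψ) = 0) ∧
      casimir S ((LinearMap.ker (casimir A)).starProjection ψ) =
        σ • (LinearMap.ker (casimir A)).starProjection ψ := by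
  refine ⟨(casimir_apply_eq_zero_iff h.spinA.symm).1
    (Submodule.starProjection_apply_mem (LinearMap.ker (casimir A)) ψ), ?_⟩
  rw [← starProjection_apply_comm h.spinS.casimir_symm, hψ, map_smul]
  intro v hv
  have := LinearMap.congr_fun h.commute_casimirS_casimirA.eq v
  simp only [Module.End.mul_apply] at this
  rw [LinearMap.mem_ker] at hv ⊢
  rw [← this, hv, map_zero]

/-- The projections of an eigenvector `ψ` on `w, T w, T² w` satisfy a linear system. -/
theorem IsPair.level_equations (h : IsPair s A x S) {J μ : ℝ} {ψ w : V}
    (hA : ∀ a, A a w = 0) (hS : casimir S w = (2 : ℂ) • w)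
    (hμ : pairEnergy A x S J ψ = (μ : ℂ) • ψ) :
    (1 - μ) * ⟪w, ψ⟫_ℂ + J * ⟪scalarProd x S w, ψ⟫_ℂ = 0 ∧
    (2 - μ) * ⟪scalarProd x S w, ψ⟫_ℂ + J * ⟪scalarProd x S (scalarProd x S w), ψ⟫_ℂ = 0 ∧
    s * (s + 1) * (J - 2) * ⟪w, ψ⟫_ℂ + (1 + J * (s * (s + 1) - 1)) * ⟪scalarProd x S w, ψ⟫_ℂ
      + (4 - 2 * J - μ) * ⟪scalarProd x S (scalarProd x S w), ψ⟫_ℂ = 0 := by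
  obtain ⟨e1, e2, e3⟩ := h.energy_levels J hA hS
  have hsym : ∀ v, ⟪pairEnergy A x S J v, ψ⟫_ℂ = μ * ⟪v, ψ⟫_ℂ := fun v => by
    rw [h.symm_energy J, hμ, inner_smul_right]
  have h1 := hsym w
  have h2 := hsym (scalarProd x S w)
  have h3 := hsym (scalarProd x S (scalarProd x S w))
  have e2' : (2 : ℂ) = ((2 : ℝ) : ℂ) := by norm_num
  rw [e2'] at e2
  simp only [e1, e2, e3, inner_add_left, inner_smul_left, Complex.conj_ofReal] at h1 h2 h3
  push_cast at h1 h2 h3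
  exact ⟨by linear_combination h1, by linear_combination h2, by linear_combination h3⟩

/-- Let `w` be the component of `ψ` in the singlets of the first triangle. The determinant of the
system in `level_equations` is the cubic at `μ`, while `⟪w, ψ⟫ = ‖w‖²` is nonzero unless `w = 0`. -/
theorem IsPair.root_or_orthogonal (h : IsPair s A x S) {J μ : ℝ} {ψ : V}
    (hS : casimir S ψ = (2 : ℂ) • ψ) (hμ : pairEnergy A x S J ψ = (μ : ℂ) • ψ) :
    gapCubic (s * (s + 1)) J μ = 0 ∨ ψ ∈ (LinearMap.ker (casimir A))ᗮ := by
  set K := LinearMap.ker (casimir A) with hK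
  obtain ⟨hwA, hwS⟩ := h.singlet_component hS
  obtain ⟨e1, e2, e3⟩ := h.level_equations hwA hwS hμ
  rw [← hK] at e1 e2 e3
  by_cases hw : K.starProjection ψ = 0
  · right
    have := Submodule.sub_starProjection_mem_orthogonal (K := K) ψ
    rwa [hw, sub_zero] at this
  · left
    have h0 : ⟪K.starProjection ψ, ψ⟫_ℂ ≠ 0 := by
      rw [← inner_conj_symm, re_inner_starProjection, Complex.conj_ofReal]
      have : 0 < ‖K.starProjection ψ‖ ^ 2 := by positivity
      exact_mod_cast this.ne'
    have h1 : ((gapCubic (s * (s + 1)) J μ : ℝ) : ℂ) * ⟪K.starProjection ψ, ψ⟫_ℂ = 0 := by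
      unfold gapCubic
      push_cast
      -- The coefficients are the cofactors of the first column.
      linear_combination ((2 - μ) * (4 - 2 * J - μ) - J * (1 + J * (s * (s + 1) - 1)) : ℂ) * e1
        - (J * (4 - 2 * J - μ) : ℂ) * e2 + (J : ℂ) ^ 2 * e3
    have := (mul_eq_zero.1 h1).resolve_right h0
    exact_mod_cast this

/-- The lowest root of the cubic bounds the pair energy from below on the orthogonal complement of
the states in which both triangles are singlets. -/
theorem IsPair.le_re_inner_energy (h : IsPair s A x S) (hs : 1 ≤ s) (hz : IsEndpoint s z t) {u f : ℝ}
    (hu0 : 0 ≤ u) (hu1 : u ≤ 1) (hf : IsLeast {x | gapCubic (s * (s + 1)) (u * z) x = 0} f) {ψ : V}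
    (hψ : ψ ∈ (LinearMap.ker (casimir S) ⊓ LinearMap.ker (casimir A))ᗮ) :
    f * ‖ψ‖ ^ 2 ≤ (⟪ψ, pairEnergy A x S (u * z) ψ⟫_ℂ).re := by
  have hr : (2 : ℝ) ≤ s * (s + 1) := by
    have : (1 : ℝ) ≤ s := by exact_mod_cast hs
    nlinarith
  have hfle : ∀ y, gapCubic (s * (s + 1)) (u * z) y ≤ 0 → f ≤ y := fun y hy => by
    obtain ⟨y', hy', hy0⟩ := exists_root_gapCubic_le hy
    exact (hf.2 hy0).trans hy'
  have hf2 : f ≤ 2 * (1 - u) := hfle _ (gapCubic_nonpos_of_mul hr hz.root hz.le_one hu0 hu1)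
  have hf1 : f ≤ 1 := hfle _ (by
    have huz : u * z ≤ 1 := by nlinarith [hz.le_one]
    have : gapCubic (s * (s + 1)) (u * z) 1 = -(s * (s + 1) * (u * z) ^ 2 * (2 - u * z)) := by
      unfold gapCubic; ring
    rw [this, neg_nonpos]
    exact mul_nonneg (by positivity) (by linarith))
  have hcSA := h.commute_casimirS_casimirA
  have inv : ∀ {X : Module.End ℂ V}, X.IsSymmetric →
      (∀ v ∈ LinearMap.ker (casimir S) ⊓ LinearMap.ker (casimir A), X v = 0) →
      ∀ v ∈ (LinearMap.ker (casimir S) ⊓ LinearMap.ker (casimir A))ᗮ,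
        X v ∈ (LinearMap.ker (casimir S) ⊓ LinearMap.ker (casimir A))ᗮ := fun hX hX0 v hv =>
    apply_mem_orthogonal hX (fun w hw => by rw [hX0 w hw]; exact Submodule.zero_mem _) hv
  refine le_re_inner_of_joint_eigen (h.symm_energy _) h.spinS.casimir_symm
    (h.commute_casimirS_energy _).symm _ (inv (h.symm_energy _) fun v hv => h.energy_singlets hv)
    (inv h.spinS.casimir_symm fun v hv => hv.1) (fun μ ν χ hχ h0 hμ hν => ?_) hψ
  have hn : 0 < ‖χ‖ ^ 2 := by positivity
  have hμ' : (⟪χ, pairEnergy A x S (u * z) χ⟫_ℂ).re = μ * ‖χ‖ ^ 2 := by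
    rw [hμ, re_inner_smul_self]
  have hS : (⟪χ, casimir S χ⟫_ℂ).re = ν * ‖χ‖ ^ 2 := by
    rw [hν, re_inner_smul_self]
  have hA : 0 ≤ (⟪χ, casimir A χ⟫_ℂ).re := by
    rw [re_inner_casimir h.spinA.symm]; positivity
  obtain ⟨n, rfl⟩ := h.spinS.casimir_eigenvalue h0 hν
  -- Spin `0` leaves `A²/2 ≥ 1 ≥ f`. Spin `1` gives a root of the cubic or a state without singlets
  -- of `A`. The latter, as well as spin `≥ 2`, has energy at least `2 (1 - u) ≥ f` by
  -- interpolation.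
  rcases (by omega : n = 0 ∨ n = 1 ∨ 2 ≤ n) with rfl | rfl | hn2
  · have hν0 : casimir S χ = 0 := by rw [hν]; simp
    have hA2 : casimir A χ = ((2 * μ : ℝ) : ℂ) • χ := by
      rw [pairEnergy_apply, hν0,
        scalarProd_apply_eq_zero ((casimir_apply_eq_zero_iff h.spinS.symm).1 hν0)] at hμ
      push_cast
      linear_combination (norm := module) (2 : ℂ) • hμ
    obtain ⟨m, hm⟩ := h.spinA.casimir_eigenvalue h0 hA2
    rcases m with - | m
    · exfalso
      refine h0 (inner_self_eq_zero.1 ((Submodule.mem_orthogonal _ _).1 hχ χ ⟨hν0, ?_⟩))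
      show casimir A χ = 0
      rw [hA2, hm]; simp
    · push_cast at hm
      nlinarith [(m.cast_nonneg : (0 : ℝ) ≤ m)]
  · have hν2 : casimir S χ = (2 : ℂ) • χ := by rw [hν]; norm_num
    rcases h.root_or_orthogonal hν2 hμ with hroot | hort
    · exact hf.2 hroot
    · refine hf2.trans ?_
      have h1 := hz.le_re_inner_energy_one h hν2 hort
      have h2 := h.spinA.two_le_re_inner_casimir hort
      rw [pairEnergy_mul, hS] at hμ'
      have h3 : 0 ≤ (2 - t) * ‖χ‖ ^ 2 := mul_nonneg (by linarith [hz.le_two]) hn.le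
      have h4 := mul_nonneg hu0 (h3.trans h1)
      have h5 : 0 ≤ (1 - u) * ((⟪χ, casimir A χ⟫_ℂ).re - 2 * ‖χ‖ ^ 2) :=
        mul_nonneg (by linarith) (by linarith)
      push_cast at hμ'
      have h6 : 2 * (1 - u) * ‖χ‖ ^ 2 ≤ μ * ‖χ‖ ^ 2 := by linarith
      exact le_of_mul_le_mul_right h6 hn
  · refine hf2.trans ?_
    have h1 := hz.re_inner_energy_pos h hn2 hν h0
    rw [pairEnergy_mul, hS] at hμ'
    have hn2' : (2 : ℝ) ≤ n := by exact_mod_cast hn2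
    have h4 := mul_nonneg hu0 h1.le
    have h5 : 0 ≤ (1 - u) * (⟪χ, casimir A χ⟫_ℂ).re := mul_nonneg (by linarith) hA
    have h7 : (1 - u) * (2 * ‖χ‖ ^ 2) ≤ (1 - u) * ((n * (n + 1) / 2) * ‖χ‖ ^ 2) := by
      refine mul_le_mul_of_nonneg_left (mul_le_mul_of_nonneg_right ?_ hn.le) (by linarith)
      nlinarith
    have h6 : 2 * (1 - u) * ‖χ‖ ^ 2 ≤ μ * ‖χ‖ ^ 2 := by linarith
    exact le_of_mul_le_mul_right h6 hn

theorem IsEndpoint.energy_nonneg (hz : IsEndpoint s z t) (hs : 1 ≤ s) (h : IsPair s A x S) (ψ : V) :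
    0 ≤ (⟪ψ, pairEnergy A x S z ψ⟫_ℂ).re := by
  obtain ⟨f, hf⟩ := exists_isLeast_root (s * (s + 1)) (1 * z)
  have hf0 : 0 ≤ f := by
    by_contra! hneg
    have h1 := gapCubic_zero_add_le (r := s * (s + 1)) (J := 1 * z) (x := f)
      (by simpa using hz.le_one) (by rw [one_mul, hz.root]) hneg.le
    rw [hf.1, one_mul, hz.root] at h1
    have : 0 < (-f) ^ 3 := pow_pos (by linarith) 3
    linarith
  set K := LinearMap.ker (casimir S) ⊓ LinearMap.ker (casimir A)
  have h1 := h.le_re_inner_energy hs hz zero_le_one le_rfl hf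
    (Submodule.sub_starProjection_mem_orthogonal (K := K) ψ)
  have h2 : pairEnergy A x S (1 * z) (K.starProjection ψ) = 0 :=
    h.energy_singlets (Submodule.starProjection_apply_mem K ψ)
  rw [map_sub, h2, sub_zero, ← h.symm_energy, map_sub, h2, sub_zero, h.symm_energy, one_mul] at h1
  exact (mul_nonneg hf0 (sq_nonneg _)).trans h1

theorem IsEndpoint.casimirS_of_energy_eq_zero (hz : IsEndpoint s z t) (h : IsPair s A x S) {ψ : V}
    (hψ : pairEnergy A x S z ψ = 0) : casimir S (casimir S ψ) = (2 : ℂ) • casimir S ψ := by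
  have h1 := apply_eq_zero_of_eigen h.spinS.casimir_symm (LinearMap.ker (pairEnergy A x S z))
    (fun v hv => by
      have := LinearMap.congr_fun (h.commute_casimirS_energy z).eq v
      simp only [Module.End.mul_apply] at this
      rw [LinearMap.mem_ker] at hv ⊢
      rw [← this, hv, map_zero])
    (casimir S * casimir S - (2 : ℂ) • casimir S)
    (fun ν χ hχ h0 hν => by
      obtain ⟨n, rfl⟩ := h.spinS.casimir_eigenvalue h0 hν
      simp only [LinearMap.sub_apply, Module.End.mul_apply, LinearMap.smul_apply, hν, map_smul]
      rcases (by omega : n = 0 ∨ n = 1 ∨ 2 ≤ n) with rfl | rfl | hn2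
      · simp
      · norm_num [smul_smul]
      · have := hz.re_inner_energy_pos h hn2 hν h0
        rw [LinearMap.mem_ker.1 hχ] at this
        simp at this) hψ
  simpa [sub_eq_zero] using h1

/-- In a zero-energy state at an endpoint, if the first triangle has total spin at most one, then
the two spins other than `x` are coupled to a singlet whenever it has total spin one. -/
theorem IsEndpoint.sub_apply_casimirA (hz : IsEndpoint s z t) (hs : 1 ≤ s) (h : IsPair s A x S)
    {ψ : V} (hψ : pairEnergy A x S z ψ = 0) (hA : casimir A (casimir A ψ) = (2 : ℂ) • casimir A ψ)
    (a : Fin 3) : (A a - x a) (casimir A ψ) = 0 := by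
  have hz0 : (z : ℂ) ≠ 0 := by
    rcases hz.sign with h | h
    · exact_mod_cast h.1.ne'
    · exact_mod_cast h.1.ne
  have hSS := hz.casimirS_of_energy_eq_zero h hψ
  have cSE := fun v => LinearMap.congr_fun (h.commute_casimirS_energy z).eq v
  have cSA := fun v => LinearMap.congr_fun h.commute_casimirS_casimirA.eq v
  simp only [Module.End.mul_apply] at cSE cSA
  -- This is the spin-one part of `ψ` for the second triangle. The remaining part has spin zero
  -- there, so its zero energy makes it a singlet of `A` too, and it does not contribute to `A² ψ`.
  set χ := (1 / 2 : ℂ) • casimir S ψ with hχ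
  have hχS : casimir S χ = (2 : ℂ) • χ := by rw [hχ, map_smul, hSS, smul_comm]
  have hχ0 : pairEnergy A x S z χ = 0 := by rw [hχ, map_smul, ← cSE, hψ, map_zero, smul_zero]
  have hχA : casimir A (casimir A χ) = (2 : ℂ) • casimir A χ := by
    rw [hχ, map_smul, map_smul, ← cSA, ← cSA, hA, map_smul, smul_comm]
  have hAψ : casimir A ψ = casimir A χ := by
    have h1 : casimir S (ψ - χ) = 0 := by
      rw [map_sub, hχS, hχ]; module
    have h2 : pairEnergy A x S z (ψ - χ) = 0 := by rw [map_sub, hψ, hχ0, sub_zero]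
    rw [pairEnergy_apply, h1,
      scalarProd_apply_eq_zero ((casimir_apply_eq_zero_iff h.spinS.symm).1 h1)] at h2
    have h3 : casimir A (ψ - χ) = 0 := by
      linear_combination (norm := module) (2 : ℂ) • h2
    rw [map_sub] at h3
    exact sub_eq_zero.1 h3
  rw [hAψ]
  set K := LinearMap.ker (casimir A) with hK
  have hw : K.starProjection χ = 0 := by
    obtain ⟨hwA, hwS⟩ := h.singlet_component hχS
    obtain ⟨e1, e2, e3⟩ := h.level_equations (μ := 0) hwA hwS (by rw [hχ0]; simp)
    have f1 := h.casimirA_scalarProd hwA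
    have f2 := h.casimirA_scalarProd_scalarProd hwA hwS
    rw [← hK] at e1 e2 e3 f1 f2
    set w := K.starProjection χ with hwdef
    have hw0 : casimir A w = 0 := Submodule.starProjection_apply_mem K χ
    -- The assumption `A² (A² - 2) χ = 0` excludes spin two. Tested against `T² w`, with `T = x·S`,
    -- it gives a relation beyond the three level equations, and together they force `w = 0`.
    have e4 : 24 * ⟪scalarProd x S (scalarProd x S w), χ⟫_ℂ + 12 * ⟪scalarProd x S w, χ⟫_ℂ
        - 16 * (s * (s + 1)) * ⟪w, χ⟫_ℂ = 0 := by
      have g1 : ⟪scalarProd x S (scalarProd x S w), casimir A (casimir A χ)⟫_ℂ =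
          2 * ⟪scalarProd x S (scalarProd x S w), casimir A χ⟫_ℂ := by
        rw [hχA, inner_smul_right]
      simp only [← h.spinA.casimir_symm _, f2, f1, map_add, map_sub, map_smul, hw0] at g1
      have c6 : (6 : ℂ) = ((6 : ℝ) : ℂ) := by norm_num
      have c2 : (2 : ℂ) = ((2 : ℝ) : ℂ) := by norm_num
      have hr : (2 * ((s * (s + 1) : ℝ) : ℂ) * 2) = ((4 * (s * (s + 1)) : ℝ) : ℂ) := by
        push_cast; ring
      rw [hr] at g1
      rw [c6, c2] at g1
      simp only [inner_add_left, inner_sub_left, inner_smul_left, Complex.conj_ofReal,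
        smul_zero, inner_zero_left] at g1
      push_cast at g1
      linear_combination g1
    push_cast at e1 e2 e3
    set a0 := ⟪w, χ⟫_ℂ
    set a1 := ⟪scalarProd x S w, χ⟫_ℂ
    set a2 := ⟪scalarProd x S (scalarProd x S w), χ⟫_ℂ
    have ha2 : a2 = -a1 / 2 + 2 * (s * (s + 1)) / 3 * a0 := by linear_combination e4 / 24
    have ha0 : a0 = -(z * a1) := by linear_combination e1
    rw [ha2, ha0] at e2 e3
    have e5 : (z : ℂ) * (4 * (s * (s + 1)) - 3) / 6 * a1 = 0 := by
      linear_combination 2 * e3 + e2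
    have hs3 : (4 * (s * (s + 1)) - 3 : ℂ) ≠ 0 := by
      have : (4 * (s * (s + 1)) - 3 : ℝ) ≠ 0 := by
        have : (1 : ℝ) ≤ s := by exact_mod_cast hs
        nlinarith
      exact_mod_cast this
    have ha1 : a1 = 0 := by
      refine (mul_eq_zero.1 e5).resolve_left ?_
      exact div_ne_zero (mul_ne_zero hz0 hs3) (by norm_num)
    rw [ha1, mul_zero, neg_zero] at ha0
    have : ⟪χ, w⟫_ℂ = 0 := by rw [← inner_conj_symm]; simp [a0, ha0]
    rw [hwdef, re_inner_starProjection] at this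
    have h3 : ‖K.starProjection χ‖ ^ 2 = 0 := by exact_mod_cast this
    simpa using h3
  have hort : χ ∈ Kᗮ := by
    have := Submodule.sub_starProjection_mem_orthogonal (K := K) χ
    rwa [hw, sub_zero] at this
  have hA2 : casimir A χ = (2 : ℂ) • χ := by
    have h1 : casimir A χ - (2 : ℂ) • χ ∈ K := by
      rw [hK, LinearMap.mem_ker, map_sub, hχA, map_smul (casimir A) (2 : ℂ) χ, sub_self]
    have h2 : casimir A χ - (2 : ℂ) • χ ∈ Kᗮ :=
      Kᗮ.sub_mem (apply_mem_orthogonal h.spinA.casimir_symm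
        (fun v hv => by rw [hK, LinearMap.mem_ker] at hv ⊢; rw [hv, map_zero]) hort)
        (Kᗮ.smul_mem _ hort)
    exact sub_eq_zero.1 (inner_self_eq_zero.1 ((Submodule.mem_orthogonal _ _).1 h2 _ h1))
  have hform := hz.le_re_inner_energy_one h hχS hort
  rw [hχ0, inner_zero_right, Complex.zero_re] at hform
  -- Only `s = z = 1` allows a nonzero `χ`: there `x·S = -2` couples `x` and `S` to spin zero, and
  -- `A² = x²` on `χ`. For `t < 2` the form bound gives `χ = 0`.
  rcases hz.bound with ⟨rfl, rfl⟩ | ⟨ht, -⟩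
  · rw [hA2, map_smul]
    have hT : scalarProd x S χ = -((2 : ℂ) • χ) := by
      rw [pairEnergy_apply, hχS, hA2] at hχ0
      push_cast at hχ0
      linear_combination (norm := module) hχ0
    have hx : casimir x χ = (2 : ℂ) • χ := by rw [h.length]; norm_num
    have hxS : casimir (x + S) χ = 0 := by
      rw [casimir_add h.commxS]
      simp only [LinearMap.add_apply, LinearMap.smul_apply, hx, hχS, hT]
      module
    have hxS' := (casimir_apply_eq_zero_iff (h.spinx.add h.spinS h.commxS).symm).1 hxS
    rw [h.sub_apply_eq_zero (fun b => eq_neg_of_add_eq_zero_left (hxS' b)) (hA2.trans hx.symm) a,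
      smul_zero]
  · have : χ = 0 := by
      by_contra hne
      have : 0 < ‖χ‖ ^ 2 := by positivity
      nlinarith
    rw [this, map_zero, map_zero]

end PairGap


/-! ### Spin matrices -/

section SpinMatrices

variable (s : ℕ)

/-- The magnetic quantum number of the basis state `k`. -/
def magnetic (k : Fin (2 * s + 1)) : ℝ := (k : ℝ) - s

theorem spinPlus_apply (i j : Fin (2 * s + 1)) : spinPlus s i j =
    if (i : ℕ) = (j : ℕ) + 1 then
      ((Real.sqrt ((s : ℝ) * (s + 1) - magnetic s j * (magnetic s j + 1)) : ℝ) : ℂ) else 0 := rfl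

theorem raising_radicand_nonneg (j : Fin (2 * s + 1)) :
    0 ≤ (s : ℝ) * (s + 1) - magnetic s j * (magnetic s j + 1) := by
  have h1 : (j : ℝ) ≤ 2 * s := by exact_mod_cast Nat.lt_succ_iff.1 j.2
  have h2 : (0 : ℝ) ≤ j := Nat.cast_nonneg _
  unfold magnetic
  nlinarith

theorem spinPlus_mul_conjTranspose : spinPlus s * (spinPlus s)ᴴ =
    Matrix.diagonal fun k =>
      (((s : ℝ) * (s + 1) - magnetic s k * (magnetic s k - 1) : ℝ) : ℂ) := by
  ext i j
  rw [Matrix.mul_apply, Matrix.diagonal_apply]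
  simp only [Matrix.conjTranspose_apply, spinPlus_apply]
  rcases Nat.eq_zero_or_pos (i : ℕ) with hi | hi
  · rw [Finset.sum_eq_zero (fun k _ => by rw [if_neg (by omega), zero_mul])]
    split_ifs
    · unfold magnetic
      rw [hi]
      push_cast
      ring
    · rfl
  · have hk : (i : ℕ) - 1 < 2 * s + 1 := by have := i.2; omega
    rw [Finset.sum_eq_single (⟨(i : ℕ) - 1, hk⟩ : Fin (2 * s + 1))]
    · rw [if_pos (by show (i : ℕ) = (i - 1) + 1; omega)]
      by_cases hij : i = j
      · subst hij
        rw [if_pos (by show (i : ℕ) = (i - 1) + 1; omega), if_pos rfl, Complex.star_def,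
          Complex.conj_ofReal, ← Complex.ofReal_mul, Real.mul_self_sqrt
          (raising_radicand_nonneg s _)]
        congr 1
        have : magnetic s ⟨(i : ℕ) - 1, hk⟩ = magnetic s i - 1 := by
          unfold magnetic
          push_cast [Nat.cast_sub (show 1 ≤ (i : ℕ) from hi)]
          ring
        rw [this]; ring
      · rw [if_neg (c := (j : ℕ) = _) (fun h => hij (Fin.ext (by
          have h' : (j : ℕ) = (i - 1) + 1 := h
          omega))), if_neg hij, star_zero, mul_zero]
    · intro k _ hk'
      rw [if_neg (fun h => hk' (Fin.ext (by show (k : ℕ) = i - 1; omega))), zero_mul]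
    · simp

theorem conjTranspose_mul_spinPlus : (spinPlus s)ᴴ * spinPlus s =
    Matrix.diagonal fun k =>
      (((s : ℝ) * (s + 1) - magnetic s k * (magnetic s k + 1) : ℝ) : ℂ) := by
  ext i j
  rw [Matrix.mul_apply, Matrix.diagonal_apply]
  simp only [Matrix.conjTranspose_apply, spinPlus_apply]
  rcases (Nat.lt_succ_iff.1 i.2).eq_or_lt with hi | hi
  · rw [Finset.sum_eq_zero (fun k _ => by
      have := k.2
      rw [if_neg (by omega), star_zero, zero_mul])]
    split_ifs
    · unfold magnetic
      rw [hi]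
      push_cast
      ring
    · rfl
  · have hk : (i : ℕ) + 1 < 2 * s + 1 := by omega
    rw [Finset.sum_eq_single (⟨(i : ℕ) + 1, hk⟩ : Fin (2 * s + 1))]
    · rw [if_pos rfl]
      by_cases hij : i = j
      · subst hij
        rw [if_pos rfl, if_pos rfl, Complex.star_def, Complex.conj_ofReal, ← Complex.ofReal_mul,
          Real.mul_self_sqrt (raising_radicand_nonneg s _)]
      · rw [if_neg (c := _ = (j : ℕ) + 1) (fun h => hij (Fin.ext (by
          have h' : (i : ℕ) + 1 = j + 1 := h
          omega))), if_neg hij, mul_zero]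
    · intro k _ hk'
      rw [if_neg (fun h => hk' (Fin.ext h)), star_zero, zero_mul]
    · simp

theorem spinVec_two : spinVec s 2 = Matrix.diagonal fun k => ((magnetic s k : ℝ) : ℂ) := by
  simp [spinVec, magnetic]

theorem spinVec_two_mul_spinPlus :
    spinVec s 2 * spinPlus s - spinPlus s * spinVec s 2 = spinPlus s := by
  ext i j
  rw [spinVec_two, Matrix.sub_apply, Matrix.diagonal_mul, Matrix.mul_diagonal, spinPlus_apply]
  split_ifs with h
  · have : magnetic s i = magnetic s j + 1 := by
      unfold magnetic; rw [h]; push_cast; ring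
    rw [this]; push_cast; ring
  · simp

theorem spinVec_two_isHermitian : (spinVec s 2)ᴴ = spinVec s 2 := by
  rw [spinVec_two, Matrix.diagonal_conjTranspose]
  congr 1
  ext k
  simp

theorem spinVec_two_mul_conjTranspose :
    spinVec s 2 * (spinPlus s)ᴴ - (spinPlus s)ᴴ * spinVec s 2 = -(spinPlus s)ᴴ := by
  have := congrArg Matrix.conjTranspose (spinVec_two_mul_spinPlus s)
  rw [Matrix.conjTranspose_sub, Matrix.conjTranspose_mul, Matrix.conjTranspose_mul,
    spinVec_two_isHermitian] at this
  rw [← neg_sub, this]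

theorem spinPlus_commutator :
    spinPlus s * (spinPlus s)ᴴ - (spinPlus s)ᴴ * spinPlus s = (2 : ℂ) • spinVec s 2 := by
  rw [spinPlus_mul_conjTranspose, conjTranspose_mul_spinPlus, spinVec_two, Matrix.diagonal_sub,
    ← Matrix.diagonal_smul]
  congr 1
  ext k
  simp only [Pi.smul_apply, smul_eq_mul]
  push_cast
  ring

theorem inv_two_mul_I : (1 / (2 * Complex.I) : ℂ) = -(Complex.I / 2) := by
  rw [div_eq_iff (by simp)]
  linear_combination Complex.I_mul_I

theorem spinVec_zero : spinVec s 0 = (1 / 2 : ℂ) • (spinPlus s + (spinPlus s)ᴴ) := rfl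

theorem spinVec_one : spinVec s 1 = (-(Complex.I / 2)) • (spinPlus s - (spinPlus s)ᴴ) := by
  rw [← inv_two_mul_I]; rfl

theorem spinVec_isHermitian (a : Fin 3) : (spinVec s a)ᴴ = spinVec s a := by
  fin_cases a
  · show (spinVec s 0)ᴴ = spinVec s 0
    rw [spinVec_zero, Matrix.conjTranspose_smul, Matrix.conjTranspose_add,
      Matrix.conjTranspose_conjTranspose, add_comm (spinPlus s)ᴴ]
    norm_num
  · show (spinVec s 1)ᴴ = spinVec s 1
    rw [spinVec_one, Matrix.conjTranspose_smul, Matrix.conjTranspose_sub,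
      Matrix.conjTranspose_conjTranspose]
    simp only [star_neg, Complex.star_def, map_div₀, Complex.conj_I, Complex.conj_ofNat]
    module
  · exact spinVec_two_isHermitian s

theorem spinVec_comm01 :
    spinVec s 0 * spinVec s 1 - spinVec s 1 * spinVec s 0 = Complex.I • spinVec s 2 := by
  have h := spinPlus_commutator s
  rw [spinVec_zero, spinVec_one]
  simp only [smul_mul_assoc, mul_smul_comm, mul_add, add_mul, mul_sub, sub_mul]
  linear_combination (norm := module) (Complex.I / 2) • h

theorem spinVec_comm12 :
    spinVec s 1 * spinVec s 2 - spinVec s 2 * spinVec s 1 = Complex.I • spinVec s 0 := by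
  have h1 := spinVec_two_mul_spinPlus s
  have h2 := spinVec_two_mul_conjTranspose s
  rw [spinVec_zero, spinVec_one]
  simp only [smul_mul_assoc, mul_smul_comm, mul_sub, sub_mul, smul_smul, smul_sub, smul_add]
  linear_combination (norm := module) (Complex.I / 2) • h1 - (Complex.I / 2) • h2

theorem spinVec_comm20 :
    spinVec s 2 * spinVec s 0 - spinVec s 0 * spinVec s 2 = Complex.I • spinVec s 1 := by
  have h1 := spinVec_two_mul_spinPlus s
  have h2 := spinVec_two_mul_conjTranspose s
  have hI := Complex.I_mul_I
  rw [spinVec_zero, spinVec_one]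
  simp only [smul_mul_assoc, mul_smul_comm, mul_add, add_mul, smul_smul, smul_sub, smul_add]
  linear_combination (norm := module) (1 / 2 : ℂ) • h1 + (1 / 2 : ℂ) • h2
    + (hI / 2) • spinPlus s - (hI / 2) • (spinPlus s)ᴴ

theorem spinVec_casimir :
    spinVec s 0 * spinVec s 0 + spinVec s 1 * spinVec s 1 + spinVec s 2 * spinVec s 2 =
      ((s * (s + 1) : ℝ) : ℂ) • 1 := by
  have h1 := spinPlus_mul_conjTranspose s
  have h2 := conjTranspose_mul_spinPlus s
  have hI := Complex.I_mul_I
  have h3 : spinVec s 0 * spinVec s 0 + spinVec s 1 * spinVec s 1 =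
      (1 / 2 : ℂ) • (spinPlus s * (spinPlus s)ᴴ + (spinPlus s)ᴴ * spinPlus s) := by
    rw [spinVec_zero, spinVec_one]
    simp only [smul_mul_assoc, mul_smul_comm, mul_add, add_mul, mul_sub, sub_mul, smul_smul,
      smul_sub, smul_add]
    linear_combination (norm := module) (hI / 4) • (spinPlus s * spinPlus s
      - spinPlus s * (spinPlus s)ᴴ - (spinPlus s)ᴴ * spinPlus s + (spinPlus s)ᴴ * (spinPlus s)ᴴ)
  rw [h3, h1, h2, spinVec_two, Matrix.diagonal_mul_diagonal, Matrix.diagonal_add,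
    ← Matrix.diagonal_smul, Matrix.diagonal_add, ← Matrix.diagonal_one, ← Matrix.diagonal_smul]
  congr 1
  ext k
  simp only [Pi.smul_apply, smul_eq_mul]
  push_cast
  ring

end SpinMatrices

/-! ### Operators of single sites -/

section Sites

variable {s : ℕ} {ι : Type} [Fintype ι] [DecidableEq ι]

theorem siteOp_mulVec (i : ι) (M : Matrix (Fin (2 * s + 1)) (Fin (2 * s + 1)) ℂ)
    (ψ : StateVec s ι) (σ : ι → Fin (2 * s + 1)) :
    (siteOp i M *ᵥ ψ) σ = ∑ k, M (σ i) k * ψ (Function.update σ i k) := by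
  rw [Matrix.mulVec, dotProduct]
  symm
  refine Finset.sum_of_injOn (Function.update σ i)
    (Function.update_injective σ i).injOn (fun _ _ => Finset.mem_coe.2 (Finset.mem_univ _))
    (fun τ _ hτ => ?_) (fun k _ => ?_)
  · rw [siteOp, Matrix.of_apply, if_neg, zero_mul]
    intro h
    refine hτ ⟨τ i, Finset.mem_coe.2 (Finset.mem_univ _), ?_⟩
    ext j
    by_cases hj : j = i
    · subst hj; simp
    · simp [hj, h j hj]
  · rw [siteOp, Matrix.of_apply, if_pos (fun j hj => by simp [hj])]
    simp

theorem matrix_ext_mulVec {n : Type} [Fintype n] [DecidableEq n] {A B : Matrix n n ℂ}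
    (h : ∀ v, A *ᵥ v = B *ᵥ v) : A = B :=
  Matrix.toLin'.injective (LinearMap.ext fun v => by simpa using h v)

theorem siteOp_mul (i : ι) (M N : Matrix (Fin (2 * s + 1)) (Fin (2 * s + 1)) ℂ) :
    siteOp i (M * N) = siteOp i M * siteOp i N := by
  refine matrix_ext_mulVec fun ψ => ?_
  ext σ
  rw [← Matrix.mulVec_mulVec]
  simp only [siteOp_mulVec, Function.update_self, Function.update_idem, Matrix.mul_apply,
    Finset.sum_mul, Finset.mul_sum, mul_assoc]
  exact Finset.sum_comm

theorem siteOp_commute {i j : ι} (hij : i ≠ j)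
    (M N : Matrix (Fin (2 * s + 1)) (Fin (2 * s + 1)) ℂ) :
    siteOp i M * siteOp j N = siteOp j N * siteOp i M := by
  refine matrix_ext_mulVec fun ψ => ?_
  ext σ
  rw [← Matrix.mulVec_mulVec, ← Matrix.mulVec_mulVec]
  simp only [siteOp_mulVec, Function.update_of_ne hij, Function.update_of_ne hij.symm,
    Finset.mul_sum]
  rw [Finset.sum_comm]
  refine Finset.sum_congr rfl fun k _ => Finset.sum_congr rfl fun l _ => ?_
  rw [Function.update_comm hij]
  ring

theorem siteOp_add (i : ι) (M N : Matrix (Fin (2 * s + 1)) (Fin (2 * s + 1)) ℂ) :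
    siteOp i (M + N) = siteOp i M + siteOp i N := by
  ext σ τ
  simp only [siteOp, Matrix.of_apply, Matrix.add_apply]
  split_ifs <;> simp

theorem siteOp_sub (i : ι) (M N : Matrix (Fin (2 * s + 1)) (Fin (2 * s + 1)) ℂ) :
    siteOp i (M - N) = siteOp i M - siteOp i N := by
  ext σ τ
  simp only [siteOp, Matrix.of_apply, Matrix.sub_apply]
  split_ifs <;> simp

theorem siteOp_smul (i : ι) (c : ℂ) (M : Matrix (Fin (2 * s + 1)) (Fin (2 * s + 1)) ℂ) :
    siteOp i (c • M) = c • siteOp i M := by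
  ext σ τ
  simp only [siteOp, Matrix.of_apply, Matrix.smul_apply]
  split_ifs <;> simp

theorem siteOp_diagonal (i : ι) (d : Fin (2 * s + 1) → ℂ) :
    siteOp i (Matrix.diagonal d) = Matrix.diagonal fun σ => d (σ i) := by
  ext σ τ
  simp only [siteOp, Matrix.of_apply, Matrix.diagonal_apply]
  by_cases h : σ = τ
  · subst h; simp
  · rw [if_neg h]
    split_ifs with h1 h2
    · exact absurd (funext fun j => by
        by_cases hj : j = i
        · subst hj; exact h2
        · exact h1 j hj) h
    · rfl
    · rfl

theorem siteOp_one (i : ι) :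
    siteOp i (1 : Matrix (Fin (2 * s + 1)) (Fin (2 * s + 1)) ℂ) = 1 := by
  rw [← Matrix.diagonal_one, siteOp_diagonal]
  rfl

theorem siteOp_conjTranspose (i : ι) (M : Matrix (Fin (2 * s + 1)) (Fin (2 * s + 1)) ℂ) :
    (siteOp i M)ᴴ = siteOp i Mᴴ := by
  ext σ τ
  simp only [siteOp, Matrix.of_apply, Matrix.conjTranspose_apply]
  have : (∀ j, j ≠ i → τ j = σ j) ↔ (∀ j, j ≠ i → σ j = τ j) :=
    forall₂_congr fun _ _ => eq_comm
  simp only [this]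
  split_ifs <;> simp

/-- A matrix as an operator on the Hilbert space of states. -/
noncomputable abbrev toOp {n : Type} [Fintype n] [DecidableEq n] :
    Matrix n n ℂ ≃ₐ[ℂ] Module.End ℂ (EuclideanSpace ℂ n) := Matrix.toLpLinAlgEquiv 2

theorem toOp_apply {n : Type} [Fintype n] [DecidableEq n] (A : Matrix n n ℂ)
    (v : EuclideanSpace ℂ n) : toOp A v = WithLp.toLp 2 (A *ᵥ v.ofLp) :=
  Matrix.toLpLin_apply _ _ A v

theorem toOp_isSymmetric {n : Type} [Fintype n] [DecidableEq n] {A : Matrix n n ℂ}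
    (hA : Aᴴ = A) : (toOp A).IsSymmetric :=
  Matrix.isSymmetric_toEuclideanLin_iff.2 hA

variable (s) in
/-- The spin operators of the site `i`. -/
noncomputable def siteSpin (i : ι) :
    Fin 3 → Module.End ℂ (EuclideanSpace ℂ (ι → Fin (2 * s + 1))) :=
  fun a => toOp (siteOp i (spinVec s a))

theorem isSpin_siteSpin (i : ι) : IsSpin (siteSpin s i) where
  symm a := toOp_isSymmetric (by rw [siteOp_conjTranspose, spinVec_isHermitian])
  comm01 := by
    simp only [siteSpin, ← map_mul, ← map_sub, ← siteOp_mul, ← siteOp_sub, spinVec_comm01,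
      siteOp_smul, map_smul]
  comm12 := by
    simp only [siteSpin, ← map_mul, ← map_sub, ← siteOp_mul, ← siteOp_sub, spinVec_comm12,
      siteOp_smul, map_smul]
  comm20 := by
    simp only [siteSpin, ← map_mul, ← map_sub, ← siteOp_mul, ← siteOp_sub, spinVec_comm20,
      siteOp_smul, map_smul]
  integral μ v hv h := by
    obtain ⟨σ, hσ⟩ : ∃ σ, v.ofLp σ ≠ 0 := by
      by_contra! hcon
      exact hv (by ext σ; simpa using hcon σ)
    have h1 := congrArg (fun w : EuclideanSpace ℂ _ => w.ofLp σ) h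
    simp only [siteSpin, spinVec_two, siteOp_diagonal, toOp_apply, Matrix.mulVec_diagonal,
      PiLp.smul_apply, smul_eq_mul] at h1
    have h2 := mul_right_cancel₀ hσ h1
    refine ⟨((σ i : ℕ) : ℤ) - s, ?_⟩
    have h3 : magnetic s (σ i) = μ := Complex.ofReal_injective h2
    rw [← h3, magnetic]
    push_cast
    rfl

theorem casimir_siteSpin (i : ι) : casimir (siteSpin s i) = ((s * (s + 1) : ℝ) : ℂ) • 1 := by
  simp only [casimir, siteSpin, ← map_mul, ← map_add, ← siteOp_mul, ← siteOp_add, spinVec_casimir,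
    siteOp_smul, siteOp_one, map_smul, map_one]

theorem commute_siteSpin {i j : ι} (hij : i ≠ j) (a b : Fin 3) :
    Commute (siteSpin s i a) (siteSpin s j b) := by
  show _ * _ = _ * _
  simp only [siteSpin, ← map_mul, siteOp_commute hij]

theorem toOp_bond (i j : ι) :
    toOp (bond s i j) = scalarProd (siteSpin s i) (siteSpin s j) := by
  simp only [bond, scalarProd, siteSpin, Fin.sum_univ_three, map_add, map_mul]

variable (s) in
/-- The total spin of the three sites `p 0, p 1, p 2`. -/
noncomputable def tripleSpin (p : Fin 3 → ι) :
    Fin 3 → Module.End ℂ (EuclideanSpace ℂ (ι → Fin (2 * s + 1))) :=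
  siteSpin s (p 0) + siteSpin s (p 1) + siteSpin s (p 2)

theorem tripleSpin_apply (p : Fin 3 → ι) (a : Fin 3) :
    tripleSpin s p a = ∑ c, siteSpin s (p c) a := by
  rw [Fin.sum_univ_three]; rfl

theorem commute_siteSpin_tripleSpin {i : ι} {p : Fin 3 → ι} (h : ∀ c, i ≠ p c) (a b : Fin 3) :
    Commute (siteSpin s i a) (tripleSpin s p b) := by
  rw [tripleSpin_apply]
  exact Commute.sum_right _ _ _ fun c _ => commute_siteSpin (h c) a b

theorem commute_tripleSpin {p q : Fin 3 → ι} (h : ∀ c d, p c ≠ q d) (a b : Fin 3) :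
    Commute (tripleSpin s p a) (tripleSpin s q b) := by
  rw [tripleSpin_apply]
  exact Commute.sum_left _ _ _ fun c _ => commute_siteSpin_tripleSpin (h c) a b

theorem commute_siteSpin_add {p : Fin 3 → ι} (hp : Function.Injective p) (a b : Fin 3) :
    Commute ((siteSpin s (p 0) + siteSpin s (p 1)) a) (siteSpin s (p 2) b) :=
  (commute_siteSpin (hp.ne (by decide)) a b).add_left (commute_siteSpin (hp.ne (by decide)) a b)

theorem isSpin_tripleSpin {p : Fin 3 → ι} (hp : Function.Injective p) :
    IsSpin (tripleSpin s p) :=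
  ((isSpin_siteSpin _).add (isSpin_siteSpin _) (commute_siteSpin (hp.ne (by decide)))).add
    (isSpin_siteSpin _) (commute_siteSpin_add hp)

theorem scalarProd_add_left {V : Type*} [NormedAddCommGroup V] [InnerProductSpace ℂ V]
    (X Y Z : Fin 3 → Module.End ℂ V) :
    scalarProd (X + Y) Z = scalarProd X Z + scalarProd Y Z := by
  simp only [scalarProd, Pi.add_apply, add_mul]; abel

theorem scalarProd_add_right {V : Type*} [NormedAddCommGroup V] [InnerProductSpace ℂ V]
    (X Y Z : Fin 3 → Module.End ℂ V) :
    scalarProd X (Y + Z) = scalarProd X Y + scalarProd X Z := by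
  simp only [scalarProd, Pi.add_apply, mul_add]; abel

/-- The energy of a uniform triangle in terms of its total spin. -/
theorem toOp_triangle {p : Fin 3 → ι} (hp : Function.Injective p) :
    toOp (bond s (p 0) (p 1) + bond s (p 0) (p 2) + bond s (p 1) (p 2)) =
      (1 / 2 : ℂ) • casimir (tripleSpin s p) - ((3 / 2 * (s * (s + 1)) : ℝ) : ℂ) • 1 := by
  simp only [map_add, toOp_bond]
  rw [tripleSpin, casimir_add (commute_siteSpin_add hp),
    casimir_add (commute_siteSpin (hp.ne (by decide))), casimir_siteSpin, casimir_siteSpin,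
    casimir_siteSpin, scalarProd_add_left]
  push_cast
  module

theorem toOp_sum_bond (i : ι) (q : Fin 3 → ι) :
    toOp (∑ d, bond s i (q d)) = scalarProd (siteSpin s i) (tripleSpin s q) := by
  rw [Fin.sum_univ_three]
  simp only [map_add, toOp_bond, tripleSpin, scalarProd_add_right]

theorem isPair_tripleSpin {p q : Fin 3 → ι} (hp : Function.Injective p)
    (hq : Function.Injective q) (hpq : ∀ c d, p c ≠ q d) (c : Fin 3) :
    IsPair s (tripleSpin s p) (siteSpin s (p c)) (tripleSpin s q) where
  spinA := isSpin_tripleSpin hp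
  spinx := isSpin_siteSpin _
  spinS := isSpin_tripleSpin hq
  length := casimir_siteSpin _
  commxS := commute_siteSpin_tripleSpin (hpq c)
  commAS := commute_tripleSpin hpq
  commL a b := by
    rw [tripleSpin_apply, ← Finset.sum_erase_eq_sub (Finset.mem_univ c)]
    exact Commute.sum_left _ _ _ fun d hd =>
      commute_siteSpin (hp.ne (Finset.ne_of_mem_erase hd)) a b

end Sites


/-! ### Singlets of a single triangle -/

section Singlet

variable {s : ℕ}

theorem raising_coeff_ne_zero {j : Fin (2 * s + 1)} (hj : (j : ℕ) < 2 * s) :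
    ((Real.sqrt ((s : ℝ) * (s + 1) - magnetic s j * (magnetic s j + 1)) : ℝ) : ℂ) ≠ 0 := by
  have h1 : (j : ℝ) + 1 ≤ 2 * s := by exact_mod_cast hj
  have h2 : (0 : ℝ) ≤ j := Nat.cast_nonneg _
  have : 0 < (s : ℝ) * (s + 1) - magnetic s j * (magnetic s j + 1) := by
    unfold magnetic
    nlinarith
  exact_mod_cast (Real.sqrt_pos.2 this).ne'

theorem sum_spinPlus_mul {i j : Fin (2 * s + 1)} (h : (i : ℕ) = j + 1) (g : Fin (2 * s + 1) → ℂ) :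
    ∑ k, spinPlus s i k * g k =
      ((Real.sqrt ((s : ℝ) * (s + 1) - magnetic s j * (magnetic s j + 1)) : ℝ) : ℂ) * g j := by
  rw [Finset.sum_eq_single j]
  · rw [spinPlus_apply, if_pos h]
  · intro k _ hk
    rw [spinPlus_apply, if_neg (fun h' => hk (Fin.ext (by omega))), zero_mul]
  · simp

theorem sum_conjTranspose_mul {i j : Fin (2 * s + 1)} (h : (j : ℕ) = i + 1)
    (g : Fin (2 * s + 1) → ℂ) :
    ∑ k, (spinPlus s)ᴴ i k * g k =
      ((Real.sqrt ((s : ℝ) * (s + 1) - magnetic s i * (magnetic s i + 1)) : ℝ) : ℂ) * g j := by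
  rw [Finset.sum_eq_single j]
  · rw [Matrix.conjTranspose_apply, spinPlus_apply, if_pos h, Complex.star_def,
      Complex.conj_ofReal]
  · intro k _ hk
    rw [Matrix.conjTranspose_apply, spinPlus_apply, if_neg (fun h' => hk (Fin.ext (by omega))),
      star_zero, zero_mul]
  · simp

theorem sum_conjTranspose_top {i : Fin (2 * s + 1)} (h : (i : ℕ) = 2 * s)
    (g : Fin (2 * s + 1) → ℂ) : ∑ k, (spinPlus s)ᴴ i k * g k = 0 := by
  refine Finset.sum_eq_zero fun k _ => ?_
  have := k.2
  rw [Matrix.conjTranspose_apply, spinPlus_apply, if_neg (by omega), star_zero, zero_mul]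

theorem spinPlus_eq : spinPlus s = spinVec s 0 + Complex.I • spinVec s 1 := by
  rw [spinVec_zero, spinVec_one, smul_smul]
  have : Complex.I * -(Complex.I / 2) = 1 / 2 := by
    linear_combination (-1 / 2 : ℂ) * Complex.I_mul_I
  rw [this]
  module

theorem conjTranspose_spinPlus_eq : (spinPlus s)ᴴ = spinVec s 0 - Complex.I • spinVec s 1 := by
  rw [spinVec_zero, spinVec_one, smul_smul]
  have : Complex.I * -(Complex.I / 2) = 1 / 2 := by
    linear_combination (-1 / 2 : ℂ) * Complex.I_mul_I
  rw [this]
  module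

theorem update_vec3 (a b c k : Fin (2 * s + 1)) :
    Function.update ![a, b, c] 0 k = ![k, b, c] ∧ Function.update ![a, b, c] 1 k = ![a, k, c] ∧
      Function.update ![a, b, c] 2 k = ![a, b, k] := by
  refine ⟨?_, ?_, ?_⟩ <;> ext i <;> fin_cases i <;> simp

variable {ψ : StateVec s (Fin 3)}

theorem singlet_raising (h : ∀ a, totalSpin s (Fin 3) a *ᵥ ψ = 0) (a b c : Fin (2 * s + 1)) :
    ∑ k, spinPlus s a k * ψ ![k, b, c] + ∑ k, spinPlus s b k * ψ ![a, k, c]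
      + ∑ k, spinPlus s c k * ψ ![a, b, k] = 0 := by
  have h1 : (∑ i : Fin 3, siteOp i (spinPlus s)) *ᵥ ψ = 0 := by
    simp only [spinPlus_eq, siteOp_add, siteOp_smul, Finset.sum_add_distrib, ← Finset.smul_sum]
    rw [Matrix.add_mulVec, Matrix.smul_mulVec]
    have h0 := h 0
    have h1 := h 1
    unfold totalSpin at h0 h1
    rw [h0, h1]
    simp
  have h2 := congrFun h1 ![a, b, c]
  rw [Fin.sum_univ_three, Matrix.add_mulVec, Matrix.add_mulVec] at h2
  simpa only [Pi.add_apply, siteOp_mulVec, update_vec3, Matrix.cons_val, Pi.zero_apply] using h2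

theorem singlet_lowering (h : ∀ a, totalSpin s (Fin 3) a *ᵥ ψ = 0) (a b c : Fin (2 * s + 1)) :
    ∑ k, (spinPlus s)ᴴ a k * ψ ![k, b, c] + ∑ k, (spinPlus s)ᴴ b k * ψ ![a, k, c]
      + ∑ k, (spinPlus s)ᴴ c k * ψ ![a, b, k] = 0 := by
  have h1 : (∑ i : Fin 3, siteOp i (spinPlus s)ᴴ) *ᵥ ψ = 0 := by
    simp only [conjTranspose_spinPlus_eq, siteOp_sub, siteOp_smul, Finset.sum_sub_distrib,
      ← Finset.smul_sum]
    rw [Matrix.sub_mulVec, Matrix.smul_mulVec]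
    have h0 := h 0
    have h1 := h 1
    unfold totalSpin at h0 h1
    rw [h0, h1]
    simp
  have h2 := congrFun h1 ![a, b, c]
  rw [Fin.sum_univ_three, Matrix.add_mulVec, Matrix.add_mulVec] at h2
  simpa only [Pi.add_apply, siteOp_mulVec, update_vec3, Matrix.cons_val, Pi.zero_apply] using h2

theorem singlet_weight (h : ∀ a, totalSpin s (Fin 3) a *ᵥ ψ = 0) {a b c : Fin (2 * s + 1)}
    (hw : (a : ℕ) + b + c ≠ 3 * s) : ψ ![a, b, c] = 0 := by
  have h2 := congrFun (h 2) ![a, b, c]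
  unfold totalSpin at h2
  rw [Fin.sum_univ_three, Matrix.add_mulVec, Matrix.add_mulVec] at h2
  simp only [Pi.add_apply, spinVec_two, siteOp_diagonal, Matrix.mulVec_diagonal, Matrix.cons_val,
    Pi.zero_apply, ← add_mul] at h2
  refine (mul_eq_zero.1 h2).resolve_left fun h3 => hw ?_
  have h4 : magnetic s a + magnetic s b + magnetic s c = 0 := by exact_mod_cast h3
  unfold magnetic at h4
  have h5 : (a : ℝ) + b + c = 3 * s := by linarith
  exact_mod_cast h5

/-- The configuration with the magnetic quantum numbers `s, -s, 0`. -/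
def referenceConfig (s : ℕ) : Fin 3 → Fin (2 * s + 1) :=
  ![⟨2 * s, by omega⟩, ⟨0, by omega⟩, ⟨s, by omega⟩]

/-- A singlet is determined by a single component. -/
theorem singlet_eq_zero (h : ∀ a, totalSpin s (Fin 3) a *ᵥ ψ = 0)
    (h0 : ψ (referenceConfig s) = 0) : ψ = 0 := by
  -- With the first spin at its maximum, its lowering term is absent, so the lowering relation
  -- determines the components recursively in the second spin.
  have step1 : ∀ (n : ℕ) (b c : Fin (2 * s + 1)), (b : ℕ) = n →
      ψ ![⟨2 * s, by omega⟩, b, c] = 0 := by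
    intro n
    induction n with
    | zero =>
      intro b c hb
      by_cases hc : (c : ℕ) = s
      · have e : (![⟨2 * s, by omega⟩, b, c] : Fin 3 → Fin (2 * s + 1)) = referenceConfig s := by
          unfold referenceConfig
          congr 1
          congr 1
          · exact Fin.ext hb
          · congr 1
            exact Fin.ext hc
        rw [e, h0]
      · exact singlet_weight h (by simp only; omega)
    | succ n ih =>
      intro b c hb
      by_cases hc : 2 * s + (b : ℕ) + c = 3 * s
      · have hb' := b.2
        have hlow := singlet_lowering h ⟨2 * s, by omega⟩ ⟨n, by omega⟩ c
        have hc1 : (c : ℕ) + 1 < 2 * s + 1 := by omega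
        rw [sum_conjTranspose_top rfl, sum_conjTranspose_mul (j := b) (by simpa using hb),
          sum_conjTranspose_mul (j := ⟨c + 1, hc1⟩) rfl, ih ⟨n, by omega⟩ ⟨c + 1, hc1⟩ rfl, mul_zero,
          add_zero, zero_add] at hlow
        exact (mul_eq_zero.1 hlow).resolve_left (raising_coeff_ne_zero (by simp only; omega))
      · exact singlet_weight h hc
  -- The raising relation then expresses the components with first entry `a` by those with first
  -- entry `a + 1`.
  have step2 : ∀ (n : ℕ) (a b c : Fin (2 * s + 1)), (a : ℕ) + n = 2 * s →
      ψ ![a, b, c] = 0 := by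
    intro n
    induction n with
    | zero =>
      intro a b c ha
      have : a = ⟨2 * s, by omega⟩ := Fin.ext (by simpa using ha)
      rw [this]
      exact step1 _ b c rfl
    | succ n ih =>
      intro a b c ha
      have ha1 : (a : ℕ) + 1 < 2 * s + 1 := by omega
      have hr := singlet_raising h ⟨a + 1, ha1⟩ b c
      rw [sum_spinPlus_mul (j := a) rfl,
        Finset.sum_eq_zero fun k _ => by rw [ih _ _ _ (by simp only; omega), mul_zero],
        Finset.sum_eq_zero fun k _ => by rw [ih _ _ _ (by simp only; omega), mul_zero],
        add_zero, add_zero] at hr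
      exact (mul_eq_zero.1 hr).resolve_left (raising_coeff_ne_zero (by omega))
  ext σ
  have e : σ = ![σ 0, σ 1, σ 2] := by ext i; fin_cases i <;> rfl
  rw [e]
  have := (σ 0).2
  exact step2 (2 * s - σ 0) _ _ _ (by omega)

theorem IsTrimerSinglet.reference_ne_zero {φ : StateVec s (Fin 3)} (hφ : IsTrimerSinglet s φ) :
    φ (referenceConfig s) ≠ 0 := fun h => hφ.1 (singlet_eq_zero hφ.2 h)

theorem IsTrimerSinglet.eq_smul {φ : StateVec s (Fin 3)} (hφ : IsTrimerSinglet s φ)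
    (h : ∀ a, totalSpin s (Fin 3) a *ᵥ ψ = 0) :
    ψ = (ψ (referenceConfig s) / φ (referenceConfig s)) • φ := by
  have h0 := hφ.reference_ne_zero
  have := singlet_eq_zero (ψ := ψ - (ψ (referenceConfig s) / φ (referenceConfig s)) • φ)
    (fun a => by rw [Matrix.mulVec_sub, Matrix.mulVec_smul, h a, hφ.2 a]; simp)
    (by simp [h0])
  exact sub_eq_zero.1 this

/-- The raising operator maps total weight `0` to total weight `1`. The smaller dimension of the
target gives a kernel vector, a highest-weight vector of weight zero, hence a singlet. -/
theorem card_weight_lt (s : ℕ) :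
    Fintype.card {σ : Fin 3 → Fin (2 * s + 1) // (σ 0 : ℕ) + σ 1 + σ 2 = 3 * s + 1} <
      Fintype.card {σ : Fin 3 → Fin (2 * s + 1) // (σ 0 : ℕ) + σ 1 + σ 2 = 3 * s} := by
  have hext : ∀ σ τ : Fin 3 → Fin (2 * s + 1), (σ 0 : ℕ) = τ 0 → (σ 1 : ℕ) = τ 1 →
      (σ 2 : ℕ) = τ 2 → σ = τ := fun σ τ h0 h1 h2 => by
    ext i; fin_cases i <;> assumption
  -- Lower the first entry by one. If it is zero, wrap it to `2s`, a value the other branch never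
  -- takes, and lower the other two entries by `s + 1` and `s`. The configuration `(2s, s, 0)` is
  -- missed.
  let F : {σ : Fin 3 → Fin (2 * s + 1) // (σ 0 : ℕ) + σ 1 + σ 2 = 3 * s + 1} →
      {σ : Fin 3 → Fin (2 * s + 1) // (σ 0 : ℕ) + σ 1 + σ 2 = 3 * s} := fun σ =>
    if h : (σ.1 0 : ℕ) = 0 then
      ⟨![⟨2 * s, by omega⟩, ⟨σ.1 1 - (s + 1), by omega⟩, ⟨σ.1 2 - s, by omega⟩], by
        have := σ.2
        have := (σ.1 1).2
        have := (σ.1 2).2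
        simp only [Matrix.cons_val]
        omega⟩
    else
      ⟨![⟨σ.1 0 - 1, by omega⟩, σ.1 1, σ.1 2], by
        have := σ.2
        simp only [Matrix.cons_val]
        omega⟩
  have hF0 : ∀ σ, (σ.1 0 : ℕ) = 0 → ((F σ).1 0 : ℕ) = 2 * s ∧
      ((F σ).1 1 : ℕ) = σ.1 1 - (s + 1) ∧ ((F σ).1 2 : ℕ) = σ.1 2 - s := fun σ h => by
    simp only [F, dif_pos h]
    exact ⟨rfl, rfl, rfl⟩
  have hF1 : ∀ σ, (σ.1 0 : ℕ) ≠ 0 → ((F σ).1 0 : ℕ) = σ.1 0 - 1 ∧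
      ((F σ).1 1 : ℕ) = σ.1 1 ∧ ((F σ).1 2 : ℕ) = σ.1 2 := fun σ h => by
    simp only [F, dif_neg h]
    exact ⟨rfl, rfl, rfl⟩
  refine Fintype.card_lt_of_injective_of_notMem F (b := ⟨![⟨2 * s, by omega⟩, ⟨s, by omega⟩,
    ⟨0, by omega⟩], by simp only [Matrix.cons_val]; omega⟩) ?_ ?_
  · intro σ τ hστ
    have s0 := (σ.1 0).2
    have s1 := (σ.1 1).2
    have s2 := (σ.1 2).2
    have t0 := (τ.1 0).2
    have t1 := (τ.1 1).2
    have t2 := (τ.1 2).2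
    have hs := σ.2
    have ht := τ.2
    have e0 : ((F σ).1 0 : ℕ) = (F τ).1 0 := by rw [hστ]
    have e1 : ((F σ).1 1 : ℕ) = (F τ).1 1 := by rw [hστ]
    have e2 : ((F σ).1 2 : ℕ) = (F τ).1 2 := by rw [hστ]
    apply Subtype.ext
    by_cases h1 : (σ.1 0 : ℕ) = 0 <;> by_cases h2 : (τ.1 0 : ℕ) = 0
    · obtain ⟨a0, a1, a2⟩ := hF0 σ h1
      obtain ⟨b0, b1, b2⟩ := hF0 τ h2
      exact hext _ _ (by omega) (by omega) (by omega)
    · obtain ⟨a0, a1, a2⟩ := hF0 σ h1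
      obtain ⟨b0, b1, b2⟩ := hF1 τ h2
      omega
    · obtain ⟨a0, a1, a2⟩ := hF1 σ h1
      obtain ⟨b0, b1, b2⟩ := hF0 τ h2
      omega
    · obtain ⟨a0, a1, a2⟩ := hF1 σ h1
      obtain ⟨b0, b1, b2⟩ := hF1 τ h2
      exact hext _ _ (by omega) (by omega) (by omega)
  · rintro ⟨σ, hσ⟩
    have s0 := (σ.1 0).2
    have s1 := (σ.1 1).2
    have s2 := (σ.1 2).2
    have hs := σ.2
    have e0 : ((F σ).1 0 : ℕ) = 2 * s := by rw [hσ]; rfl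
    have e1 : ((F σ).1 1 : ℕ) = s := by rw [hσ]; rfl
    have e2 : ((F σ).1 2 : ℕ) = 0 := by rw [hσ]; rfl
    by_cases h1 : (σ.1 0 : ℕ) = 0
    · obtain ⟨a0, a1, a2⟩ := hF0 σ h1
      omega
    · obtain ⟨a0, a1, a2⟩ := hF1 σ h1
      omega

theorem toOp_totalSpin (a : Fin 3) : toOp (totalSpin s (Fin 3) a) = tripleSpin s id a := by
  rw [tripleSpin_apply, totalSpin, map_sum]
  rfl

variable (s) in
/-- Three spins of integer length have a singlet state. -/
theorem exists_isTrimerSinglet : ∃ φ : StateVec s (Fin 3), IsTrimerSinglet s φ := by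
  classical
  set W₀ := {σ : Fin 3 → Fin (2 * s + 1) // (σ 0 : ℕ) + σ 1 + σ 2 = 3 * s}
  set W₁ := {σ : Fin 3 → Fin (2 * s + 1) // (σ 0 : ℕ) + σ 1 + σ 2 = 3 * s + 1}
  let E : (W₀ → ℂ) →ₗ[ℂ] StateVec s (Fin 3) :=
    { toFun := fun g σ => if h : (σ 0 : ℕ) + σ 1 + σ 2 = 3 * s then g ⟨σ, h⟩ else 0
      map_add' := fun g g' => by ext σ; simp only [Pi.add_apply]; split_ifs <;> simp
      map_smul' := fun c g => by ext σ; simp only [Pi.smul_apply]; split_ifs <;> simp }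
  let R : (W₀ → ℂ) →ₗ[ℂ] (W₁ → ℂ) :=
    (LinearMap.funLeft ℂ ℂ (Subtype.val : W₁ → _)) ∘ₗ
      (Matrix.mulVecLin (∑ i : Fin 3, siteOp i (spinPlus s))) ∘ₗ E
  obtain ⟨g, hg, hg0⟩ := (Submodule.ne_bot_iff _).1 (LinearMap.ker_ne_bot_of_finrank_lt (f := R) (by
    rw [Module.finrank_fintype_fun_eq_card, Module.finrank_fintype_fun_eq_card]
    exact card_weight_lt s))
  have hE : ∀ σ : Fin 3 → Fin (2 * s + 1), (σ 0 : ℕ) + σ 1 + σ 2 ≠ 3 * s → E g σ = 0 :=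
    fun σ h => dif_neg h
  have hE0 : E g ≠ 0 := by
    intro h
    apply hg0
    ext σ
    have := congrFun h σ.1
    rwa [show E g σ.1 = g σ from dif_pos σ.2] at this
  have hraise : (∑ i : Fin 3, siteOp i (spinPlus s)) *ᵥ E g = 0 := by
    ext σ
    by_cases h : (σ 0 : ℕ) + σ 1 + σ 2 = 3 * s + 1
    · exact congrFun (LinearMap.mem_ker.1 hg) ⟨σ, h⟩
    · rw [Matrix.sum_mulVec, Finset.sum_apply]
      refine Finset.sum_eq_zero fun i _ => ?_
      rw [siteOp_mulVec]
      refine Finset.sum_eq_zero fun k _ => ?_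
      rw [spinPlus_apply]
      split_ifs with hk
      · rw [hE, mul_zero]
        intro h'
        apply h
        fin_cases i <;> simp at h' hk <;> omega
      · rw [zero_mul]
  refine ⟨E g, hE0, fun a => ?_⟩
  set v : EuclideanSpace ℂ (Fin 3 → Fin (2 * s + 1)) := WithLp.toLp 2 (E g) with hv
  have hX := isSpin_tripleSpin (s := s) (p := (id : Fin 3 → Fin 3)) Function.injective_id
  have h2 : tripleSpin s (id : Fin 3 → Fin 3) 2 v = ((0 : ℝ) : ℂ) • v := by
    rw [← toOp_totalSpin, toOp_apply]
    ext σ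
    simp only [totalSpin, spinVec_two, siteOp_diagonal, Fin.sum_univ_three, Matrix.add_mulVec,
      Pi.add_apply, Matrix.mulVec_diagonal, hv, ← add_mul, Complex.ofReal_zero, zero_smul,
      PiLp.zero_apply]
    by_cases h : (σ 0 : ℕ) + σ 1 + σ 2 = 3 * s
    · have : magnetic s (σ 0) + magnetic s (σ 1) + magnetic s (σ 2) = 0 := by
        have h' : (σ 0 : ℝ) + σ 1 + σ 2 = 3 * s := by exact_mod_cast h
        unfold magnetic
        linarith
      rw [← Complex.ofReal_add, ← Complex.ofReal_add, this]
      simp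
    · rw [hE σ h, mul_zero]
  have h3 : tripleSpin s (id : Fin 3 → Fin 3) 0 v
      + Complex.I • tripleSpin s (id : Fin 3 → Fin 3) 1 v = 0 := by
    rw [← toOp_totalSpin, ← toOp_totalSpin, ← LinearMap.smul_apply, ← LinearMap.add_apply,
      ← map_smul, ← map_add, toOp_apply]
    have e : totalSpin s (Fin 3) 0 + Complex.I • totalSpin s (Fin 3) 1 =
        ∑ i : Fin 3, siteOp i (spinPlus s) := by
      simp only [totalSpin, spinPlus_eq, siteOp_add, siteOp_smul, Finset.sum_add_distrib,
        ← Finset.smul_sum]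
    rw [e, hv, hraise]
    rfl
  have h4 := hX.casimir_of_raising_eq_zero h2 h3
  rw [zero_mul, Complex.ofReal_zero, zero_smul] at h4
  have h5 := (casimir_apply_eq_zero_iff hX.symm).1 h4 a
  rw [← toOp_totalSpin, toOp_apply] at h5
  exact congrArg WithLp.ofLp h5

end Singlet

/-! ### Product states -/

section Product

variable {s : ℕ} {T : Type}

/-- The configuration `σ`, changed to `τ` in the triangle `t`. -/
def overwrite [DecidableEq T] (t : T) (σ : T × Fin 3 → Fin (2 * s + 1)) (τ : Fin 3 → Fin (2 * s + 1)) :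
    T × Fin 3 → Fin (2 * s + 1) := fun i => if i.1 = t then τ i.2 else σ i

theorem overwrite_update [DecidableEq T] (t : T) (σ : T × Fin 3 → Fin (2 * s + 1))
    (τ : Fin 3 → Fin (2 * s + 1)) (c : Fin 3) (k : Fin (2 * s + 1)) :
    overwrite t σ (Function.update τ c k) = Function.update (overwrite t σ τ) (t, c) k := by
  ext ⟨t', c'⟩
  by_cases ht : t' = t <;> by_cases hc : c' = c <;>
    simp [overwrite, ht, hc]

theorem overwrite_self [DecidableEq T] (t : T) (σ : T × Fin 3 → Fin (2 * s + 1)) :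
    overwrite t σ (fun c => σ (t, c)) = σ := by
  ext ⟨t', c'⟩
  by_cases ht : t' = t
  · subst ht; simp [overwrite]
  · simp [overwrite, ht]

theorem productState_ne_zero [Fintype T] {φ : StateVec s (Fin 3)} (hφ : IsTrimerSinglet s φ) :
    (productState φ : StateVec s (T × Fin 3)) ≠ 0 := fun h => by
  have h1 := congrFun h fun i => referenceConfig s i.2
  exact Finset.prod_ne_zero_iff.2 (fun t _ => hφ.reference_ne_zero) h1

variable [Fintype T] [DecidableEq T]

variable (s) in
/-- The total spin of the triangle `t`. -/
noncomputable def triangleSpin (t : T) :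
    Fin 3 → Module.End ℂ (EuclideanSpace ℂ (T × Fin 3 → Fin (2 * s + 1))) :=
  tripleSpin s fun c => (t, c)

theorem triangleSpin_apply (t : T) (a : Fin 3)
    (ψ : EuclideanSpace ℂ (T × Fin 3 → Fin (2 * s + 1))) (σ : T × Fin 3 → Fin (2 * s + 1))
    (τ : Fin 3 → Fin (2 * s + 1)) :
    (triangleSpin s t a ψ).ofLp (overwrite t σ τ) =
      (totalSpin s (Fin 3) a *ᵥ fun τ => ψ.ofLp (overwrite t σ τ)) τ := by
  rw [triangleSpin, tripleSpin_apply]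
  simp only [LinearMap.sum_apply, siteSpin, toOp_apply, totalSpin, Matrix.sum_mulVec,
    WithLp.ofLp_sum, Finset.sum_apply, siteOp_mulVec, overwrite_update]
  simp [overwrite]

variable {φ : StateVec s (Fin 3)}

theorem triangleSpin_productState (hφ : IsTrimerSinglet s φ) (t : T) (a : Fin 3) :
    triangleSpin s t a (WithLp.toLp 2 (productState φ)) = 0 := by
  ext σ
  rw [← overwrite_self t σ, triangleSpin_apply]
  have e : (fun τ => productState φ (overwrite t σ τ)) =
      (∏ t' ∈ Finset.univ.erase t, φ fun c => σ (t', c)) • φ := by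
    ext τ
    rw [productState, ← Finset.mul_prod_erase _ _ (Finset.mem_univ t), Pi.smul_apply, smul_eq_mul,
      mul_comm]
    congr 1
    · refine Finset.prod_congr rfl fun t' ht' => ?_
      simp [overwrite, Finset.ne_of_mem_erase ht']
    · simp [overwrite]
  show (totalSpin s (Fin 3) a *ᵥ fun τ => productState φ (overwrite t σ τ)) _ = 0
  rw [e, Matrix.mulVec_smul, hφ.2]
  simp

/-- A state in which all triangles are singlets is the product state. -/
theorem eq_smul_productState (hφ : IsTrimerSinglet s φ)
    {ψ : EuclideanSpace ℂ (T × Fin 3 → Fin (2 * s + 1))}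
    (h : ∀ t a, triangleSpin s t a ψ = 0) : ∃ c : ℂ, ψ.ofLp = c • productState φ := by
  have h0 := hφ.reference_ne_zero
  have hslice : ∀ t σ, ψ.ofLp σ = ψ.ofLp (overwrite t σ (referenceConfig s)) *
      ((φ fun c => σ (t, c)) / φ (referenceConfig s)) := fun t σ => by
    have := congrFun (hφ.eq_smul (ψ := fun τ => ψ.ofLp (overwrite t σ τ)) (fun a => by
      ext τ
      rw [← triangleSpin_apply, h]
      rfl)) fun c => σ (t, c)
    simp only [overwrite_self, Pi.smul_apply, smul_eq_mul] at this
    rw [this]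
    ring
  -- Triangle by triangle, the dependence on `σ` factors out relative to the reference
  -- configuration, because each slice is a multiple of `φ`.
  have hind : ∀ (B : Finset T) (σ : T × Fin 3 → Fin (2 * s + 1)),
      ψ.ofLp σ = ψ.ofLp (fun i => if i.1 ∈ B then referenceConfig s i.2 else σ i) *
        ∏ t ∈ B, ((φ fun c => σ (t, c)) / φ (referenceConfig s)) := by
    intro B
    induction B using Finset.induction_on with
    | empty => intro σ; simp
    | insert t B ht ih =>
      intro σ
      rw [Finset.prod_insert ht, ih, hslice t]
      have e : overwrite t (fun i => if i.1 ∈ B then referenceConfig s i.2 else σ i)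
          (referenceConfig s) =
          fun i => if i.1 ∈ insert t B then referenceConfig s i.2 else σ i := by
        ext i
        by_cases hi : i.1 = t <;> simp [overwrite, hi]
      rw [e]
      simp only [ht, if_false]
      ring
  refine ⟨ψ.ofLp (fun i => referenceConfig s i.2) *
    ∏ _t : T, (φ (referenceConfig s))⁻¹, ?_⟩
  ext σ
  rw [hind Finset.univ σ]
  simp only [Finset.mem_univ, if_true, Pi.smul_apply, smul_eq_mul, productState, div_eq_mul_inv,
    Finset.prod_mul_distrib]
  ring

end Product


/-! ### Energies, ground states and gaps -/

section Spectrum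

theorem IsGap.pos {n : Type} [Fintype n] {A : Matrix n n ℂ} {g : ℝ} (hg : IsGap A g) : 0 < g := by
  obtain ⟨E, E₁, -, hE₁, rfl⟩ := hg
  exact sub_pos.2 hE₁.1.2

variable {n : Type} [Fintype n] [DecidableEq n] {A : Matrix n n ℂ} {Φ : n → ℂ} {E₀ δ : ℝ}

theorem mem_energies_iff {E : ℝ} :
    E ∈ energies A ↔ ∃ v : EuclideanSpace ℂ n, v ≠ 0 ∧ toOp A v = (E : ℂ) • v := by
  constructor
  · rintro ⟨ψ, h0, h⟩
    refine ⟨WithLp.toLp 2 ψ, fun h' => h0 (congrArg WithLp.ofLp h'), ?_⟩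
    rw [toOp_apply, h]
    rfl
  · rintro ⟨v, h0, h⟩
    refine ⟨v.ofLp, fun h' => h0 (WithLp.ofLp_injective 2 h'), ?_⟩
    rw [toOp_apply] at h
    exact congrArg WithLp.ofLp h

theorem toOp_toLp_eq {E : ℝ} (h : A *ᵥ Φ = (E : ℂ) • Φ) :
    toOp A (WithLp.toLp 2 Φ) = (E : ℂ) • WithLp.toLp 2 Φ := by
  rw [toOp_apply, h]
  rfl

theorem finite_energies (A : Matrix n n ℂ) : (energies A).Finite := by
  refine Set.Finite.of_finite_image (f := fun E : ℝ => (E : ℂ)) ?_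
    Complex.ofReal_injective.injOn
  refine (Module.End.finite_hasEigenvalue (toOp A)).subset ?_
  rintro _ ⟨E, hE, rfl⟩
  obtain ⟨v, h0, h⟩ := mem_energies_iff.1 hE
  exact Module.End.hasEigenvalue_of_hasEigenvector ⟨Module.End.mem_eigenspace_iff.2 h, h0⟩

theorem le_of_eigenvector {V : Type*} [NormedAddCommGroup V] [InnerProductSpace ℂ V]
    {X : Module.End ℂ V} {E₀ E : ℝ} {v : V} (h0 : v ≠ 0) (h : X v = (E : ℂ) • v)
    (hle : E₀ * ‖v‖ ^ 2 ≤ (⟪v, X v⟫_ℂ).re) : E₀ ≤ E := by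
  rw [h, re_inner_smul_self] at hle
  exact le_of_mul_le_mul_right hle (by have := norm_pos_iff.2 h0; positivity)

/-- An eigenvector is a ground state if and only if its energy bounds all expectation values. -/
theorem isGroundState_iff (hA : (toOp A).IsSymmetric) (h0 : Φ ≠ 0)
    (hΦ : A *ᵥ Φ = (E₀ : ℂ) • Φ) :
    IsGroundState A Φ ↔
      ∀ v : EuclideanSpace ℂ n, E₀ * ‖v‖ ^ 2 ≤ (⟪v, toOp A v⟫_ℂ).re := by
  constructor
  · rintro ⟨-, E, hE, hEΦ⟩ v
    have hEE : E = E₀ := by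
      rw [hΦ] at hEΦ
      exact_mod_cast (smul_left_injective ℂ h0 hEΦ).symm
    subst hEE
    refine le_re_inner_of_eigen hA ⊤ (fun _ _ => Submodule.mem_top) (fun μ ψ _ hψ hμ => ?_)
      Submodule.mem_top
    exact hE.2 (mem_energies_iff.2 ⟨ψ, hψ, hμ⟩)
  · intro h
    refine ⟨h0, E₀, ⟨⟨Φ, h0, hΦ⟩, fun E hE => ?_⟩, hΦ⟩
    obtain ⟨v, hv0, hv⟩ := mem_energies_iff.1 hE
    exact le_of_eigenvector hv0 hv (h v)

theorem mem_orthogonal_of_ne (hA : (toOp A).IsSymmetric) (hΦ : A *ᵥ Φ = (E₀ : ℂ) • Φ) {E : ℝ}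
    {v : EuclideanSpace ℂ n} (hv : toOp A v = (E : ℂ) • v) (hE : E ≠ E₀) :
    v ∈ (ℂ ∙ (WithLp.toLp 2 Φ : EuclideanSpace ℂ n))ᗮ := by
  rw [Submodule.mem_orthogonal_singleton_iff_inner_right]
  have h := hA (WithLp.toLp 2 Φ) v
  rw [hv, toOp_toLp_eq hΦ, inner_smul_left, inner_smul_right, Complex.conj_ofReal] at h
  have h1 : ((E₀ : ℂ) - E) * ⟪(WithLp.toLp 2 Φ : EuclideanSpace ℂ n), v⟫_ℂ = 0 := by
    rw [sub_mul, h, sub_self]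
  refine (mul_eq_zero.1 h1).resolve_left (sub_ne_zero.2 fun h2 => hE ?_)
  exact_mod_cast h2.symm

/-- The energies other than `E₀` are at least `E₀ + δ` if this holds for the expectation values
in the orthogonal complement of the state `Φ` of energy `E₀`. -/
theorem add_le_energy (hA : (toOp A).IsSymmetric) (hΦ : A *ᵥ Φ = (E₀ : ℂ) • Φ)
    (h : ∀ v ∈ (ℂ ∙ (WithLp.toLp 2 Φ : EuclideanSpace ℂ n))ᗮ,
      (E₀ + δ) * ‖v‖ ^ 2 ≤ (⟪v, toOp A v⟫_ℂ).re)
    {E : ℝ} (hE : E ∈ energies A) (hne : E ≠ E₀) : E₀ + δ ≤ E := by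
  obtain ⟨v, hv0, hv⟩ := mem_energies_iff.1 hE
  exact le_of_eigenvector hv0 hv (h v (mem_orthogonal_of_ne hA hΦ hv hne))

theorem isLeast_energies (hA : (toOp A).IsSymmetric) (h0 : Φ ≠ 0) (hΦ : A *ᵥ Φ = (E₀ : ℂ) • Φ)
    (hδ : 0 < δ) (h : ∀ v ∈ (ℂ ∙ (WithLp.toLp 2 Φ : EuclideanSpace ℂ n))ᗮ,
      (E₀ + δ) * ‖v‖ ^ 2 ≤ (⟪v, toOp A v⟫_ℂ).re) : IsLeast (energies A) E₀ := by
  refine ⟨⟨Φ, h0, hΦ⟩, fun E hE => ?_⟩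
  by_cases hne : E = E₀
  · exact hne.ge
  · have := add_le_energy hA hΦ h hE hne
    linarith

theorem isUniqueGroundState_of_le (hA : (toOp A).IsSymmetric) (h0 : Φ ≠ 0)
    (hΦ : A *ᵥ Φ = (E₀ : ℂ) • Φ) (hδ : 0 < δ)
    (h : ∀ v ∈ (ℂ ∙ (WithLp.toLp 2 Φ : EuclideanSpace ℂ n))ᗮ,
      (E₀ + δ) * ‖v‖ ^ 2 ≤ (⟪v, toOp A v⟫_ℂ).re) : IsUniqueGroundState A Φ := by
  have hl := isLeast_energies hA h0 hΦ hδ h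
  refine ⟨⟨h0, E₀, hl, hΦ⟩, ?_⟩
  rintro χ ⟨-, E, hE, hχ⟩
  rw [hE.unique hl] at hχ
  set K := ℂ ∙ (WithLp.toLp 2 Φ : EuclideanSpace ℂ n)
  set v : EuclideanSpace ℂ n := WithLp.toLp 2 χ
  obtain ⟨c, hc⟩ := Submodule.mem_span_singleton.1 (K.starProjection_apply_mem v)
  have hw := K.sub_starProjection_mem_orthogonal v
  have hw' : toOp A (v - K.starProjection v) = (E₀ : ℂ) • (v - K.starProjection v) := by
    rw [← hc, map_sub, map_smul, toOp_toLp_eq hΦ, toOp_toLp_eq hχ]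
    module
  have h1 := h _ hw
  rw [hw', re_inner_smul_self] at h1
  have h2 : ‖v - K.starProjection v‖ = 0 := by
    by_contra hne
    have : 0 < ‖v - K.starProjection v‖ ^ 2 := by positivity
    nlinarith
  refine ⟨c, ?_⟩
  rw [norm_eq_zero, sub_eq_zero, ← hc] at h2
  exact congrArg WithLp.ofLp h2

theorem isGap_of_le (hA : (toOp A).IsSymmetric) (h0 : Φ ≠ 0) (hΦ : A *ᵥ Φ = (E₀ : ℂ) • Φ)
    (hδ : 0 < δ) (h : ∀ v ∈ (ℂ ∙ (WithLp.toLp 2 Φ : EuclideanSpace ℂ n))ᗮ,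
      (E₀ + δ) * ‖v‖ ^ 2 ≤ (⟪v, toOp A v⟫_ℂ).re) (hE : E₀ + δ ∈ energies A) : IsGap A δ :=
  ⟨E₀, E₀ + δ, isLeast_energies hA h0 hΦ hδ h,
    ⟨⟨hE, by linarith⟩, fun _ hE' => add_le_energy hA hΦ h hE'.1 hE'.2.ne'⟩, by ring⟩

theorem IsGap.le (hA : (toOp A).IsSymmetric) (h0 : Φ ≠ 0) (hΦ : A *ᵥ Φ = (E₀ : ℂ) • Φ)
    (hδ : 0 < δ) (h : ∀ v ∈ (ℂ ∙ (WithLp.toLp 2 Φ : EuclideanSpace ℂ n))ᗮ,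
      (E₀ + δ) * ‖v‖ ^ 2 ≤ (⟪v, toOp A v⟫_ℂ).re) {g : ℝ} (hg : IsGap A g) : δ ≤ g := by
  obtain ⟨E, E₁, hE, hE₁, rfl⟩ := hg
  obtain rfl := hE.unique (isLeast_energies hA h0 hΦ hδ h)
  have := add_le_energy hA hΦ h hE₁.1.1 hE₁.1.2.ne'
  linarith

/-- A Hermitian matrix whose expectation values are not all equal has a gap. -/
theorem exists_isGap (hA : (toOp A).IsSymmetric)
    (h : ¬∃ E : ℝ, ∀ v : EuclideanSpace ℂ n, (⟪v, toOp A v⟫_ℂ).re = E * ‖v‖ ^ 2) :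
    ∃ g, IsGap A g := by
  have hne : (energies A).Nonempty := by
    by_contra hempty
    refine h ⟨0, fun v => ?_⟩
    by_cases hv : v = 0
    · simp [hv]
    · obtain ⟨μ, χ, -, h0, hχ⟩ := exists_eigenvector hA ⊤ (fun _ _ => Submodule.mem_top)
        Submodule.mem_top hv
      exact absurd ⟨μ, mem_energies_iff.2 ⟨χ, h0, hχ⟩⟩ hempty
  obtain ⟨E, hE, hmin⟩ := Set.exists_min_image _ id (finite_energies A) hne
  have hl : IsLeast (energies A) E := ⟨hE, hmin⟩
  have hne' : {E' | E' ∈ energies A ∧ E < E'}.Nonempty := by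
    by_contra hempty
    refine h ⟨E, fun v => ?_⟩
    have hall : ∀ (μ : ℝ) (ψ : EuclideanSpace ℂ n), ψ ∈ (⊤ : Submodule ℂ (EuclideanSpace ℂ n)) →
        ψ ≠ 0 → toOp A ψ = (μ : ℂ) • ψ → μ = E := fun μ ψ _ h0 hψ => by
      have hμ := mem_energies_iff.2 ⟨ψ, h0, hψ⟩
      by_contra hne
      exact hempty ⟨μ, hμ, lt_of_le_of_ne (hl.2 hμ) (Ne.symm hne)⟩
    have h1 := le_re_inner_of_eigen hA ⊤ (fun _ _ => Submodule.mem_top)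
      (fun μ ψ hψ h0 hμ => (hall μ ψ hψ h0 hμ).ge) (Submodule.mem_top (x := v))
    have h2 := le_re_inner_of_eigen (X := -toOp A) (m := -E)
      (fun x y => by
        rw [LinearMap.neg_apply, LinearMap.neg_apply, inner_neg_left, inner_neg_right, hA])
      ⊤ (fun _ _ => Submodule.mem_top)
      (fun μ ψ hψ h0 hμ => by
        have : toOp A ψ = ((-μ : ℝ) : ℂ) • ψ := by
          rw [Complex.ofReal_neg, neg_smul, ← hμ, LinearMap.neg_apply, neg_neg]
        have := hall _ ψ hψ h0 this
        linarith) (Submodule.mem_top (x := v))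
    rw [LinearMap.neg_apply, inner_neg_right, Complex.neg_re] at h2
    linarith
  obtain ⟨E₁, hE₁, hmin₁⟩ := Set.exists_min_image _ id
    ((finite_energies A).subset fun _ h => h.1) hne'
  exact ⟨E₁ - E, E, E₁, hl, ⟨hE₁, hmin₁⟩, rfl⟩

end Spectrum

/-! ### Regions of nonnegativity and perturbations -/

/-- The set of parameters for which a family of affine functions is nonnegative is a compact
interval if there are functions in the family of positive and of negative slope. -/
theorem exists_eq_Icc {X : Type*} (p q : X → ℝ) (hne : ∃ J : ℝ, ∀ v, 0 ≤ p v + J * q v)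
    {v w : X} (hv : 0 < q v) (hw : q w < 0) :
    ∃ a b : ℝ, {J : ℝ | ∀ v, 0 ≤ p v + J * q v} = Set.Icc a b := by
  set R := {J : ℝ | ∀ v, 0 ≤ p v + J * q v} with hR
  have hclosed : IsClosed R := by
    rw [hR, Set.ofPred_forall]
    exact isClosed_iInter fun v => isClosed_le continuous_const (by fun_prop)
  have hsub : R ⊆ Set.Icc (-p v / q v) (p w / -q w) := fun J hJ => by
    constructor
    · rw [div_le_iff₀ hv]
      linarith [hJ v]
    · rw [le_div_iff₀ (by linarith)]
      linarith [hJ w]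
  have hconv : Convex ℝ R := by
    intro a ha b hb α β hα hβ hαβ v
    have h1 := mul_nonneg hα (ha v)
    have h2 := mul_nonneg hβ (hb v)
    have : p v = α * p v + β * p v := by rw [← add_mul, hαβ, one_mul]
    simp only [smul_eq_mul]
    nlinarith
  exact ⟨sInf R, sSup R, eq_Icc_of_connected_compact ⟨hne, hconv.isPreconnected⟩
    (isCompact_Icc.of_isClosed_subset hclosed hsub)⟩

section Perturbation

variable {V : Type*} [NormedAddCommGroup V] [InnerProductSpace ℂ V] [FiniteDimensional ℂ V]

/-- A strictly positive symmetric operator on an invariant subspace is bounded below. -/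
theorem exists_pos_le_re_inner {X : Module.End ℂ V} (hX : X.IsSymmetric) (W : Submodule ℂ V)
    (hW : ∀ v ∈ W, X v ∈ W) (hpos : ∀ v ∈ W, v ≠ 0 → 0 < (⟪v, X v⟫_ℂ).re) :
    ∃ δ > 0, ∀ v ∈ W, δ * ‖v‖ ^ 2 ≤ (⟪v, X v⟫_ℂ).re := by
  obtain ⟨n, b, e, he⟩ := exists_eigenbasis hX W hW
  have hpe : ∀ i, 0 < e i := fun i => by
    have hn : ‖(b i : V)‖ = 1 := b.orthonormal.norm_eq_one i
    have := hpos (b i) (b i).2 (by rw [← norm_ne_zero_iff, hn]; exact one_ne_zero)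
    rw [he, re_inner_smul_self, hn] at this
    simpa using this
  obtain ⟨δ, hδ, hle⟩ : ∃ δ > 0, ∀ i, δ ≤ e i := by
    rcases isEmpty_or_nonempty (Fin n) with hn | hn
    · exact ⟨1, one_pos, fun i => hn.elim i⟩
    · obtain ⟨i, hi⟩ := Finite.exists_min e
      exact ⟨e i, hpe i, hi⟩
  refine ⟨δ, hδ, fun v hv => ?_⟩
  obtain ⟨h1, h2⟩ := re_inner_eq_sum_of_eigenbasis b he hv
  rw [h1, h2, Finset.mul_sum]
  exact Finset.sum_le_sum fun i _ => mul_le_mul_of_nonneg_right (hle i) (sq_nonneg _)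

/-- A positive semidefinite symmetric operator stays so under small perturbations that vanish on its
kernel. -/
theorem exists_pos_perturbation {X Y : Module.End ℂ V} (hX : X.IsSymmetric) (hY : Y.IsSymmetric)
    (hpos : ∀ v, 0 ≤ (⟪v, X v⟫_ℂ).re) (hker : ∀ v, X v = 0 → Y v = 0) :
    ∃ ε > 0, ∀ t : ℝ, |t| ≤ ε → ∀ v, 0 ≤ (⟪v, X v⟫_ℂ).re + t * (⟪v, Y v⟫_ℂ).re := by
  set K := LinearMap.ker X with hK
  obtain ⟨δ, hδ, hle⟩ := exists_pos_le_re_inner hX Kᗮ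
    (fun v hv => apply_mem_orthogonal hX (fun w hw => by
      rw [hK, LinearMap.mem_ker] at hw ⊢
      rw [hw, map_zero]) hv) (fun v hv h0 => by
      refine lt_of_le_of_ne (hpos v) fun h => h0 ?_
      have : v ∈ K := apply_eq_zero_of_re_inner_eq_zero hX hpos h.symm
      exact inner_self_eq_zero.1 (Submodule.inner_right_of_mem_orthogonal this hv))
  set C := ‖LinearMap.toContinuousLinearMap Y‖
  -- Both forms depend only on the component orthogonal to the kernel of `X`, where `X ≥ δ` and `Y`
  -- is bounded by `C`. The summand `1` avoids division by zero.
  refine ⟨δ / (C + 1), by positivity, fun t ht v => ?_⟩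
  have hred : ∀ Z : Module.End ℂ V, Z.IsSymmetric → Z (K.starProjection v) = 0 →
      (⟪v, Z v⟫_ℂ).re = (⟪v - K.starProjection v, Z (v - K.starProjection v)⟫_ℂ).re :=
    fun Z hZ h => by
      rw [map_sub, h, sub_zero, inner_sub_left, ← hZ (K.starProjection v), h, inner_zero_left,
        sub_zero]
  have hKv : X (K.starProjection v) = 0 := K.starProjection_apply_mem v
  rw [hred X hX hKv, hred Y hY (hker _ hKv)]
  have hw := K.sub_starProjection_mem_orthogonal v
  set w := v - K.starProjection v
  have h1 := hle w hw
  have h2 : |(⟪w, Y w⟫_ℂ).re| ≤ C * ‖w‖ ^ 2 := by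
    calc |(⟪w, Y w⟫_ℂ).re| ≤ ‖⟪w, Y w⟫_ℂ‖ := Complex.abs_re_le_norm _
      _ ≤ ‖w‖ * ‖Y w‖ := norm_inner_le_norm _ _
      _ ≤ ‖w‖ * (C * ‖w‖) := by gcongr; exact (LinearMap.toContinuousLinearMap Y).le_opNorm w
      _ = C * ‖w‖ ^ 2 := by ring
  have h3 : |t * (⟪w, Y w⟫_ℂ).re| ≤ δ / (C + 1) * (C * ‖w‖ ^ 2) := by
    rw [abs_mul]
    exact mul_le_mul ht h2 (abs_nonneg _) (by positivity)
  have h4 : δ / (C + 1) * (C * ‖w‖ ^ 2) ≤ δ * ‖w‖ ^ 2 := by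
    rw [div_mul_eq_mul_div, div_le_iff₀ (by positivity)]
    have : 0 ≤ δ * ‖w‖ ^ 2 := by positivity
    nlinarith
  have := neg_abs_le (t * (⟪w, Y w⟫_ℂ).re)
  linarith

end Perturbation


/-! ### The lowest root of the cubic -/

theorem two_le_mul_add_one {s : ℕ} (hs : 1 ≤ s) : (2 : ℝ) ≤ s * (s + 1) := by
  have : (1 : ℝ) ≤ s := by exact_mod_cast hs
  nlinarith

/-- The lowest root of the cubic is positive exactly between two endpoints. -/
theorem exists_endpoints {s : ℕ} (hs : 1 ≤ s) :
    ∃ z₁ t₁ z₂ t₂ : ℝ, z₁ < 0 ∧ 0 < z₂ ∧ IsEndpoint s z₁ t₁ ∧ IsEndpoint s z₂ t₂ ∧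
      ∀ J f : ℝ, IsLeast {x : ℝ | gapCubic (s * (s + 1)) J x = 0} f →
        (0 < f ↔ z₁ < J ∧ J < z₂) := by
  have hr := two_le_mul_add_one hs
  obtain ⟨z₁, h₁, hz₁⟩ := exists_neg_zero hr
  obtain ⟨z₂, h₂, h₂', hz₂⟩ := exists_pos_zero hr
  refine ⟨z₁, -z₁ * s, z₂, z₂ * (s + 1), h₁, h₂,
    ⟨hz₁, by linarith, Or.inr ⟨h₁, rfl⟩, Or.inr (neg_zero_bounds hs hz₁ h₁)⟩,
    ⟨hz₂, h₂', Or.inl ⟨h₂, rfl⟩, pos_zero_bounds hs hz₂ h₂ h₂'⟩, fun J f hf => ?_⟩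
  have hroot : ∀ x ≤ 0, gapCubic (s * (s + 1)) J x ≤ 0 → f ≤ 0 := fun x hx h => by
    obtain ⟨y, hy, hy0⟩ := exists_root_gapCubic_le h
    have := hf.2 hy0
    linarith
  have hpos : ∀ z u : ℝ, gapCubic (s * (s + 1)) z 0 = 0 → z ≤ 1 → 0 ≤ u → u < 1 → u * z = J →
      0 < f := fun z u hz hz1 hu hu1 hJ => by
    have h0 := gapCubic_zero_mul_pos hr hz hz1 hu hu1
    by_contra hneg
    push Not at hneg
    have h3 := gapCubic_zero_add_le (J := u * z) (by nlinarith) h0.le hneg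
    have h4 : gapCubic (s * (s + 1)) (u * z) f = 0 := by rw [hJ]; exact hf.1
    have : 0 ≤ (-f) ^ 3 := pow_nonneg (by linarith) 3
    linarith
  constructor
  · intro h
    constructor
    · by_contra hJ
      push Not at hJ
      exact absurd (hroot 0 le_rfl (exists_gapCubic_nonpos_of_neg hr hz₁ h₁ hJ)) (by linarith)
    · by_contra hJ
      push Not at hJ
      obtain ⟨x, hx, hx'⟩ := exists_gapCubic_nonpos_of_pos hr hz₂ h₂ hJ
      exact absurd (hroot x hx hx') (by linarith)
  · rintro ⟨hJ₁, hJ₂⟩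
    rcases le_or_gt 0 J with hJ | hJ
    · exact hpos z₂ (J / z₂) hz₂ h₂' (by positivity) ((div_lt_one h₂).2 hJ₂)
        (div_mul_cancel₀ _ h₂.ne')
    · exact hpos z₁ (J / z₁) hz₁ (by linarith) (div_nonneg_of_nonpos hJ.le h₁.le)
        ((div_lt_one_of_neg h₁).2 hJ₁) (div_mul_cancel₀ _ h₁.ne)

/-! ### The excited state of a pair -/

section Pair

variable {V : Type*} [NormedAddCommGroup V] [InnerProductSpace ℂ V]
  {s : ℕ} {A x S : Fin 3 → Module.End ℂ V}

/-- A vector operator maps singlets to triplets. -/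
theorem IsPair.casimirA_x_apply (h : IsPair s A x S) {v : V} (hv : ∀ a, A a v = 0) (a : Fin 3) :
    casimir A (x a v) = (2 : ℂ) • x a v := by
  have h1 : ∀ a b, A a (x b v) = (x a * x b - x b * x a) v := fun a b => by
    have := LinearMap.congr_fun (h.comm_A_x a b) v
    simpa [hv] using this
  have h01 : A 0 (x 1 v) = Complex.I • x 2 v := by rw [h1, h.spinx.comm01]; rfl
  have h12 : A 1 (x 2 v) = Complex.I • x 0 v := by rw [h1, h.spinx.comm12]; rfl
  have h20 : A 2 (x 0 v) = Complex.I • x 1 v := by rw [h1, h.spinx.comm20]; rfl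
  have h10 : A 1 (x 0 v) = -(Complex.I • x 2 v) := by
    rw [h1, ← neg_sub, h.spinx.comm01]; rfl
  have h21 : A 2 (x 1 v) = -(Complex.I • x 0 v) := by
    rw [h1, ← neg_sub, h.spinx.comm12]; rfl
  have h02 : A 0 (x 2 v) = -(Complex.I • x 1 v) := by
    rw [h1, ← neg_sub, h.spinx.comm20]; rfl
  have h00 : ∀ a, A a (x a v) = 0 := fun a => by rw [h1, sub_self]; rfl
  have hI := Complex.I_mul_I
  simp only [casimir, LinearMap.add_apply, Module.End.mul_apply]
  fin_cases a
  · simp only [Fin.zero_eta, h00, h10, h20, map_neg, map_smul, map_zero, h12, h21, smul_neg,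
      smul_smul, hI]
    module
  · simp only [Fin.mk_one, h00, h01, h21, map_neg, map_smul, map_zero, h02, h20, smul_neg,
      smul_smul, hI]
    module
  · simp only [Fin.reduceFinMk, h00, h02, h12, map_neg, map_smul, map_zero, h01, h10, smul_neg,
      smul_smul, hI]
    module

theorem IsPair.exists_x_apply_ne_zero (h : IsPair s A x S) (hs : 1 ≤ s) {v : V} (hv : v ≠ 0) :
    ∃ a, x a v ≠ 0 := by
  by_contra hx
  push Not at hx
  have h1 := (casimir_apply_eq_zero_iff h.spinx.symm).2 hx
  rw [h.length, LinearMap.smul_apply, Module.End.one_apply, smul_eq_zero] at h1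
  rcases h1 with h1 | h1
  · have := two_le_mul_add_one hs
    have : (s * (s + 1) : ℝ) = 0 := by exact_mod_cast h1
    linarith
  · exact hv h1

variable [FiniteDimensional ℂ V]

/-- The states `w, T w, T² w` with `T = x ⬝ S` span an invariant space of the pair energy. -/
theorem IsPair.exists_eigenvector_of_root (h : IsPair s A x S) (hs : 1 ≤ s) {J μ : ℝ}
    (hμ : gapCubic (s * (s + 1)) J μ = 0) (hJ : J = 0 → μ = 1) {w : V} (hw : w ≠ 0)
    (hA : ∀ a, A a w = 0) (hS : casimir S w = (2 : ℂ) • w) :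
    ∃ ψ : V, ψ ≠ 0 ∧ pairEnergy A x S J ψ = (μ : ℂ) • ψ := by
  have hr := two_le_mul_add_one hs
  obtain ⟨e0, e1, e2⟩ := h.energy_levels J hA hS
  have a1 := h.casimirA_scalarProd hA
  have a2 := h.casimirA_scalarProd_scalarProd hA hS
  have a0 : casimir A w = 0 := (casimir_apply_eq_zero_iff h.spinA.symm).2 hA
  have hcub := h.scalarProd_cubic hS
  set u := scalarProd x S w with hu
  set v := scalarProd x S u with hv
  set r : ℝ := s * (s + 1) with hrdef
  -- The coefficients are again cofactors of the three-level system. At `J = 0` only `w` remains,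
  -- with factor `(2 - μ)(4 - μ)`, which would vanish for the other two roots; hence the hypothesis
  -- `hJ`.
  refine ⟨(((2 - μ) * (4 - 2 * J - μ) - J * (1 + J * (r - 1)) : ℝ) : ℂ) • w
    + ((-(4 - 2 * J - μ) * J : ℝ) : ℂ) • u + ((J ^ 2 : ℝ) : ℂ) • v, fun h0 => ?_, ?_⟩
  · by_cases hJ0 : J = 0
    · rw [hJ hJ0, hJ0] at h0
      norm_num at h0
      exact hw h0
    -- Applying `A² (A² - 2)` isolates the spin-two part of `T² w`, with `T = x·S`. If it vanishes,
    -- the cubic relation for `T` forces `T w = 0` and then `w = 0`.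
    · have h1 := congrArg (fun z => casimir A (casimir A z) - (2 : ℂ) • casimir A z) h0
      simp only [map_add, map_smul, map_sub, a0, a1, a2, map_zero, smul_zero, sub_zero] at h1
      have h2 : ((24 * J ^ 2 : ℝ) : ℂ) • (v + (1 / 2 : ℂ) • u - ((2 * r / 3 : ℝ) : ℂ) • w) = 0 := by
        rw [← h1]
        push_cast
        module
      have h3 := (smul_eq_zero.1 h2).resolve_left (by
        have : 24 * J ^ 2 ≠ 0 := by positivity
        exact_mod_cast this)
      have h4 := congrArg (scalarProd x S) h3
      simp only [map_add, map_smul, map_sub, map_zero, ← hu, ← hv, hcub] at h4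
      have h5 : ((r / 3 - 1 / 4 : ℝ) : ℂ) • u = 0 := by
        push_cast at h3 h4 ⊢
        linear_combination (norm := module) h4 + (3 / 2 : ℂ) • h3
      have h6 : u = 0 := (smul_eq_zero.1 h5).resolve_left (by
        have : r / 3 - 1 / 4 ≠ 0 := by linarith
        exact_mod_cast this)
      have h7 : v = 0 := by rw [hv, h6, map_zero]
      rw [h6, h7, smul_zero, add_zero, zero_sub, neg_eq_zero] at h3
      have h8 := (smul_eq_zero.1 h3).resolve_right hw
      have : 2 * r / 3 = 0 := by exact_mod_cast h8
      linarith
  · simp only [map_add, map_smul, e0, e1, e2]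
    unfold gapCubic at hμ
    have hμ' := congrArg (fun y : ℝ => (y : ℂ)) hμ
    push_cast at hμ' ⊢
    linear_combination (norm := module) hμ' • w

end Pair

/-! ### Systems of triangles -/

section Triangles

variable {s : ℕ} {T : Type} [Fintype T] [DecidableEq T]

theorem isSpin_triangleSpin (t : T) : IsSpin (triangleSpin s t) :=
  isSpin_tripleSpin fun _ _ h => (Prod.mk.inj h).2

theorem commute_triangleSpin {t t' : T} (h : t ≠ t') (a b : Fin 3) :
    Commute (triangleSpin s t a) (triangleSpin s t' b) :=
  commute_tripleSpin (fun _ _ h' => h (Prod.mk.inj h').1) a b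

theorem isPair_triangleSpin {t t' : T} (h : t ≠ t') (c : Fin 3) :
    IsPair s (triangleSpin s t) (siteSpin s (t, c)) (triangleSpin s t') :=
  isPair_tripleSpin (fun _ _ h => (Prod.mk.inj h).2) (fun _ _ h => (Prod.mk.inj h).2)
    (fun _ _ h' => h (Prod.mk.inj h').1) c

theorem toOp_triangle_eq (t : T) :
    toOp (triangle s t) = (1 / 2 : ℂ) • casimir (triangleSpin s t)
      - ((3 / 2 * (s * (s + 1)) : ℝ) : ℂ) • 1 :=
  toOp_triangle (p := fun c => (t, c)) fun _ _ h => (Prod.mk.inj h).2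

theorem toOp_threeBonds (t : T) (c : Fin 3) (t' : T) :
    toOp (threeBonds s t c t') = scalarProd (siteSpin s (t, c)) (triangleSpin s t') :=
  toOp_sum_bond (t, c) fun d => (t', d)

variable {φ : StateVec s (Fin 3)}

theorem casimir_triangleSpin_productState (hφ : IsTrimerSinglet s φ) (t : T) :
    casimir (triangleSpin s t) (WithLp.toLp 2 (productState φ)) = 0 :=
  (casimir_apply_eq_zero_iff (isSpin_triangleSpin t).symm).2 (triangleSpin_productState hφ t)

theorem mem_span_productState (hφ : IsTrimerSinglet s φ)
    {ψ : EuclideanSpace ℂ (T × Fin 3 → Fin (2 * s + 1))}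
    (h : ∀ t, casimir (triangleSpin s t) ψ = 0) :
    ψ ∈ ℂ ∙ (WithLp.toLp 2 (productState φ) :
      EuclideanSpace ℂ (T × Fin 3 → Fin (2 * s + 1))) := by
  obtain ⟨c, hc⟩ := eq_smul_productState hφ fun t =>
    (casimir_apply_eq_zero_iff (isSpin_triangleSpin t).symm).1 (h t)
  exact Submodule.mem_span_singleton.2 ⟨c, WithLp.ofLp_injective 2 hc.symm⟩

end Triangles

/-! ### One and two triangles -/

section Small

variable {s : ℕ} {φ : StateVec s (Fin 3)}

theorem isSymmetric_one {V : Type*} [NormedAddCommGroup V] [InnerProductSpace ℂ V] :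
    (1 : Module.End ℂ V).IsSymmetric := fun _ _ => rfl

theorem toOp_trimerHamiltonian : toOp (trimerHamiltonian s) =
    (1 / 2 : ℂ) • casimir (tripleSpin s (id : Fin 3 → Fin 3))
      - ((3 / 2 * (s * (s + 1)) : ℝ) : ℂ) • 1 := by
  rw [trimerHamiltonian]
  exact toOp_triangle (p := (id : Fin 3 → Fin 3)) Function.injective_id

theorem isUniqueGroundState_trimer (hφ : IsTrimerSinglet s φ) :
    IsUniqueGroundState (trimerHamiltonian s) φ := by
  have hX := isSpin_tripleSpin (s := s) (p := (id : Fin 3 → Fin 3)) Function.injective_id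
  set X := tripleSpin s (id : Fin 3 → Fin 3)
  have hsymm : (toOp (trimerHamiltonian s)).IsSymmetric := by
    rw [toOp_trimerHamiltonian]
    have := isSymmetric_ofReal_smul hX.casimir_symm (1 / 2)
    push_cast at this
    exact this.sub (isSymmetric_ofReal_smul isSymmetric_one _)
  have hker : ∀ ψ, casimir X ψ = 0 ↔ ∀ a, totalSpin s (Fin 3) a *ᵥ ψ.ofLp = 0 := fun ψ => by
    rw [casimir_apply_eq_zero_iff hX.symm]
    refine forall_congr' fun a => ?_
    rw [show X a = toOp (totalSpin s (Fin 3) a) from (toOp_totalSpin a).symm, toOp_apply]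
    exact ⟨fun h => congrArg WithLp.ofLp h, fun h => congrArg (WithLp.toLp 2) h⟩
  have hE : trimerHamiltonian s *ᵥ φ = ((-(3 / 2 * (s * (s + 1))) : ℝ) : ℂ) • φ := by
    have h1 : toOp (trimerHamiltonian s) (WithLp.toLp 2 φ) =
        ((-(3 / 2 * (s * (s + 1))) : ℝ) : ℂ) • WithLp.toLp 2 φ := by
      rw [toOp_trimerHamiltonian, LinearMap.sub_apply, LinearMap.smul_apply,
        (hker (WithLp.toLp 2 φ)).2 hφ.2, LinearMap.smul_apply, Module.End.one_apply, smul_zero,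
        zero_sub, Complex.ofReal_neg, neg_smul]
    rw [toOp_apply] at h1
    exact congrArg WithLp.ofLp h1
  refine isUniqueGroundState_of_le hsymm hφ.1 hE one_pos fun v hv => ?_
  have hle : LinearMap.ker (casimir X) ≤
      ℂ ∙ (WithLp.toLp 2 φ : EuclideanSpace ℂ (Fin 3 → Fin (2 * s + 1))) := fun ψ hψ =>
    Submodule.mem_span_singleton.2
      ⟨_, WithLp.ofLp_injective 2 (hφ.eq_smul ((hker ψ).1 hψ)).symm⟩
  have h1 := hX.two_le_re_inner_casimir (Submodule.orthogonal_le hle hv)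
  rw [toOp_trimerHamiltonian, LinearMap.sub_apply, inner_sub_right, Complex.sub_re,
    LinearMap.smul_apply, LinearMap.smul_apply, Module.End.one_apply, re_inner_smul_self]
  have h2 := re_inner_smul_self (1 / 2) v
  have h3 : (⟪v, (1 / 2 : ℂ) • casimir X v⟫_ℂ).re = 1 / 2 * (⟪v, casimir X v⟫_ℂ).re := by
    rw [inner_smul_right, show (1 / 2 : ℂ) = ((1 / 2 : ℝ) : ℂ) by push_cast; rfl,
      Complex.re_ofReal_mul]
  rw [h3]
  linarith

theorem toOp_H6 (J : ℝ) : toOp (H6 s J) =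
    pairEnergy (triangleSpin s (1 : Fin 2)) (siteSpin s (1, 0)) (triangleSpin s 0) J
      - ((3 * (s * (s + 1)) : ℝ) : ℂ) • 1 := by
  rw [H6, map_add, map_add, map_smul, toOp_triangle_eq, toOp_triangle_eq, toOp_threeBonds,
    pairEnergy]
  push_cast
  module

theorem H6_ground_state_and_gap (hs : 1 ≤ s) (hφ : IsTrimerSinglet s φ) {z t u f : ℝ}
    (hz : IsEndpoint s z t) (hu0 : 0 ≤ u) (hu1 : u ≤ 1)
    (hf : IsLeast {x | gapCubic (s * (s + 1)) (u * z) x = 0} f) (hf0 : 0 < f) :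
    IsUniqueGroundState (H6 s (u * z)) (productState φ) ∧ IsGap (H6 s (u * z)) f := by
  have hP := isPair_triangleSpin (s := s) (one_ne_zero : (1 : Fin 2) ≠ 0) 0
  have hsymm : (toOp (H6 s (u * z))).IsSymmetric := by
    rw [toOp_H6]
    exact (hP.symm_energy _).sub (isSymmetric_ofReal_smul isSymmetric_one _)
  have hshift : ∀ (v : EuclideanSpace ℂ (Fin 2 × Fin 3 → Fin (2 * s + 1))) (E : ℝ),
      pairEnergy (triangleSpin s (1 : Fin 2)) (siteSpin s (1, 0)) (triangleSpin s 0) (u * z) v =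
        (E : ℂ) • v → toOp (H6 s (u * z)) v = ((-(3 * (s * (s + 1))) + E : ℝ) : ℂ) • v := by
    intro v E h
    rw [toOp_H6, LinearMap.sub_apply, h, LinearMap.smul_apply, Module.End.one_apply]
    push_cast
    module
  have h0 : (productState φ : StateVec s (Fin 2 × Fin 3)) ≠ 0 := productState_ne_zero hφ
  have hE : H6 s (u * z) *ᵥ productState φ = ((-(3 * (s * (s + 1))) : ℝ) : ℂ) • productState φ := by
    have h1 := hshift (WithLp.toLp 2 (productState φ)) 0 (by
      rw [hP.energy_singlets ⟨casimir_triangleSpin_productState hφ 0,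
        casimir_triangleSpin_productState hφ 1⟩, Complex.ofReal_zero, zero_smul])
    rw [add_zero, toOp_apply] at h1
    exact congrArg WithLp.ofLp h1
  have hle : LinearMap.ker (casimir (triangleSpin s (0 : Fin 2))) ⊓
      LinearMap.ker (casimir (triangleSpin s (1 : Fin 2))) ≤
      ℂ ∙ (WithLp.toLp 2 (productState φ) :
        EuclideanSpace ℂ (Fin 2 × Fin 3 → Fin (2 * s + 1))) := fun ψ hψ =>
    mem_span_productState hφ fun t => by
      fin_cases t
      · exact hψ.1
      · exact hψ.2
  have hb : ∀ v ∈ (ℂ ∙ (WithLp.toLp 2 (productState φ) :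
      EuclideanSpace ℂ (Fin 2 × Fin 3 → Fin (2 * s + 1))))ᗮ,
      (-(3 * (s * (s + 1))) + f) * ‖v‖ ^ 2 ≤ (⟪v, toOp (H6 s (u * z)) v⟫_ℂ).re := fun v hv => by
    have h1 := hP.le_re_inner_energy hs hz hu0 hu1 hf (Submodule.orthogonal_le hle hv)
    rw [toOp_H6, LinearMap.sub_apply, inner_sub_right, Complex.sub_re, LinearMap.smul_apply,
      Module.End.one_apply, re_inner_smul_self]
    linarith
  refine ⟨isUniqueGroundState_of_le hsymm h0 hE hf0 hb, isGap_of_le hsymm h0 hE hf0 hb ?_⟩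
  -- With the roles of the triangles exchanged, a spin of triangle `0` acting on the product state
  -- makes this triangle a triplet while triangle `1` stays a singlet; this is the required `w`.
  have hQ := isPair_triangleSpin (s := s) (zero_ne_one : (0 : Fin 2) ≠ 1) 0
  have hΦ0 : (WithLp.toLp 2 (productState φ) :
      EuclideanSpace ℂ (Fin 2 × Fin 3 → Fin (2 * s + 1))) ≠ 0 := fun h =>
    h0 (congrArg WithLp.ofLp h)
  obtain ⟨a, ha⟩ := hQ.exists_x_apply_ne_zero hs hΦ0
  obtain ⟨ψ, hψ0, hψ⟩ := hP.exists_eigenvector_of_root hs hf.1 (fun hJ => by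
      have h1 := hf.1
      have h2 : gapCubic (s * (s + 1)) (u * z) 1 = 0 := by rw [hJ]; unfold gapCubic; ring
      have h3 := hf.2 h2
      rw [Set.mem_ofPred_eq, hJ] at h1
      unfold gapCubic at h1
      have h4 : (f - 4) * (f - 2) * (f - 1) = 0 := by linarith
      rcases mul_eq_zero.1 h4 with h5 | h5
      · rcases mul_eq_zero.1 h5 with h6 | h6 <;> linarith
      · linarith) ha (fun b => by
      rw [← Module.End.mul_apply, ← (hQ.commxS a b).eq, Module.End.mul_apply,
        triangleSpin_productState hφ, map_zero])
    (hQ.casimirA_x_apply (triangleSpin_productState hφ 0) a)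
  exact mem_energies_iff.2 ⟨ψ, hψ0, hshift ψ f hψ⟩

end Small


/-! ### Networks of triangles -/

/-- If the total spin of a triangle acts on a state as each of two of its three spins, the state
vanishes. -/
theorem IsPair.eq_zero_of_corners {V : Type*} [NormedAddCommGroup V] [InnerProductSpace ℂ V]
    {s : ℕ} {A x y S S' : Fin 3 → Module.End ℂ V} (h : IsPair s A x S) (h' : IsPair s A y S')
    (hs : 1 ≤ s) (hxy : ∀ a b, Commute (x a) (y b)) {ζ : V} (hx : ∀ a, (A a - x a) ζ = 0)
    (hy : ∀ a, (A a - y a) ζ = 0) : ζ = 0 := by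
  have ex : ∀ a, A a ζ = x a ζ := fun a => sub_eq_zero.1 (hx a)
  have ey : ∀ a, A a ζ = y a ζ := fun a => sub_eq_zero.1 (hy a)
  have cx : ∀ a b, A a (A b ζ) = x a (A b ζ) := fun a b => by
    have := LinearMap.congr_fun (h.commL a b).eq ζ
    rw [Module.End.mul_apply, Module.End.mul_apply, hx, map_zero, ← ex] at this
    exact sub_eq_zero.1 this
  have cy : ∀ a b, A a (A b ζ) = y a (A b ζ) := fun a b => by
    have := LinearMap.congr_fun (h'.commL a b).eq ζ
    rw [Module.End.mul_apply, Module.End.mul_apply, hy, map_zero, ← ey] at this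
    exact sub_eq_zero.1 this
  -- On `ζ`, products of components of `A` can be replaced by products of components of `x` and `y`,
  -- which commute. So the commutators of `A`, and with them `A` itself, annihilate `ζ`.
  have comm : ∀ a b, (A a * A b - A b * A a) ζ = 0 := fun a b => by
    rw [LinearMap.sub_apply, Module.End.mul_apply, Module.End.mul_apply, cx, cy b a, ey b, ex a]
    exact sub_eq_zero.2 (LinearMap.congr_fun (hxy a b).eq ζ)
  have hA : ∀ a, A a ζ = 0 := fun a => by
    have h01 := comm 0 1
    have h12 := comm 1 2
    have h20 := comm 2 0
    rw [h.spinA.comm01] at h01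
    rw [h.spinA.comm12] at h12
    rw [h.spinA.comm20] at h20
    fin_cases a
    · exact (smul_eq_zero.1 h12).resolve_left Complex.I_ne_zero
    · exact (smul_eq_zero.1 h20).resolve_left Complex.I_ne_zero
    · exact (smul_eq_zero.1 h01).resolve_left Complex.I_ne_zero
  by_contra h0
  obtain ⟨a, ha⟩ := h.exists_x_apply_ne_zero hs h0
  exact ha (by rw [← ex, hA])

/-- A system of triangles in which the corner `c p` of the triangle `A p` is connected to all corners
of the triangle `S p`, such that each triangle takes part in four such connections. -/
structure IsNetwork {P T : Type} [Fintype P] [DecidableEq T] (A S : P → T) (c : P → Fin 3) :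
    Prop where
  ne : ∀ p, A p ≠ S p
  count : ∀ t, ∑ p, ((if A p = t then 1 else 0) + (if S p = t then 1 else 0)) = 4
  corner_zero : ∀ t, ∃ p, A p = t ∧ c p = 0
  corner_one : ∀ t, ∃ p, A p = t ∧ c p = 1
  target : ∀ t, ∃ p, S p = t

section Network

variable {s : ℕ} {P T : Type} [Fintype P] [Fintype T] [DecidableEq T] {A S : P → T} {c : P → Fin 3}

theorem IsNetwork.sum (h : IsNetwork A S c) {M : Type*} [AddCommMonoid M] (g : T → M) :
    ∑ p, (g (A p) + g (S p)) = 4 • ∑ t, g t := by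
  have e : ∀ p, g (A p) + g (S p) =
      ∑ t, ((if A p = t then 1 else 0) + (if S p = t then 1 else 0)) • g t := fun p => by
    simp [add_smul, Finset.sum_add_distrib]
  simp only [e]
  rw [Finset.sum_comm, Finset.smul_sum]
  exact Finset.sum_congr rfl fun t _ => by rw [← Finset.sum_smul, h.count]

variable (s A S c)

/-- The bonds between the triangles. -/
noncomputable def couplingOp : Module.End ℂ (EuclideanSpace ℂ (T × Fin 3 → Fin (2 * s + 1))) :=
  ∑ p, scalarProd (siteSpin s (A p, c p)) (triangleSpin s (S p))

/-- The energy of the network, relative to that of the product of the singlets. -/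
noncomputable def networkEnergy (J : ℝ) :
    Module.End ℂ (EuclideanSpace ℂ (T × Fin 3 → Fin (2 * s + 1))) :=
  (1 / 2 : ℂ) • ∑ t, casimir (triangleSpin s t) + (J : ℂ) • couplingOp s A S c

variable {s A S c}

theorem re_inner_networkEnergy_add (J t : ℝ)
    (v : EuclideanSpace ℂ (T × Fin 3 → Fin (2 * s + 1))) :
    (⟪v, networkEnergy s A S c (J + t) v⟫_ℂ).re =
      (⟪v, networkEnergy s A S c J v⟫_ℂ).re + t * (⟪v, couplingOp s A S c v⟫_ℂ).re := by
  simp only [networkEnergy, LinearMap.add_apply, LinearMap.smul_apply, inner_add_right,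
    inner_smul_right _ _ (_ : ℂ), Complex.add_re, Complex.re_ofReal_mul]
  ring

theorem IsNetwork.symm_couplingOp (h : IsNetwork A S c) : (couplingOp s A S c).IsSymmetric :=
  LinearMap.isSymmetric_sum _ fun p _ => (isPair_triangleSpin (h.ne p) (c p)).symm_scalarProd

theorem IsNetwork.symm_networkEnergy (h : IsNetwork A S c) (J : ℝ) :
    (networkEnergy s A S c J).IsSymmetric := by
  have h1 : (∑ t : T, casimir (triangleSpin s t)).IsSymmetric :=
    LinearMap.isSymmetric_sum _ fun t _ => (isSpin_triangleSpin t).casimir_symm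
  have h2 := isSymmetric_ofReal_smul h1 (1 / 2)
  push_cast at h2
  exact h2.add (isSymmetric_ofReal_smul h.symm_couplingOp J)

/-- The energy of each triangle is shared among its four connections, whereas each connecting
coupling belongs to only one; this turns `J` into `4J`. -/
theorem IsNetwork.sum_pairEnergy (h : IsNetwork A S c) (J : ℝ) :
    ∑ p, pairEnergy (triangleSpin s (A p)) (siteSpin s (A p, c p)) (triangleSpin s (S p)) (4 * J) =
      (4 : ℂ) • networkEnergy s A S c J := by
  have h1 := h.sum fun t => (1 / 2 : ℂ) • casimir (triangleSpin s t)
  have h2 : ∀ p, pairEnergy (triangleSpin s (A p)) (siteSpin s (A p, c p)) (triangleSpin s (S p))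
      (4 * J) = ((1 / 2 : ℂ) • casimir (triangleSpin s (A p))
        + (1 / 2 : ℂ) • casimir (triangleSpin s (S p)))
        + ((4 * J : ℝ) : ℂ) • scalarProd (siteSpin s (A p, c p)) (triangleSpin s (S p)) :=
    fun p => by
      rw [pairEnergy]
      abel
  simp only [h2]
  rw [Finset.sum_add_distrib, h1, ← Finset.smul_sum, ← Finset.smul_sum, networkEnergy, couplingOp]
  push_cast
  module

theorem IsNetwork.re_inner_networkEnergy (h : IsNetwork A S c) (J : ℝ)
    (v : EuclideanSpace ℂ (T × Fin 3 → Fin (2 * s + 1))) :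
    4 * (⟪v, networkEnergy s A S c J v⟫_ℂ).re =
      ∑ p, (⟪v, pairEnergy (triangleSpin s (A p)) (siteSpin s (A p, c p)) (triangleSpin s (S p))
        (4 * J) v⟫_ℂ).re := by
  rw [← Complex.re_sum, ← inner_sum, ← LinearMap.sum_apply, h.sum_pairEnergy,
    LinearMap.smul_apply, inner_smul_right, show (4 : ℂ) = ((4 : ℝ) : ℂ) by push_cast; rfl,
    Complex.re_ofReal_mul]

variable (s A S) in
/-- The states in which both triangles of the connection `p` are singlets. -/
noncomputable def singletPair (p : P) :
    Submodule ℂ (EuclideanSpace ℂ (T × Fin 3 → Fin (2 * s + 1))) :=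
  LinearMap.ker (casimir (triangleSpin s (S p))) ⊓ LinearMap.ker (casimir (triangleSpin s (A p)))

theorem commute_casimir_triangleSpin (t t' : T) :
    Commute (casimir (triangleSpin s t)) (casimir (triangleSpin s t')) := by
  by_cases h : t = t'
  · rw [h]
  · exact commute_casimir_of_commute fun a =>
      (commute_casimir_of_commute fun b => (commute_triangleSpin h a b).symm).symm

theorem casimir_apply_mem_ker_inf_ker (t₁ t₂ t : T) :
    ∀ v ∈ LinearMap.ker (casimir (triangleSpin s t₁)) ⊓ LinearMap.ker (casimir (triangleSpin s t₂)),
      casimir (triangleSpin s t) v ∈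
        LinearMap.ker (casimir (triangleSpin s t₁)) ⊓ LinearMap.ker (casimir (triangleSpin s t₂)) := by
  rintro v ⟨hS, hA⟩
  have key : ∀ t', casimir (triangleSpin s t') v = 0 →
      casimir (triangleSpin s t') (casimir (triangleSpin s t) v) = 0 := fun t' h' => by
    rw [← Module.End.mul_apply, (commute_casimir_triangleSpin t' t).eq, Module.End.mul_apply, h',
      map_zero]
  exact ⟨key _ hS, key _ hA⟩

theorem mem_orthogonal_ker_of_range {V : Type*} [NormedAddCommGroup V] [InnerProductSpace ℂ V]
    {X : Module.End ℂ V} (hX : X.IsSymmetric) (v : V) : X v ∈ (LinearMap.ker X)ᗮ := by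
  rw [Submodule.mem_orthogonal]
  intro u hu
  rw [← hX, LinearMap.mem_ker.1 hu, inner_zero_left]

variable {φ : StateVec s (Fin 3)}

/-- Each excited triangle excites four connections. -/
theorem IsNetwork.four_mul_le_sum (h : IsNetwork A S c) (hφ : IsTrimerSinglet s φ)
    {v : EuclideanSpace ℂ (T × Fin 3 → Fin (2 * s + 1))}
    (hv : v ∈ (ℂ ∙ (WithLp.toLp 2 (productState φ) :
      EuclideanSpace ℂ (T × Fin 3 → Fin (2 * s + 1))))ᗮ) :
    4 * ‖v‖ ^ 2 ≤ ∑ p, (‖v‖ ^ 2 - ‖(singletPair s A S p).starProjection v‖ ^ 2) := by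
  set K := singletPair s A S
  set Φ : EuclideanSpace ℂ (T × Fin 3 → Fin (2 * s + 1)) := WithLp.toLp 2 (productState φ)
  set X : Module.End ℂ (EuclideanSpace ℂ (T × Fin 3 → Fin (2 * s + 1))) :=
    ∑ p, (1 - ((K p).starProjection : Module.End ℂ _)) with hXdef
  have hX : X.IsSymmetric := LinearMap.isSymmetric_sum _ fun p _ =>
    isSymmetric_one.sub (starProjection_symm _)
  have hXv : ∀ v, X v = ∑ p, (v - (K p).starProjection v) := fun v => by
    rw [hXdef, LinearMap.sum_apply]
    rfl
  have hre : ∀ v, (⟪v, X v⟫_ℂ).re = ∑ p, (‖v‖ ^ 2 - ‖(K p).starProjection v‖ ^ 2) := fun v => by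
    rw [hXv, inner_sum, Complex.re_sum]
    refine Finset.sum_congr rfl fun p _ => ?_
    rw [inner_sub_right, re_inner_starProjection, Complex.sub_re, Complex.ofReal_re,
      inner_self_eq_norm_sq_to_K]
    norm_cast
  have hcomm : ∀ t v, X (casimir (triangleSpin s t) v) = casimir (triangleSpin s t) (X v) :=
    fun t v => by
      rw [hXv, hXv, map_sum]
      refine Finset.sum_congr rfl fun p _ => ?_
      rw [starProjection_apply_comm (W := K p) (isSpin_triangleSpin t).casimir_symm
        (casimir_apply_mem_ker_inf_ker _ _ t), map_sub]
  have hΦK : ∀ p, Φ ∈ K p := fun p =>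
    ⟨casimir_triangleSpin_productState hφ _, casimir_triangleSpin_productState hφ _⟩
  have hXΦ : X Φ = 0 := by
    rw [hXv]
    exact Finset.sum_eq_zero fun p _ => by
      rw [Submodule.starProjection_eq_self_iff.2 (hΦK p), sub_self]
  rw [← hre]
  refine le_re_inner_of_eigen hX _ (fun w hw => apply_mem_orthogonal hX (fun w hw => ?_) hw)
    (fun μ ψ hψ hψ0 hμ => ?_) hv
  · obtain ⟨a, rfl⟩ := Submodule.mem_span_singleton.1 hw
    rw [map_smul, hXΦ, smul_zero]
    exact Submodule.zero_mem _
  -- The square of the spin of `t` commutes with `X`, so it maps `ψ` to an eigenvector with the same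
  -- eigenvalue in which `t` is certainly excited; its four connections then contribute the full
  -- norm.
  obtain ⟨t, ht⟩ : ∃ t, casimir (triangleSpin s t) ψ ≠ 0 := by
    by_contra hall
    push Not at hall
    exact hψ0 (inner_self_eq_zero.1 (Submodule.inner_right_of_mem_orthogonal
      (mem_span_productState hφ hall) hψ))
  set χ := casimir (triangleSpin s t) ψ
  have hχ : X χ = (μ : ℂ) • χ := by rw [hcomm, hμ, map_smul]
  refine le_of_eigenvector ht hχ ?_
  rw [hre]
  have hχker := mem_orthogonal_ker_of_range (isSpin_triangleSpin (s := s) t).casimir_symm ψ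
  have hcount := congrArg (fun m : ℕ => (m : ℝ) * ‖χ‖ ^ 2) (h.count t)
  simp only [Nat.cast_sum, Finset.sum_mul] at hcount
  push_cast at hcount
  rw [← hcount]
  refine Finset.sum_le_sum fun p _ => ?_
  have hproj : A p = t ∨ S p = t → (K p).starProjection χ = 0 := fun hp => by
    rw [Submodule.starProjection_apply_eq_zero_iff]
    refine Submodule.orthogonal_le ?_ hχker
    rcases hp with rfl | rfl
    · exact inf_le_right
    · exact inf_le_left
  have hle : ‖(K p).starProjection χ‖ ^ 2 ≤ ‖χ‖ ^ 2 := by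
    rw [re_inner_sub_starProjection (K p) χ]
    linarith [sq_nonneg ‖χ - (K p).starProjection χ‖]
  by_cases hA : A p = t
  · have hS : S p ≠ t := fun hS => h.ne p (hA.trans hS.symm)
    rw [hproj (Or.inl hA)]
    simp [hA, hS]
  · by_cases hS : S p = t
    · rw [hproj (Or.inr hS)]
      simp [hA, hS]
    · simpa [hA, hS] using hle

theorem couplingOp_productState (hφ : IsTrimerSinglet s φ) :
    couplingOp s A S c (WithLp.toLp 2 (productState φ)) = 0 := by
  rw [couplingOp, LinearMap.sum_apply]
  exact Finset.sum_eq_zero fun p _ => scalarProd_apply_eq_zero (triangleSpin_productState hφ _)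

theorem networkEnergy_productState (hφ : IsTrimerSinglet s φ) (J : ℝ) :
    networkEnergy s A S c J (WithLp.toLp 2 (productState φ)) = 0 := by
  rw [networkEnergy, LinearMap.add_apply, LinearMap.smul_apply, LinearMap.smul_apply,
    couplingOp_productState hφ, LinearMap.sum_apply,
    Finset.sum_eq_zero fun t _ => casimir_triangleSpin_productState hφ t, smul_zero, smul_zero,
    add_zero]

variable {z t : ℝ}

/-- Each pair contributes at least `f` times the squared norm of the component outside its singlet
pair; `four_mul_le_sum` cancels the factor four. -/
theorem IsNetwork.le_re_inner_networkEnergy (h : IsNetwork A S c) (hφ : IsTrimerSinglet s φ)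
    (hs : 1 ≤ s) (hz : IsEndpoint s z t) {u f J : ℝ} (hu0 : 0 ≤ u) (hu1 : u ≤ 1)
    (hJ : u * z = 4 * J) (hf : IsLeast {x | gapCubic (s * (s + 1)) (4 * J) x = 0} f) (hf0 : 0 ≤ f)
    {v : EuclideanSpace ℂ (T × Fin 3 → Fin (2 * s + 1))}
    (hv : v ∈ (ℂ ∙ (WithLp.toLp 2 (productState φ) :
      EuclideanSpace ℂ (T × Fin 3 → Fin (2 * s + 1))))ᗮ) :
    f * ‖v‖ ^ 2 ≤ (⟪v, networkEnergy s A S c J v⟫_ℂ).re := by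
  have h1 := h.re_inner_networkEnergy J v
  have h2 := mul_le_mul_of_nonneg_left (h.four_mul_le_sum hφ hv) hf0
  rw [Finset.mul_sum] at h2
  have h3 : ∀ p, f * (‖v‖ ^ 2 - ‖(singletPair s A S p).starProjection v‖ ^ 2) ≤
      (⟪v, pairEnergy (triangleSpin s (A p)) (siteSpin s (A p, c p)) (triangleSpin s (S p))
        (4 * J) v⟫_ℂ).re := fun p => by
    have hP := isPair_triangleSpin (s := s) (h.ne p) (c p)
    set K := singletPair s A S p
    have h4 := hP.energy_singlets (J := 4 * J) (K.starProjection_apply_mem v)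
    have h5 := hP.le_re_inner_energy hs hz hu0 hu1 (by rwa [hJ])
      (K.sub_starProjection_mem_orthogonal v)
    rw [hJ, map_sub, h4, sub_zero, inner_sub_left, ← hP.symm_energy _ (K.starProjection v), h4,
      inner_zero_left, sub_zero] at h5
    rw [re_inner_sub_starProjection K v]
    linarith
  have h4 := Finset.sum_le_sum fun p (_ : p ∈ Finset.univ) => h3 p
  linarith

theorem IsEndpoint.re_inner_networkEnergy_nonneg (hz : IsEndpoint s z t) (hs : 1 ≤ s)
    (h : IsNetwork A S c) (v : EuclideanSpace ℂ (T × Fin 3 → Fin (2 * s + 1))) :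
    0 ≤ (⟪v, networkEnergy s A S c (z / 4) v⟫_ℂ).re := by
  have h1 := h.re_inner_networkEnergy (z / 4) v
  rw [mul_div_cancel₀ z four_ne_zero] at h1
  have h2 := Finset.sum_nonneg fun p (_ : p ∈ Finset.univ) =>
    hz.energy_nonneg hs (isPair_triangleSpin (s := s) (h.ne p) (c p)) v
  linarith

/-- At the endpoints, the product of the singlets is still the only state of lowest energy. -/
theorem IsEndpoint.mem_span_of_networkEnergy_eq_zero (hz : IsEndpoint s z t) (hs : 1 ≤ s)
    (h : IsNetwork A S c) (hφ : IsTrimerSinglet s φ)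
    {v : EuclideanSpace ℂ (T × Fin 3 → Fin (2 * s + 1))}
    (hv : networkEnergy s A S c (z / 4) v = 0) :
    v ∈ ℂ ∙ (WithLp.toLp 2 (productState φ) :
      EuclideanSpace ℂ (T × Fin 3 → Fin (2 * s + 1))) := by
  have hP := fun p => isPair_triangleSpin (s := s) (h.ne p) (c p)
  have h1 := h.re_inner_networkEnergy (z / 4) v
  rw [mul_div_cancel₀ z four_ne_zero, hv, inner_zero_right, Complex.zero_re, mul_zero] at h1
  have h2 := (Finset.sum_eq_zero_iff_of_nonneg fun p _ => hz.energy_nonneg hs (hP p) v).1 h1.symm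
  have h3 : ∀ p, pairEnergy (triangleSpin s (A p)) (siteSpin s (A p, c p)) (triangleSpin s (S p))
      z v = 0 := fun p =>
    apply_eq_zero_of_re_inner_eq_zero ((hP p).symm_energy z) (hz.energy_nonneg hs (hP p))
      (h2 p (Finset.mem_univ p))
  refine mem_span_productState hφ fun t => ?_
  obtain ⟨p, hp⟩ := h.target t
  obtain ⟨p₀, hp₀, hc₀⟩ := h.corner_zero t
  obtain ⟨p₁, hp₁, hc₁⟩ := h.corner_one t
  -- As the target of some connection, the triangle `t` has spin zero or one; as the source through
  -- its corners `0` and `1`, it then satisfies both conditions of `eq_zero_of_corners`.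
  have hC := hz.casimirS_of_energy_eq_zero (hP p) (h3 p)
  have hP₀ := hP p₀
  have hP₁ := hP p₁
  have e₀ := h3 p₀
  have e₁ := h3 p₁
  rw [hp] at hC
  rw [hp₀, hc₀] at hP₀ e₀
  rw [hp₁, hc₁] at hP₁ e₁
  refine hP₀.eq_zero_of_corners hP₁ hs (commute_siteSpin ?_)
    (hz.sub_apply_casimirA hs hP₀ e₀ hC) (hz.sub_apply_casimirA hs hP₁ e₁ hC)
  simp

theorem IsEndpoint.exists_pos_networkEnergy_nonneg (hz : IsEndpoint s z t) (hs : 1 ≤ s)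
    (h : IsNetwork A S c) : ∃ ε > 0, ∀ t : ℝ, |t| ≤ ε →
      ∀ v, 0 ≤ (⟪v, networkEnergy s A S c (z / 4 + t) v⟫_ℂ).re := by
  obtain ⟨φ, hφ⟩ := exists_isTrimerSinglet s
  obtain ⟨ε, hε, hle⟩ := exists_pos_perturbation (h.symm_networkEnergy (z / 4)) h.symm_couplingOp
    (hz.re_inner_networkEnergy_nonneg hs h) fun v hv => by
      obtain ⟨a, rfl⟩ :=
        Submodule.mem_span_singleton.1 (hz.mem_span_of_networkEnergy_eq_zero hs h hφ hv)
      rw [map_smul, couplingOp_productState hφ, smul_zero]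
  refine ⟨ε, hε, fun t ht v => ?_⟩
  rw [re_inner_networkEnergy_add]
  exact hle t ht v

end Network

/-! ### Diagonal entries -/

section Diagonal

variable {s : ℕ} {ι : Type} [Fintype ι] [DecidableEq ι]

theorem siteOp_mul_siteOp_diag {i j : ι} (hij : i ≠ j)
    (M N : Matrix (Fin (2 * s + 1)) (Fin (2 * s + 1)) ℂ) (σ : ι → Fin (2 * s + 1)) :
    (siteOp i M * siteOp j N) σ σ = M (σ i) (σ i) * N (σ j) (σ j) := by
  rw [Matrix.mul_apply, Finset.sum_eq_single σ]
  · simp [siteOp]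
  · intro τ _ hτ
    simp only [siteOp, Matrix.of_apply]
    by_cases h1 : ∀ k, k ≠ i → σ k = τ k
    · by_cases h2 : ∀ k, k ≠ j → τ k = σ k
      · refine absurd (funext fun k => ?_) hτ
        by_cases hk : k = i
        · exact h2 k (hk ▸ hij)
        · exact (h1 k hk).symm
      · rw [if_neg h2, mul_zero]
    · rw [if_neg h1, zero_mul]
  · simp

theorem bond_diag {i j : ι} (hij : i ≠ j) (σ : ι → Fin (2 * s + 1)) :
    bond s i j σ σ = ((magnetic s (σ i) * magnetic s (σ j) : ℝ) : ℂ) := by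
  have h : ∀ k, spinPlus s k k = 0 := fun k => by rw [spinPlus_apply, if_neg (by omega)]
  simp only [bond, Fin.sum_univ_three, Matrix.add_apply, siteOp_mul_siteOp_diag hij, spinVec_zero,
    spinVec_one, spinVec_two, Matrix.smul_apply, Matrix.sub_apply, Matrix.conjTranspose_apply, h,
    Matrix.diagonal_apply_eq]
  simp

theorem inner_toOp_single {n : Type} [Fintype n] [DecidableEq n] (B : Matrix n n ℂ) (i : n) :
    ⟪EuclideanSpace.single i (1 : ℂ), toOp B (EuclideanSpace.single i 1)⟫_ℂ = B i i := by
  rw [EuclideanSpace.inner_single_left, toOp_apply]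
  simp

end Diagonal


/-! ### The modified Shastry-Sutherland lattice -/

section Lattice

variable {s : ℕ} (L₁ L₂ : ℕ)

/-- The connections between the triangles; there are four of them in each unit cell. -/
abbrev Connection : Type := (ZMod L₁ × ZMod L₂) × Fin 4

variable {L₁ L₂}

/-- The triangle of which one corner is connected to another triangle. -/
def sourceTriangle (p : Connection L₁ L₂) : Triangle L₁ L₂ :=
  ![(1, p.1), (1, p.1), (0, p.1), (0, p.1)] p.2

/-- The corner of the triangle `sourceTriangle p` that is connected to another triangle. -/
def sourceCorner (p : Connection L₁ L₂) : Fin 3 := ![0, 1, 1, 0] p.2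

/-- The triangle all of whose sites are connected to a corner of `sourceTriangle p`. -/
def targetTriangle (p : Connection L₁ L₂) : Triangle L₁ L₂ :=
  ![(0, p.1 + (0, 1)), (0, p.1 + (1, 0)), (1, p.1), (1, p.1 - (1, 1))] p.2

theorem sourceTriangle_fst_ne (p : Connection L₁ L₂) :
    (sourceTriangle p).1 ≠ (targetTriangle p).1 := by
  obtain ⟨k, i⟩ := p
  fin_cases i <;> simp [sourceTriangle, targetTriangle]

variable (s L₁ L₂) in
/-- The configuration in which the spins of all triangles of type I, and those of the triangles of
type II if `b` is true, point up, and the others down. -/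
def polarized (b : Bool) : Triangle L₁ L₂ × Fin 3 → Fin (2 * s + 1) := fun i =>
  if i.1.1 = 0 ∨ b = true then ⟨2 * s, by omega⟩ else ⟨0, by omega⟩

theorem magnetic_polarized_mul_same (b : Bool) (t : Triangle L₁ L₂) (d d' : Fin 3) :
    magnetic s (polarized s L₁ L₂ b (t, d)) * magnetic s (polarized s L₁ L₂ b (t, d')) = s ^ 2 := by
  unfold magnetic polarized
  simp only
  split_ifs <;> push_cast <;> ring

theorem magnetic_polarized_mul (b : Bool) {t t' : Triangle L₁ L₂} (h : t.1 ≠ t'.1) (d d' : Fin 3) :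
    magnetic s (polarized s L₁ L₂ b (t, d)) * magnetic s (polarized s L₁ L₂ b (t', d')) =
      (if b = true then 1 else -1) * s ^ 2 := by
  obtain ⟨i, k⟩ := t
  obtain ⟨i', k'⟩ := t'
  unfold magnetic polarized
  cases b <;> fin_cases i <;> fin_cases i' <;> simp at h ⊢ <;> ring

variable [NeZero L₁] [NeZero L₂]

/-- Connections join triangles of different types and translations are bijections, so this holds for
all sizes, even where periodic images coincide. -/
theorem isNetwork_lattice :
    IsNetwork (sourceTriangle (L₁ := L₁) (L₂ := L₂)) targetTriangle sourceCorner where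
  ne p h := sourceTriangle_fst_ne p (congrArg Prod.fst h)
  count t := by
    obtain ⟨i, k⟩ := t
    rw [Fintype.sum_prod_type]
    simp only [Fin.sum_univ_four, sourceTriangle, targetTriangle, Matrix.cons_val]
    fin_cases i <;>
      simp [Finset.sum_add_distrib, ← eq_sub_iff_add_eq, sub_eq_iff_eq_add]
  corner_zero t := by
    obtain ⟨i, k⟩ := t
    fin_cases i
    · exact ⟨(k, 3), rfl, rfl⟩
    · exact ⟨(k, 0), rfl, rfl⟩
  corner_one t := by
    obtain ⟨i, k⟩ := t
    fin_cases i
    · exact ⟨(k, 2), rfl, rfl⟩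
    · exact ⟨(k, 1), rfl, rfl⟩
  target t := by
    obtain ⟨i, k⟩ := t
    fin_cases i
    · exact ⟨(k - (0, 1), 0), by simp [targetTriangle]⟩
    · exact ⟨(k, 2), rfl⟩

variable (s L₁ L₂) in
/-- The bonds between the triangles of the lattice. -/
noncomputable abbrev latticeCoupling : Module.End ℂ (EuclideanSpace ℂ (Triangle L₁ L₂ × Fin 3 →
    Fin (2 * s + 1))) :=
  couplingOp s (sourceTriangle (L₁ := L₁) (L₂ := L₂)) targetTriangle sourceCorner

variable (s L₁ L₂) in
/-- The energy of the lattice, relative to that of the product of the singlets. -/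
noncomputable abbrev latticeEnergy (J : ℝ) : Module.End ℂ (EuclideanSpace ℂ (Triangle L₁ L₂ × Fin 3 →
    Fin (2 * s + 1))) :=
  networkEnergy s (sourceTriangle (L₁ := L₁) (L₂ := L₂)) targetTriangle sourceCorner J

variable (s L₁ L₂) in
/-- The energy of the product of the singlets. -/
noncomputable def singletEnergy : ℝ :=
  -(Fintype.card (Triangle L₁ L₂) * (3 / 2 * (s * (s + 1))))

theorem latticeHamiltonian_eq (J : ℝ) : latticeHamiltonian s L₁ L₂ J =
    ∑ t : Triangle L₁ L₂, triangle s t + (J : ℂ) • ∑ p : Connection L₁ L₂,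
      threeBonds s (sourceTriangle p) (sourceCorner p) (targetTriangle p) := by
  rw [latticeHamiltonian, Fintype.sum_prod_type (f := fun p : Connection L₁ L₂ => _)]
  simp only [Fin.sum_univ_four]
  rfl

theorem toOp_latticeHamiltonian (J : ℝ) : toOp (latticeHamiltonian s L₁ L₂ J) =
    latticeEnergy s L₁ L₂ J + ((singletEnergy s L₁ L₂ : ℝ) : ℂ) • 1 := by
  rw [latticeHamiltonian_eq, map_add, map_smul, map_sum, map_sum]
  simp only [toOp_triangle_eq, toOp_threeBonds]
  rw [Finset.sum_sub_distrib, Finset.sum_const, latticeEnergy, networkEnergy, couplingOp,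
    ← Finset.smul_sum, Finset.card_univ, singletEnergy, ← Nat.cast_smul_eq_nsmul ℂ]
  push_cast
  module

theorem toOp_latticeHamiltonian_isSymmetric (J : ℝ) :
    (toOp (latticeHamiltonian s L₁ L₂ J)).IsSymmetric := by
  rw [toOp_latticeHamiltonian]
  exact (isNetwork_lattice.symm_networkEnergy J).add (isSymmetric_ofReal_smul isSymmetric_one _)

theorem re_inner_latticeHamiltonian (J : ℝ)
    (v : EuclideanSpace ℂ (Triangle L₁ L₂ × Fin 3 → Fin (2 * s + 1))) :
    (⟪v, toOp (latticeHamiltonian s L₁ L₂ J) v⟫_ℂ).re =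
      (⟪v, latticeEnergy s L₁ L₂ J v⟫_ℂ).re + singletEnergy s L₁ L₂ * ‖v‖ ^ 2 := by
  rw [toOp_latticeHamiltonian, LinearMap.add_apply, inner_add_right, Complex.add_re,
    LinearMap.smul_apply, Module.End.one_apply, re_inner_smul_self]

variable {φ : StateVec s (Fin 3)}

theorem latticeHamiltonian_mulVec (hφ : IsTrimerSinglet s φ) (J : ℝ) :
    latticeHamiltonian s L₁ L₂ J *ᵥ productState φ =
      ((singletEnergy s L₁ L₂ : ℝ) : ℂ) • productState φ := by
  have h : toOp (latticeHamiltonian s L₁ L₂ J) (WithLp.toLp 2 (productState φ)) =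
      ((singletEnergy s L₁ L₂ : ℝ) : ℂ) • WithLp.toLp 2 (productState φ) := by
    rw [toOp_latticeHamiltonian, LinearMap.add_apply, networkEnergy_productState hφ, zero_add,
      LinearMap.smul_apply, Module.End.one_apply]
  rw [toOp_apply] at h
  exact congrArg WithLp.ofLp h

theorem isGroundState_lattice_iff (hφ : IsTrimerSinglet s φ) (J : ℝ) :
    IsGroundState (latticeHamiltonian s L₁ L₂ J) (productState φ) ↔
      ∀ v, 0 ≤ (⟪v, latticeEnergy s L₁ L₂ J v⟫_ℂ).re := by
  rw [isGroundState_iff (toOp_latticeHamiltonian_isSymmetric J) (productState_ne_zero hφ)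
    (latticeHamiltonian_mulVec hφ J)]
  refine forall_congr' fun v => ?_
  rw [re_inner_latticeHamiltonian]
  exact ⟨fun h => by linarith, fun h => by linarith⟩

variable (s L₁ L₂) in
theorem tspgsRegion_eq : tspgsRegion s L₁ L₂ =
    {J | ∀ v, 0 ≤ (⟪v, latticeEnergy s L₁ L₂ 0 v⟫_ℂ).re
      + J * (⟪v, latticeCoupling s L₁ L₂ v⟫_ℂ).re} := by
  ext J
  simp only [← re_inner_networkEnergy_add, zero_add]
  constructor
  · rintro ⟨φ, hφ, h⟩
    exact (isGroundState_lattice_iff hφ J).1 h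
  · intro h
    obtain ⟨φ, hφ⟩ := exists_isTrimerSinglet s
    exact ⟨φ, hφ, (isGroundState_lattice_iff hφ J).2 h⟩

/-! ### Fully polarized states -/

theorem triangle_diag (b : Bool) (t : Triangle L₁ L₂) :
    triangle s t (polarized s L₁ L₂ b) (polarized s L₁ L₂ b) = ((3 * s ^ 2 : ℝ) : ℂ) := by
  simp only [triangle, Matrix.add_apply]
  rw [bond_diag (by simp), bond_diag (by simp), bond_diag (by simp)]
  simp only [magnetic_polarized_mul_same]
  push_cast
  ring

theorem threeBonds_diag (b : Bool) {t t' : Triangle L₁ L₂} (h : t.1 ≠ t'.1) (c : Fin 3) :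
    threeBonds s t c t' (polarized s L₁ L₂ b) (polarized s L₁ L₂ b) =
      ((3 * ((if b = true then 1 else -1) * s ^ 2) : ℝ) : ℂ) := by
  simp only [threeBonds, Matrix.sum_apply, Fin.sum_univ_three]
  have hne : ∀ d, ((t, c) : Triangle L₁ L₂ × Fin 3) ≠ (t', d) := fun d h' =>
    h (congrArg (fun i => i.1.1) h')
  rw [bond_diag (hne _), bond_diag (hne _), bond_diag (hne _)]
  simp only [magnetic_polarized_mul b h]
  push_cast
  ring

variable (s L₁ L₂) in
/-- The basis state of the configuration `polarized s L₁ L₂ b`. -/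
noncomputable def polarizedState (b : Bool) :
    EuclideanSpace ℂ (Triangle L₁ L₂ × Fin 3 → Fin (2 * s + 1)) :=
  EuclideanSpace.single (polarized s L₁ L₂ b) 1

theorem re_inner_coupling_polarized (b : Bool) :
    (⟪polarizedState s L₁ L₂ b, latticeCoupling s L₁ L₂ (polarizedState s L₁ L₂ b)⟫_ℂ).re =
      Fintype.card (Connection L₁ L₂) * (3 * ((if b = true then 1 else -1) * s ^ 2)) := by
  have h : latticeCoupling s L₁ L₂ = toOp (∑ p : Connection L₁ L₂,
      threeBonds s (sourceTriangle p) (sourceCorner p) (targetTriangle p)) := by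
    rw [map_sum]
    simp only [toOp_threeBonds]
    rfl
  rw [h, polarizedState, inner_toOp_single, Matrix.sum_apply,
    Finset.sum_congr rfl fun p _ => threeBonds_diag b (sourceTriangle_fst_ne p) (sourceCorner p),
    Finset.sum_const, Finset.card_univ, nsmul_eq_mul, ← Complex.ofReal_natCast,
    ← Complex.ofReal_mul, Complex.ofReal_re]

theorem re_inner_latticeHamiltonian_polarized (b : Bool) (J : ℝ) :
    (⟪polarizedState s L₁ L₂ b,
      toOp (latticeHamiltonian s L₁ L₂ J) (polarizedState s L₁ L₂ b)⟫_ℂ).re =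
      Fintype.card (Triangle L₁ L₂) * (3 * s ^ 2) +
        J * (Fintype.card (Connection L₁ L₂) * (3 * ((if b = true then 1 else -1) * s ^ 2))) := by
  rw [polarizedState, inner_toOp_single, latticeHamiltonian_eq, Matrix.add_apply,
    Matrix.smul_apply, Matrix.sum_apply, Matrix.sum_apply,
    Finset.sum_congr rfl fun p _ => threeBonds_diag b (sourceTriangle_fst_ne p) (sourceCorner p),
    Finset.sum_congr rfl fun t _ => triangle_diag b t]
  simp only [Finset.sum_const, Finset.card_univ, nsmul_eq_mul, smul_eq_mul,
    ← Complex.ofReal_natCast, ← Complex.ofReal_mul, ← Complex.ofReal_add, Complex.ofReal_re]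

/-- For a constant form every expectation value would be the negative singlet energy. But in the two
polarized states the coupling terms cancel on summation, and the mean energy is nonnegative. -/
theorem exists_isGap_lattice (hs : 1 ≤ s) (J : ℝ) :
    ∃ g, IsGap (latticeHamiltonian s L₁ L₂ J) g := by
  refine exists_isGap (toOp_latticeHamiltonian_isSymmetric J) ?_
  rintro ⟨E, hE⟩
  obtain ⟨φ, hφ⟩ := exists_isTrimerSinglet s
  have hΦ : (WithLp.toLp 2 (productState φ) :
      EuclideanSpace ℂ (Triangle L₁ L₂ × Fin 3 → Fin (2 * s + 1))) ≠ 0 := fun h =>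
    productState_ne_zero hφ (congrArg WithLp.ofLp h)
  have h0 := hE (WithLp.toLp 2 (productState φ))
  rw [toOp_toLp_eq (latticeHamiltonian_mulVec hφ J), re_inner_smul_self] at h0
  have hE0 := mul_right_cancel₀ (pow_ne_zero 2 (norm_ne_zero_iff.2 hΦ)) h0
  have hn : ∀ b, ‖polarizedState s L₁ L₂ b‖ = 1 := fun b => by simp [polarizedState]
  have h1 := hE (polarizedState s L₁ L₂ true)
  have h2 := hE (polarizedState s L₁ L₂ false)
  rw [re_inner_latticeHamiltonian_polarized, hn] at h1 h2
  simp only [if_true, Bool.false_eq_true, if_false] at h1 h2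
  have hc : (0 : ℝ) < Fintype.card (Triangle L₁ L₂) := by exact_mod_cast Fintype.card_pos
  have hr := two_le_mul_add_one hs
  have h3 : 0 ≤ (Fintype.card (Triangle L₁ L₂) : ℝ) * (3 * s ^ 2) := by positivity
  have h4 : 0 < (Fintype.card (Triangle L₁ L₂) : ℝ) * (3 / 2 * (s * (s + 1))) := by positivity
  unfold singletEnergy at hE0
  linarith

/-- The coupling has opposite signs in the two polarized states, which bounds the region on both
sides; strictness is the perturbation result at the endpoints. -/
theorem exists_tspgsRegion_eq_Icc (hs : 1 ≤ s) {z₁ t₁ z₂ t₂ : ℝ} (h₁ : IsEndpoint s z₁ t₁)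
    (h₂ : IsEndpoint s z₂ t₂) :
    ∃ a b, tspgsRegion s L₁ L₂ = Set.Icc a b ∧ a < z₁ / 4 ∧ z₂ / 4 < b := by
  have hmem : ∀ J : ℝ, (∀ v, 0 ≤ (⟪v, latticeEnergy s L₁ L₂ J v⟫_ℂ).re) →
      J ∈ tspgsRegion s L₁ L₂ := fun J hJ => by
    rw [tspgsRegion_eq]
    intro v
    rw [← re_inner_networkEnergy_add, zero_add]
    exact hJ v
  have hc : (0 : ℝ) < Fintype.card (Connection L₁ L₂) := by exact_mod_cast Fintype.card_pos
  have hs' : (0 : ℝ) < s := by exact_mod_cast hs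
  have hne := hmem _ (h₁.re_inner_networkEnergy_nonneg hs isNetwork_lattice)
  rw [tspgsRegion_eq] at hne
  obtain ⟨a, b, hab⟩ := exists_eq_Icc
    (fun v => (⟪v, latticeEnergy s L₁ L₂ 0 v⟫_ℂ).re)
    (fun v => (⟪v, latticeCoupling s L₁ L₂ v⟫_ℂ).re) ⟨_, hne⟩
    (v := polarizedState s L₁ L₂ true) (w := polarizedState s L₁ L₂ false)
    (by
      simp only [re_inner_coupling_polarized, if_true]
      positivity)
    (by
      simp only [re_inner_coupling_polarized, Bool.false_eq_true, if_false]
      have : 0 < (Fintype.card (Connection L₁ L₂) : ℝ) * (3 * s ^ 2) := by positivity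
      linarith)
  rw [← tspgsRegion_eq] at hab
  refine ⟨a, b, hab, ?_, ?_⟩
  · obtain ⟨ε, hε, h⟩ := h₁.exists_pos_networkEnergy_nonneg hs (isNetwork_lattice (L₁ := L₁) (L₂ := L₂))
    have := hmem _ (h (-ε) (by rw [abs_neg, abs_of_pos hε]))
    rw [hab] at this
    linarith [this.1]
  · obtain ⟨ε, hε, h⟩ := h₂.exists_pos_networkEnergy_nonneg hs (isNetwork_lattice (L₁ := L₁) (L₂ := L₂))
    have := hmem _ (h ε (by rw [abs_of_pos hε]))
    rw [hab] at this
    linarith [this.2]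

theorem le_re_inner_latticeHamiltonian (hφ : IsTrimerSinglet s φ) (hs : 1 ≤ s) {z t u f J : ℝ}
    (hz : IsEndpoint s z t) (hu0 : 0 ≤ u) (hu1 : u ≤ 1) (hJ : u * z = 4 * J)
    (hf : IsLeast {x | gapCubic (s * (s + 1)) (4 * J) x = 0} f) (hf0 : 0 ≤ f) :
    ∀ v ∈ (ℂ ∙ (WithLp.toLp 2 (productState φ) :
      EuclideanSpace ℂ (Triangle L₁ L₂ × Fin 3 → Fin (2 * s + 1))))ᗮ,
      (singletEnergy s L₁ L₂ + f) * ‖v‖ ^ 2 ≤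
        (⟪v, toOp (latticeHamiltonian s L₁ L₂ J) v⟫_ℂ).re := fun v hv => by
  have := isNetwork_lattice.le_re_inner_networkEnergy hφ hs hz hu0 hu1 hJ hf hf0 hv
  rw [re_inner_latticeHamiltonian]
  linarith

end Lattice

end ShastrySutherland
-- Ground states and gaps for all couplings
open ShastrySutherland in
theorem mainTheorem2 (s : ℕ) (hs : 1 ≤ s) :
    ∃ (f : ℝ → ℝ) (φ : ShastrySutherland.StateVec s (Fin 3)) (JL1 JL2 : ℝ),
      (∀ J : ℝ, IsLeast
        {x : ℝ | ShastrySutherland.gapCubic ((s : ℝ) * (s + 1)) J x = 0} (f J)) ∧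
      ShastrySutherland.IsTrimerSinglet s φ ∧
      ShastrySutherland.IsUniqueGroundState (ShastrySutherland.trimerHamiltonian s) φ ∧
      (∀ J : ℝ, 0 < f J →
        ShastrySutherland.IsUniqueGroundState (ShastrySutherland.H6 s J)
          (ShastrySutherland.productState φ) ∧
        ShastrySutherland.IsGap (ShastrySutherland.H6 s J) (f J)) ∧
      JL1 < 0 ∧ 0 < JL2 ∧
      (∀ J : ℝ, 0 < f (4 * J) ↔ JL1 < J ∧ J < JL2) ∧
      (s = 1 → JL1 = (3 - √73) / 16 ∧ JL2 = 1 / 4) ∧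
      ∀ (L₁ L₂ : ℕ) [NeZero L₁] [NeZero L₂],
        (∀ J : ℝ, ∃ ΔE : ℝ,
          ShastrySutherland.IsGap (ShastrySutherland.latticeHamiltonian s L₁ L₂ J) ΔE ∧
          f (4 * J) ≤ ΔE) ∧
        (∀ J : ℝ, JL1 < J → J < JL2 →
          ShastrySutherland.IsUniqueGroundState (ShastrySutherland.latticeHamiltonian s L₁ L₂ J)
            (ShastrySutherland.productState φ)) ∧
        ∃ Jc1 Jc2 : ℝ,
          ShastrySutherland.tspgsRegion s L₁ L₂ = Set.Icc Jc1 Jc2 ∧ Jc1 < JL1 ∧ JL2 < Jc2 := by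
  obtain ⟨z₁, t₁, z₂, t₂, hz₁, hz₂, he₁, he₂, hpos⟩ := exists_endpoints hs
  choose f hf using fun J : ℝ => exists_isLeast_root ((s : ℝ) * (s + 1)) J
  obtain ⟨φ, hφ⟩ := exists_isTrimerSinglet s
  have hscale : ∀ J : ℝ, z₁ < J → J < z₂ →
      ∃ z t u : ℝ, IsEndpoint s z t ∧ 0 ≤ u ∧ u ≤ 1 ∧ u * z = J := fun J h₁ h₂ => by
    rcases le_or_gt 0 J with hJ | hJ
    · exact ⟨z₂, t₂, J / z₂, he₂, by positivity, ((div_lt_one hz₂).2 h₂).le,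
        div_mul_cancel₀ _ hz₂.ne'⟩
    · exact ⟨z₁, t₁, J / z₁, he₁, div_nonneg_of_nonpos hJ.le hz₁.le,
        ((div_lt_one_of_neg hz₁).2 h₁).le, div_mul_cancel₀ _ hz₁.ne⟩
  have hiff : ∀ J : ℝ, 0 < f (4 * J) ↔ z₁ / 4 < J ∧ J < z₂ / 4 := fun J => by
    rw [hpos _ _ (hf (4 * J)), div_lt_iff₀ four_pos, lt_div_iff₀ four_pos, mul_comm J]
  refine ⟨f, φ, z₁ / 4, z₂ / 4, hf, hφ, isUniqueGroundState_trimer hφ, fun J hJ => ?_,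
    by linarith, by linarith, hiff, ?_, ?_⟩
  · obtain ⟨h₁, h₂⟩ := (hpos J _ (hf J)).1 hJ
    obtain ⟨z, t, u, he, hu0, hu1, rfl⟩ := hscale J h₁ h₂
    exact H6_ground_state_and_gap hs hφ he hu0 hu1 (hf _) hJ
  · rintro rfl
    exact ⟨(gapCubic_zero_one_roots he₁.root).1 hz₁, (gapCubic_zero_one_roots he₂.root).2 hz₂
      he₂.le_one⟩
  · intro L₁ L₂ _ _
    have hbound : ∀ J : ℝ, 0 < f (4 * J) → ∀ v ∈ (ℂ ∙ (WithLp.toLp 2 (productState φ) :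
        EuclideanSpace ℂ (Triangle L₁ L₂ × Fin 3 → Fin (2 * s + 1))))ᗮ,
        (singletEnergy s L₁ L₂ + f (4 * J)) * ‖v‖ ^ 2 ≤
          (⟪v, toOp (latticeHamiltonian s L₁ L₂ J) v⟫_ℂ).re := fun J hJ => by
      obtain ⟨h₁, h₂⟩ := (hpos _ _ (hf (4 * J))).1 hJ
      obtain ⟨z, t, u, he, hu0, hu1, hu⟩ := hscale _ h₁ h₂
      exact le_re_inner_latticeHamiltonian hφ hs he hu0 hu1 hu (hf _) hJ.le
    refine ⟨fun J => ?_, fun J h₁ h₂ => ?_, exists_tspgsRegion_eq_Icc hs he₁ he₂⟩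
    · obtain ⟨g, hg⟩ := exists_isGap_lattice (s := s) (L₁ := L₁) (L₂ := L₂) hs J
      refine ⟨g, hg, ?_⟩
      -- When `f (4 * J)` is not positive, the bound holds merely because gaps are positive, even if
      -- the product state is no ground state.
      rcases le_or_gt (f (4 * J)) 0 with hJ | hJ
      · exact hJ.trans hg.pos.le
      · exact IsGap.le (toOp_latticeHamiltonian_isSymmetric J) (productState_ne_zero hφ)
          (latticeHamiltonian_mulVec hφ J) hJ (hbound J hJ) hg
    · have hJ := (hiff J).2 ⟨h₁, h₂⟩
      exact isUniqueGroundState_of_le (toOp_latticeHamiltonian_isSymmetric J)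
        (productState_ne_zero hφ) (latticeHamiltonian_mulVec hφ J) hJ (hbound J hJ)
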